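/- For integers $p,q,r\ge 2$ let $\Gamma(p,q,r)=\langle \alpha,\beta \mid \alpha^p=\beta^q=(\alpha\beta)^r=e\rangle$. Let $\Gamma$ be one of the spherical triangle groups $\Gamma(2,2,n)$ ($n\ge 2$), $\Gamma(2,3,3)$, $\Gamma(2,3,4)$, $\Gamma(2,3,5)$. Then: (1) $\Gamma$ is finite, with $|\Gamma|=2n$ for $\Gamma(2,2,n)$, and $|\Gamma|=12$, $24$, $60$ for $\Gamma(2,3,3)$, $\Gamma(2,3,4)$, $\Gamma(2,3,5)$ respectively; and $\Gamma$ can be realised as a group of rotations of the unit sphere $S^2\subset\mathbb{R}^3$, i.e. there is an injective homomorphism $\rho:\Gamma\to SO(3)$. (2) Let $\rho:\Gamma\to SO(3)$ be any injective homomorphism. For $\lambda\in\mathbb{R}$ let $\mu_\Gamma(\lambda)$ be the complex dimension of the space of smooth functions $f:S^2\to\mathbb{C}$ that are $\Gamma$-invariant ($f(\rho(\gamma)x)=f(x)$ for all $\gamma\in\Gamma$, $x\in S^2$) and satisfy $-\Delta f=\lambda f$, where $\Delta$ is the Laplace--Beltrami operator of the round sphere; that is, $\mu_\Gamma(\lambda)$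 is the multiplicity of $\lambda$ as an eigenvalue of the quotient orbifold $S^2/\Gamma$. All these spaces are finite dimensional, for each $\Lambda\in\mathbb{R}$ only finitely many $\lambda\le\Lambda$ have a non-zero eigenspace, and the counting function $N_\Gamma(L)=\sum_{\lambda\le L(L+1)}\mu_\Gamma(\lambda)$, $L\in\{0,1,2,\dots\}$, satisfies $$N_\Gamma(L)=\frac{(L+1)^2}{|\Gamma|}+O(1),$$ that is, there is a constant $C$, which may depend on $\Gamma$, with $\left|N_\Gamma(L)-(L+1)^2/|\Gamma|\right|\le C$ for all integers $L\ge 0$. (3) For $\Gamma=\Gamma(2,2,n)$, $n\ge 2$, one has exactly, for all integers $L\ge 0$, $$N_{\Gamma(2,2,n)}(L)=1+\left\lfloor \tfrac{L}{2}\right\rfloor+\sum_{k=1}^{\lfloor L/n\rfloor}(L-kn+1).$$ (4) For every integer $n\ge 2$ there is a constant $C_n$ such that for all integers $L\ge 0$ $$\left|\sum_{l=0}^{L}\ \sum_{s=1}^{n-1}\frac{\sin\left((2l+1)\frac{s\pi}{n}\right)}{\sin\frac{s\pi}{n}}\right|\le C_n .$$ -/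

import Mathlib

open scoped Manifold ContDiff Laplacian

/-- The triangle group `Γ(p,q,r) = ⟨α, β | α^p = β^q = (αβ)^r = e⟩`;
the generators are `α = of 0` and `β = of 1`. -/
abbrev TriangleGroup (p q r : ℕ) : Type :=
  PresentedGroup
    ({FreeGroup.of 0 ^ p, FreeGroup.of 1 ^ q, (FreeGroup.of 0 * FreeGroup.of 1) ^ r} :
      Set (FreeGroup (Fin 2)))

/-- The round unit sphere `S²` in Euclidean `ℝ³`. -/
abbrev Sphere2 : Type := Metric.sphere (0 : EuclideanSpace ℝ (Fin 3)) 1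

/-- The rotation group `SO(3)`. -/
abbrev SO3 : Type := Matrix.specialOrthogonalGroup (Fin 3) ℝ

theorem SO3.norm_apply (g : SO3) (x : EuclideanSpace ℝ (Fin 3)) :
    ‖Matrix.toEuclideanLin (g : Matrix (Fin 3) (Fin 3) ℝ) x‖ = ‖x‖ := by
  have h : (g : Matrix (Fin 3) (Fin 3) ℝ).transpose * (g : Matrix (Fin 3) (Fin 3) ℝ) = 1 := by
    have h1 := (Matrix.mem_specialOrthogonalGroup_iff.mp g.2).1
    simpa [Matrix.star_eq_conjTranspose] using (Matrix.mem_orthogonalGroup_iff' (Fin 3) ℝ).mp h1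
  have key : inner ℝ (Matrix.toEuclideanLin (g : Matrix (Fin 3) (Fin 3) ℝ) x)
      (Matrix.toEuclideanLin (g : Matrix (Fin 3) (Fin 3) ℝ) x) = inner ℝ x x := by
    simp only [EuclideanSpace.inner_eq_star_dotProduct, star_trivial]
    simp only [Matrix.toLpLin_apply]
    rw [Matrix.dotProduct_mulVec, ← Matrix.mulVec_transpose, Matrix.mulVec_mulVec, h,
      Matrix.one_mulVec]
  rw [real_inner_self_eq_norm_sq, real_inner_self_eq_norm_sq] at key
  exact (sq_eq_sq₀ (norm_nonneg _) (norm_nonneg _)).mp key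

/-- The action of a rotation on the sphere. -/
noncomputable def SO3.rotate (g : SO3) (x : Sphere2) : Sphere2 :=
  ⟨Matrix.toEuclideanLin (g : Matrix (Fin 3) (Fin 3) ℝ) x, by
    rw [mem_sphere_zero_iff_norm, SO3.norm_apply, norm_eq_of_mem_sphere]⟩

/-- The radial projection `y ↦ y / |y|` of `ℝ³ \ {0}` to the sphere. -/
noncomputable def radialProj (y : EuclideanSpace ℝ (Fin 3)) (hy : y ≠ 0) : Sphere2 :=
  ⟨‖y‖⁻¹ • y, by
    rw [mem_sphere_zero_iff_norm, norm_smul, norm_inv, norm_norm,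
      inv_mul_cancel₀ (norm_ne_zero_iff.mpr hy)]⟩

open Classical in
/-- The extension of `f : S² → ℂ` to `ℝ³ \ {0}` that is constant along rays from the origin
(the value at the origin is irrelevant). -/
noncomputable def radialExt (f : Sphere2 → ℂ) (y : EuclideanSpace ℝ (Fin 3)) : ℂ :=
  if hy : y = 0 then 0 else f (radialProj y hy)

/-- The Laplace-Beltrami operator of the round sphere `S²`: for smooth `f`, its value at `x` is the
Euclidean Laplacian at `x` of the extension of `f` that is constant along rays.
(In polar coordinates `Δ = ∂_r² + (2/r) ∂_r + r⁻² Δ_{S²}`.) -/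
noncomputable def sphereLaplacian (f : Sphere2 → ℂ) (x : Sphere2) : ℂ :=
  Δ (radialExt f) (x : EuclideanSpace ℝ (Fin 3))

/-- Smooth complex-valued functions on the sphere. -/
def SmoothOnSphere (f : Sphere2 → ℂ) : Prop :=
  ContMDiff (𝓡 2) 𝓘(ℝ, ℂ) ∞ f

theorem SmoothOnSphere.contDiffAt_radialExt {f : Sphere2 → ℂ} (hf : SmoothOnSphere f)
    {y : EuclideanSpace ℝ (Fin 3)} (hy : y ≠ 0) : ContDiffAt ℝ ∞ (radialExt f) y := by
  have : Fact (Module.finrank ℝ (EuclideanSpace ℝ (Fin 3)) = 2 + 1) := ⟨by simp⟩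
  let U : TopologicalSpace.Opens (EuclideanSpace ℝ (Fin 3)) := ⟨{0}ᶜ, isOpen_compl_singleton⟩
  have hproj : ContMDiff 𝓘(ℝ, EuclideanSpace ℝ (Fin 3)) (𝓡 2) ∞
      (fun u : U => radialProj u.1 u.2) := by
    have h0 : ContMDiff 𝓘(ℝ, EuclideanSpace ℝ (Fin 3)) 𝓘(ℝ, EuclideanSpace ℝ (Fin 3)) ∞
        (fun u : U => ‖(u : EuclideanSpace ℝ (Fin 3))‖⁻¹ • (u : EuclideanSpace ℝ (Fin 3))) := by
      intro u
      have hu : (u : EuclideanSpace ℝ (Fin 3)) ≠ 0 := u.2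
      refine (contMDiffAt_subtype_iff
        (f := fun z : EuclideanSpace ℝ (Fin 3) => ‖z‖⁻¹ • z)).mpr ?_
      rw [contMDiffAt_iff_contDiffAt]
      exact ((contDiffAt_norm ℝ hu).inv (norm_ne_zero_iff.mpr hu)).smul contDiffAt_id
    exact h0.codRestrict_sphere (n := 2) (fun u => (radialProj u.1 u.2).2)
  have hcomp : ContMDiff 𝓘(ℝ, EuclideanSpace ℝ (Fin 3)) 𝓘(ℝ, ℂ) ∞
      (fun u : U => radialExt f u) := by
    have h1 := ContMDiff.comp hf hproj
    refine h1.congr ?_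
    intro u
    have hu : ¬ (u : EuclideanSpace ℝ (Fin 3)) = 0 := u.2
    simp only [radialExt, dif_neg hu, Function.comp_apply]
  exact contMDiffAt_iff_contDiffAt.mp (contMDiffAt_subtype_iff.mp (hcomp ⟨y, hy⟩))

theorem sphere_ne_zero (x : Sphere2) : (x : EuclideanSpace ℝ (Fin 3)) ≠ 0 :=
  ne_zero_of_mem_unit_sphere x

theorem sphereLaplacian_zero (x : Sphere2) : sphereLaplacian 0 x = 0 := by
  have h : radialExt 0 = fun _ => 0 := by
    funext y
    simp [radialExt]
  simp [sphereLaplacian, h]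

theorem sphereLaplacian_add {f g : Sphere2 → ℂ} (hf : SmoothOnSphere f) (hg : SmoothOnSphere g)
    (x : Sphere2) : sphereLaplacian (f + g) x = sphereLaplacian f x + sphereLaplacian g x := by
  have h : radialExt (f + g) = radialExt f + radialExt g := by
    funext y
    by_cases hy : y = 0 <;> simp [radialExt, hy]
  simp only [sphereLaplacian, h]
  exact ((hf.contDiffAt_radialExt (sphere_ne_zero x)).of_le (by norm_cast)).laplacian_add
    ((hg.contDiffAt_radialExt (sphere_ne_zero x)).of_le (by norm_cast))

theorem sphereLaplacian_smul (c : ℂ) {f : Sphere2 → ℂ} (hf : SmoothOnSphere f)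
    (x : Sphere2) : sphereLaplacian (c • f) x = c * sphereLaplacian f x := by
  have h : radialExt (c • f) = (ContinuousLinearMap.mul ℝ ℂ c) ∘ radialExt f := by
    funext y
    by_cases hy : y = 0 <;> simp [radialExt, hy]
  simp only [sphereLaplacian, h]
  rw [((hf.contDiffAt_radialExt (sphere_ne_zero x)).of_le
    (by norm_cast)).laplacian_CLM_comp_left]
  simp

/-- For a group `G` acting on `S²` by rotations through `ρ`, the eigenspace of (minus) the
Laplace-Beltrami operator of the quotient orbifold `S²/G` for the eigenvalue `ev`: the smooth
`G`-invariant functions `f` on the sphere with `-Δ f = ev • f`. -/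
noncomputable def quotientEigenspace {G : Type*} [Group G] (ρ : G →* SO3) (ev : ℝ) :
    Submodule ℂ (Sphere2 → ℂ) where
  carrier := {f | SmoothOnSphere f ∧ (∀ x, -sphereLaplacian f x = (ev : ℂ) * f x) ∧
    ∀ (γ : G) (x : Sphere2), f ((ρ γ).rotate x) = f x}
  zero_mem' := by
    refine ⟨contMDiff_const, fun x => ?_, fun γ x => rfl⟩
    rw [sphereLaplacian_zero]
    simp
  add_mem' := by
    rintro f g ⟨hf, hfe, hfi⟩ ⟨hg, hge, hgi⟩
    refine ⟨ContMDiff.add hf hg, fun x => ?_, fun γ x => ?_⟩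
    · rw [sphereLaplacian_add hf hg, neg_add, hfe, hge, Pi.add_apply, mul_add]
    · simp only [Pi.add_apply, hfi, hgi]
  smul_mem' := by
    rintro c f ⟨hf, hfe, hfi⟩
    refine ⟨?_, fun x => ?_, fun γ x => ?_⟩
    · exact (ContinuousLinearMap.mul ℝ ℂ c).contMDiff.comp hf
    · rw [sphereLaplacian_smul c hf, ← mul_neg, hfe, Pi.smul_apply, smul_eq_mul]
      ring
    · simp only [Pi.smul_apply, hfi]

/-- The multiplicity `μ_Γ(ev)` of the eigenvalue `ev` on the quotient orbifold. -/
noncomputable def eigenvalueMultiplicity {G : Type*} [Group G] (ρ : G →* SO3) (ev : ℝ) : ℕ :=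
  Module.finrank ℂ (quotientEigenspace ρ ev)

/-- The counting function `N_Γ(bound) = ∑_{ev ≤ bound} μ_Γ(ev)`, the sum being over all
eigenvalues up to `bound` (only finitely many terms are non-zero as soon as the set of
eigenvalues up to `bound` is finite). -/
noncomputable def countingFunction {G : Type*} [Group G] (ρ : G →* SO3) (bound : ℝ) : ℕ :=
  ∑ᶠ (ev : ℝ) (_ : ev ≤ bound), eigenvalueMultiplicity ρ ev

/-! Everything reduces to the space P_L of polynomial functions of degree at most L on the sphere.
In an orthonormal frame with axial coordinate z and transverse complex coordinate w one has w * conj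
w = 1 - z^2, and the functions z^min(j,k) w^(j-k) conj(w)^(k-j) with 0 ≤ j, k ≤ L (exponents
truncated at 0) form a basis of P_L (`sphMonSpan_eq`, `sphMon_linearIndependent`). A rotation about
the axis with w ↦ ζw scales the (j,k) element by ζ^(j-k), so its trace on P_L is |1 + ζ + ... +
ζ^L|^2 (`spherePolyRep_character`). This is (L+1)^2 for the identity and bounded in L when ζ ≠ 1.

On the spectral side, Δ + l(l+1) maps P_l into P_{l-1} (`sphereLaplacian_add_mem`). Hence the only
eigenvalues on polynomials are the numbers l(l+1), and the invariants in P_l are those in P_{l-1}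
plus, directly, the invariant eigenspace for l(l+1) (`sup_quotientEigenspace`). Symmetry of Δ and
density of polynomials exclude any further smooth eigenfunction (`mem_spherePoly_of_eigenfunction`).
So N_Γ(L) is the dimension of the invariants of P_L, that is, the average over Γ of the traces
(`countingFunction_eq_sum`). The identity gives (L+1)^2/|Γ|, and the other elements give O(1).

For Γ(2,2,n) the powers of αβ together contribute n times the number of pairs in [0,L]^2 congruent
mod n, and each of the n remaining elements is a half turn contributing 1 or 0 according to the
parity of L. The closed formula follows by comparing increments in L (`two_mul_dihedral_count`).

The order of each group is squeezed. Enumerating the cosets of the subgroup generated by αβ bounds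
it above, and a permutation or dihedral representation separating that many words bounds it below.
In the polyhedral cases every nontrivial element has a power conjugate to α, β, αβ or (αβ)^2, so
rotations satisfying the relations, with these four images nontrivial, already give an embedding
(`card_eq_and_injective_of_perm`). The sine sums telescope after multiplication by sin θ. -/

/-! ### The spherical Laplacian along lines -/

/-- The Euclidean space `ℝ³`. -/
abbrev R3 : Type := EuclideanSpace ℝ (Fin 3)

theorem sphere_norm (x : Sphere2) : ‖(x : R3)‖ = 1 := by
  simp

theorem radialExt_coe (f : Sphere2 → ℂ) (x : Sphere2) : radialExt f (x : R3) = f x := by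
  have hx := sphere_ne_zero x
  simp only [radialExt, dif_neg hx]
  congr 1
  apply Subtype.ext
  simp [radialProj]

theorem radialExt_smul (f : Sphere2 → ℂ) {c : ℝ} (hc : 0 < c) (y : R3) :
    radialExt f (c • y) = radialExt f y := by
  by_cases hy : y = 0
  · simp [hy]
  · have hcy : c • y ≠ 0 := smul_ne_zero hc.ne' hy
    simp only [radialExt, dif_neg hy, dif_neg hcy]
    congr 1
    apply Subtype.ext
    simp only [radialProj, norm_smul, Real.norm_eq_abs, abs_of_pos hc, smul_smul]
    congr 1
    field_simp

theorem laplacian_eq_sum_fderiv (b : OrthonormalBasis (Fin 3) ℝ R3) (F : R3 → ℂ) (x : R3) :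
    (Δ F) x = ∑ i, fderiv ℝ (fderiv ℝ F) x (b i) (b i) := by
  rw [InnerProductSpace.laplacian_eq_iteratedFDeriv_orthonormalBasis F b]
  simp [iteratedFDeriv_two_apply]

/-- Reduces Laplacians to one-variable calculus along the lines of a frame. The frame can then be
adapted to the function or moved by a rotation. -/
theorem deriv_deriv_line {F : R3 → ℂ} {x : R3} (hF : ContDiffAt ℝ 2 F x) (v : R3) :
    deriv (deriv fun t : ℝ => F (x + t • v)) 0 = fderiv ℝ (fderiv ℝ F) x v v := by
  have hline : ∀ t : ℝ, HasDerivAt (fun t : ℝ => x + t • v) v t := fun t => by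
    simpa using ((hasDerivAt_id t).smul_const v).const_add x
  have h1 : ∀ᶠ y in nhds x, DifferentiableAt ℝ F y :=
    (hF.eventually (by norm_num)).mono fun y hy => hy.differentiableAt (by norm_num)
  have hc : Filter.Tendsto (fun t : ℝ => x + t • v) (nhds 0) (nhds x) := by
    have h := (hline 0).continuousAt.tendsto
    rwa [zero_smul, add_zero] at h
  have h2 : deriv (fun t : ℝ => F (x + t • v)) =ᶠ[nhds 0]
      fun t => fderiv ℝ F (x + t • v) v := by
    filter_upwards [hc.eventually h1] with t ht
    exact (HasFDerivAt.comp_hasDerivAt t ht.hasFDerivAt (hline t)).deriv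
  rw [h2.deriv_eq]
  have h3 : DifferentiableAt ℝ (fderiv ℝ F) x :=
    (hF.fderiv_right (m := 1) (by norm_num)).differentiableAt (by norm_num)
  have h4 : HasDerivAt (fun t : ℝ => fderiv ℝ F (x + t • v)) (fderiv ℝ (fderiv ℝ F) x v) 0 :=
    HasFDerivAt.comp_hasDerivAt_of_eq (0 : ℝ) h3.hasFDerivAt (hline 0) (by simp)
  have h5 := h4.clm_apply (hasDerivAt_const 0 v)
  rw [h5.deriv, map_zero, add_zero]

theorem sphereLaplacian_eq_sum_deriv (b : OrthonormalBasis (Fin 3) ℝ R3) {f : Sphere2 → ℂ}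
    (hf : SmoothOnSphere f) {y : R3} (hy : y ≠ 0) :
    (Δ (radialExt f)) y = ∑ i, deriv (deriv fun t : ℝ => radialExt f (y + t • b i)) 0 := by
  rw [laplacian_eq_sum_fderiv b]
  exact Finset.sum_congr rfl fun i _ =>
    (deriv_deriv_line ((hf.contDiffAt_radialExt hy).of_le (by norm_cast)) _).symm

theorem deriv_deriv_comp_mul (c : ℝ) (h : ℝ → ℂ) :
    deriv (deriv fun t : ℝ => h (c * t)) 0 = (c : ℂ) ^ 2 * deriv (deriv h) 0 := by
  have h1 : (deriv fun t : ℝ => h (c * t)) = fun t => (c : ℝ) • deriv h (c * t) := by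
    funext t
    exact deriv_comp_mul_left c h t
  rw [h1]
  have h2 : (fun t : ℝ => (c : ℝ) • deriv h (c * t)) = (c : ℝ) • fun t => deriv h (c * t) := rfl
  rw [h2, deriv_const_smul_field, deriv_comp_mul_left, mul_zero]
  simp only [Complex.real_smul]
  ring

/-- The Laplacian of the radial extension off the sphere. -/
theorem laplacian_radialExt {f : Sphere2 → ℂ} (hf : SmoothOnSphere f) {y : R3} (hy : y ≠ 0) :
    (Δ (radialExt f)) y = ((‖y‖ : ℂ)⁻¹) ^ 2 * radialExt (sphereLaplacian f) y := by
  have hn : 0 < ‖y‖ := norm_pos_iff.mpr hy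
  let b := EuclideanSpace.basisFun (Fin 3) ℝ
  have h1 : radialExt (sphereLaplacian f) y = sphereLaplacian f (radialProj y hy) := by
    simp [radialExt, hy]
  rw [h1, sphereLaplacian, sphereLaplacian_eq_sum_deriv b hf hy,
    sphereLaplacian_eq_sum_deriv b hf (sphere_ne_zero _), Finset.mul_sum]
  refine Finset.sum_congr rfl fun i _ => ?_
  rw [← Complex.ofReal_inv, ← deriv_deriv_comp_mul]
  congr 2
  funext t
  -- The extension is homogeneous of degree 0. Scaling the line through y by ‖y‖⁻¹ gives the line
  -- through its projection with parameter ‖y‖⁻¹ t, and two derivatives produce the factor ‖y‖⁻².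
  rw [← radialExt_smul f (inv_pos.mpr hn) (y + t • b i)]
  congr 1
  simp [radialProj, smul_smul, smul_add]

theorem smoothOnSphere_comp_coe {P : R3 → ℂ} (hP : ContDiff ℝ ∞ P) :
    SmoothOnSphere fun x : Sphere2 => P x := by
  have : Fact (Module.finrank ℝ R3 = 2 + 1) := ⟨by simp⟩
  exact hP.contMDiff.comp (contMDiff_coe_sphere (n := 2) (E := R3))

/-! ### Monomials in adapted coordinates -/

/-- The axial coordinate in the frame `b`. -/
noncomputable def axial (b : OrthonormalBasis (Fin 3) ℝ R3) (y : R3) : ℂ := (inner ℝ (b 2) y : ℝ)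

/-- The complex coordinate `y₀ + ε y₁` in the frame `b`. -/
noncomputable def transverse (b : OrthonormalBasis (Fin 3) ℝ R3) (ε : ℂ) (y : R3) : ℂ :=
  (inner ℝ (b 0) y : ℝ) + (inner ℝ (b 1) y : ℝ) * ε

theorem norm_inv_line_hasDerivAt {b : OrthonormalBasis (Fin 3) ℝ R3} (x : R3) (i : Fin 3) {t : ℝ}
    (ht : x + t • b i ≠ 0) :
    HasDerivAt (fun t : ℝ => ((‖x + t • b i‖⁻¹ : ℝ) : ℂ))
      (-((inner ℝ (b i) x + t : ℝ) : ℂ) * ((‖x + t • b i‖⁻¹ : ℝ) : ℂ) ^ 3) t := by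
  have hline : HasDerivAt (fun t : ℝ => x + t • b i) (b i) t := by
    simpa using ((hasDerivAt_id t).smul_const (b i)).const_add x
  have hn : ‖x + t • b i‖ ≠ 0 := norm_ne_zero_iff.mpr ht
  have h1 := hline.norm_sq
  have h2 := (h1.sqrt (by positivity)).inv (by positivity)
  have h3 : HasDerivAt (fun t : ℝ => ‖x + t • b i‖⁻¹)
      (-(inner ℝ (b i) x + t) * (‖x + t • b i‖⁻¹) ^ 3) t := by
    have hfun : (fun t : ℝ => ‖x + t • b i‖⁻¹) = (fun t : ℝ => √(‖x + t • b i‖ ^ 2))⁻¹ := by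
      funext s
      simp
    rw [hfun]
    refine h2.congr_deriv ?_
    have hin : inner ℝ (x + t • b i) (b i) = inner ℝ (b i) x + t := by
      rw [inner_add_left, inner_smul_left, real_inner_comm]
      simp
    rw [hin, Real.sqrt_sq (norm_nonneg _)]
    field_simp
  have h4 := h3.ofReal_comp
  refine h4.congr_deriv ?_
  push_cast
  ring

/-- With N' = -s N^3, which holds for the inverse norm along a line, the products of this shape are
closed under differentiation up to the factor s. The second derivative then comes from applying the
same rule termwise. -/
theorem monomial_line_hasDerivAt {N s : ℝ → ℂ} {t : ℝ} (hN : HasDerivAt N (-s t * N t ^ 3) t)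
    (z w δ η : ℂ) (a m l : ℕ) :
    HasDerivAt (fun t : ℝ => (z + δ * t) ^ a * (w + η * t) ^ m * N t ^ l)
      (a * δ * ((z + δ * t) ^ (a - 1) * (w + η * t) ^ m * N t ^ l)
        + m * η * ((z + δ * t) ^ a * (w + η * t) ^ (m - 1) * N t ^ l)
        - l * s t * ((z + δ * t) ^ a * (w + η * t) ^ m * N t ^ (l + 2))) t := by
  have hid : HasDerivAt (fun t : ℝ => (t : ℂ)) 1 t := (hasDerivAt_id t).ofReal_comp
  have hz : HasDerivAt (fun t : ℝ => z + δ * (t : ℂ)) δ t := by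
    simpa using (hid.const_mul δ).const_add z
  have hw : HasDerivAt (fun t : ℝ => w + η * (t : ℂ)) η t := by
    simpa using (hid.const_mul η).const_add w
  refine (((hz.pow a).mul (hw.pow m)).mul (hN.pow l)).congr_deriv ?_
  -- N^(l-1) * N^3 = N^(l+2) fails for truncated subtraction at l = 0, where the term has
  -- coefficient 0 anyway.
  rcases l with _ | l
  · simp; ring
  · simp only [Pi.mul_apply, Pi.pow_apply, Nat.add_sub_cancel]
    push_cast
    ring

theorem monomial_line_deriv_deriv {N s : ℝ → ℂ}
    (hN : ∀ᶠ t in nhds (0 : ℝ), HasDerivAt N (-s t * N t ^ 3) t) (hN0 : N 0 = 1)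
    (hs : HasDerivAt s 1 0) (z w δ η : ℂ) (a m l : ℕ) :
    deriv (deriv fun t : ℝ => (z + δ * t) ^ a * (w + η * t) ^ m * N t ^ l) 0 =
      a * (a - 1 : ℕ) * δ ^ 2 * (z ^ (a - 1 - 1) * w ^ m)
        + 2 * a * m * (δ * η) * (z ^ (a - 1) * w ^ (m - 1))
        + m * (m - 1 : ℕ) * η ^ 2 * (z ^ a * w ^ (m - 1 - 1))
        - 2 * l * (δ * s 0) * (a * z ^ (a - 1) * w ^ m)
        - 2 * l * (η * s 0) * (m * z ^ a * w ^ (m - 1))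
        + (l * (l + 2) * s 0 ^ 2 - l) * (z ^ a * w ^ m) := by
  have h1 := hN.mono fun t ht => (monomial_line_hasDerivAt ht z w δ η a m l).deriv
  rw [Filter.EventuallyEq.deriv_eq h1]
  have h0 := hN.self_of_nhds
  have hA := (monomial_line_hasDerivAt h0 z w δ η (a - 1) m l).const_mul (a * δ)
  have hB := (monomial_line_hasDerivAt h0 z w δ η a (m - 1) l).const_mul (m * η)
  have hC := (hs.const_mul (l : ℂ)).mul (monomial_line_hasDerivAt h0 z w δ η a m (l + 2))
  refine ((hA.add hB).sub hC).deriv.trans ?_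
  simp only [hN0, Complex.ofReal_zero, mul_zero, add_zero, one_pow, mul_one]
  push_cast
  ring

/-- The spherical Laplacian of the monomial `z^a w^m` in coordinates adapted to a frame. -/
theorem sphereLaplacian_monomial (b : OrthonormalBasis (Fin 3) ℝ R3) {ε : ℂ} (hε : ε ^ 2 = -1)
    (a m : ℕ) (x : Sphere2) :
    sphereLaplacian (fun x : Sphere2 => axial b x ^ a * transverse b ε x ^ m) x =
      a * (a - 1 : ℕ) * (axial b x ^ (a - 2) * transverse b ε x ^ m)
        - ((a + m : ℕ) * ((a + m : ℕ) + 1)) * (axial b x ^ a * transverse b ε x ^ m) := by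
  have hsm : SmoothOnSphere fun x : Sphere2 => axial b x ^ a * transverse b ε x ^ m := by
    refine smoothOnSphere_comp_coe (P := fun y => axial b y ^ a * transverse b ε y ^ m) ?_
    unfold axial transverse
    have h : ∀ i, ContDiff ℝ ∞ fun y : R3 => ((inner ℝ (b i) y : ℝ) : ℂ) := fun i =>
      Complex.ofRealCLM.contDiff.comp (contDiff_const.inner ℝ contDiff_id)
    exact ((h 2).pow a).mul (((h 0).add ((h 1).mul contDiff_const)).pow m)
  have hx := sphere_ne_zero x
  rw [sphereLaplacian, sphereLaplacian_eq_sum_deriv b hsm hx]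
  -- The rates of change of the transverse and axial coordinates along the three frame directions.
  let η : Fin 3 → ℂ := ![1, ε, 0]
  let δ : Fin 3 → ℂ := ![0, 0, 1]
  have hnear : ∀ i, ∀ᶠ t in nhds (0 : ℝ), (x : R3) + t • b i ≠ 0 := fun i => by
    have hc : ContinuousAt (fun t : ℝ => (x : R3) + t • b i) 0 := by fun_prop
    exact hc.eventually_ne (by simpa using hx)
  have key : ∀ i, deriv (deriv fun t : ℝ => radialExt
      (fun x : Sphere2 => axial b x ^ a * transverse b ε x ^ m) ((x : R3) + t • b i)) 0 =
      deriv (deriv fun t : ℝ => (axial b x + δ i * t) ^ a * (transverse b ε x + η i * t) ^ m *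
        ((‖(x : R3) + t • b i‖⁻¹ : ℝ) : ℂ) ^ (a + m)) 0 := fun i => by
    refine Filter.EventuallyEq.deriv_eq (Filter.EventuallyEq.deriv ?_)
    filter_upwards [hnear i] with t ht
    simp only [radialExt, dif_neg ht, radialProj]
    have hA : axial b (‖(x : R3) + t • b i‖⁻¹ • ((x : R3) + t • b i)) =
        ((‖(x : R3) + t • b i‖⁻¹ : ℝ) : ℂ) * (axial b x + δ i * t) := by
      simp only [axial, inner_smul_right, inner_add_right, b.inner_eq_ite]
      fin_cases i <;> simp [δ]
    have hW : transverse b ε (‖(x : R3) + t • b i‖⁻¹ • ((x : R3) + t • b i)) =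
        ((‖(x : R3) + t • b i‖⁻¹ : ℝ) : ℂ) * (transverse b ε x + η i * t) := by
      simp only [transverse, inner_smul_right, inner_add_right, b.inner_eq_ite]
      fin_cases i <;> simp [η] <;> ring
    rw [hA, hW, mul_pow, mul_pow, pow_add]
    ring
  have hs : ∀ i, HasDerivAt (fun t : ℝ => ((inner ℝ (b i) (x : R3) + t : ℝ) : ℂ)) 1 0 := fun i => by
    simpa using ((hasDerivAt_id (0 : ℝ)).const_add (inner ℝ (b i) (x : R3))).ofReal_comp
  simp_rw [key]
  rw [Finset.sum_congr rfl fun i _ => monomial_line_deriv_deriv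
    (N := fun t : ℝ => ((‖(x : R3) + t • b i‖⁻¹ : ℝ) : ℂ))
    ((hnear i).mono fun t ht => norm_inv_line_hasDerivAt (x : R3) i ht)
    (by simp) (hs i) (axial b x) (transverse b ε x) (δ i) (η i) a m (a + m)]
  have hnorm : ((inner ℝ (b 0) (x : R3) : ℝ) : ℂ) ^ 2 + ((inner ℝ (b 1) (x : R3) : ℝ) : ℂ) ^ 2
      + ((inner ℝ (b 2) (x : R3) : ℝ) : ℂ) ^ 2 = 1 := by
    have h := b.sum_sq_inner_right (x : R3)
    rw [Fin.sum_univ_three, sphere_norm] at h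
    exact_mod_cast h.trans (one_pow 2)
  have hz : (a : ℂ) * axial b x ^ (a - 1) * axial b x = a * axial b x ^ a := by
    rcases a with _ | a
    · simp
    · simp only [Nat.add_sub_cancel]; ring
  have hw : (m : ℂ) * transverse b ε x ^ (m - 1) * transverse b ε x = m * transverse b ε x ^ m := by
    rcases m with _ | m
    · simp
    · simp only [Nat.add_sub_cancel]; ring
  simp only [Fin.sum_univ_three, η, δ, Matrix.cons_val_zero, Matrix.cons_val_one, Matrix.cons_val,
    add_zero, Nat.sub_sub]
  have hzx : ((inner ℝ (b 2) (x : R3) : ℝ) : ℂ) = axial b x := rfl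
  have hwx : ((inner ℝ (b 0) (x : R3) : ℝ) : ℂ) =
    transverse b ε x - ((inner ℝ (b 1) (x : R3) : ℝ) : ℂ) * ε := by simp [transverse]
  push_cast
  rw [hzx, hwx] at hnorm ⊢
  generalize ((inner ℝ (b 1) (x : R3) : ℝ) : ℂ) = v at *
  generalize axial b x = z at *
  generalize transverse b ε x = w at *
  -- Since 1 + ε^2 = 0, the transverse powers are harmonic and the w^(m-2) term drops out. The unit
  -- norm and Euler's relations for z^a and w^m reduce the remaining terms: with l = a + m the
  -- coefficient is l(l+2) - 3l - 2l^2 = -l(l+1).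
  linear_combination ((m : ℂ) * (m - 1 : ℕ) * (z ^ a * w ^ (m - (1 + 1)))) * hε
    + ((a + m) * (a + m + 2) * (z ^ a * w ^ m)) * hnorm
    - 2 * (a + m) * w ^ m * hz - 2 * (a + m) * z ^ a * hw

/-! ### Polynomial functions on the sphere -/

/-- The affine functions on the sphere. -/
noncomputable def sphereAffine : Submodule ℂ (Sphere2 → ℂ) :=
  Submodule.span ℂ {f | f = 1 ∨ ∃ v : R3, f = fun x : Sphere2 => ((inner ℝ v (x : R3) : ℝ) : ℂ)}

/-- The polynomial functions of degree at most `L` on the sphere. -/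
noncomputable def spherePoly (L : ℕ) : Submodule ℂ (Sphere2 → ℂ) := sphereAffine ^ L

/-- The function `z^min(j,k) w^(j-k) (conj w)^(k-j)` in coordinates adapted to the frame `b`. -/
noncomputable def sphMon (b : OrthonormalBasis (Fin 3) ℝ R3) (j k : ℕ) : Sphere2 → ℂ := fun x =>
  axial b x ^ min j k * transverse b Complex.I x ^ (j - k) * transverse b (-Complex.I) x ^ (k - j)

theorem one_mem_sphereAffine : 1 ∈ sphereAffine := Submodule.subset_span (Or.inl rfl)

theorem inner_mem_sphereAffine (v : R3) :
    (fun x : Sphere2 => ((inner ℝ v (x : R3) : ℝ) : ℂ)) ∈ sphereAffine :=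
  Submodule.subset_span (Or.inr ⟨v, rfl⟩)

theorem axial_mem_sphereAffine (b : OrthonormalBasis (Fin 3) ℝ R3) :
    (fun x : Sphere2 => axial b x) ∈ sphereAffine := inner_mem_sphereAffine _

theorem transverse_mem_sphereAffine (b : OrthonormalBasis (Fin 3) ℝ R3) (ε : ℂ) :
    (fun x : Sphere2 => transverse b ε x) ∈ sphereAffine := by
  have h : (fun x : Sphere2 => transverse b ε x) =
      (fun x : Sphere2 => ((inner ℝ (b 0) (x : R3) : ℝ) : ℂ)) +
        ε • fun x : Sphere2 => ((inner ℝ (b 1) (x : R3) : ℝ) : ℂ) := by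
    funext x
    simp [transverse, mul_comm]
  rw [h]
  exact add_mem (inner_mem_sphereAffine _) (Submodule.smul_mem _ _ (inner_mem_sphereAffine _))

theorem sphereAffine_le (b : OrthonormalBasis (Fin 3) ℝ R3) :
    sphereAffine ≤ Submodule.span ℂ {1, fun x : Sphere2 => axial b x,
      fun x : Sphere2 => transverse b Complex.I x,
      fun x : Sphere2 => transverse b (-Complex.I) x} := by
  refine Submodule.span_le.mpr ?_
  rintro f (rfl | ⟨v, rfl⟩)
  · exact Submodule.subset_span (by simp)
  · have h : (fun x : Sphere2 => ((inner ℝ v (x : R3) : ℝ) : ℂ)) =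
        ((inner ℝ v (b 2) : ℝ) : ℂ) • (fun x : Sphere2 => axial b x) +
        ((((inner ℝ v (b 0) : ℝ) : ℂ) - ((inner ℝ v (b 1) : ℝ) : ℂ) * Complex.I) / 2) •
          (fun x : Sphere2 => transverse b Complex.I x) +
        ((((inner ℝ v (b 0) : ℝ) : ℂ) + ((inner ℝ v (b 1) : ℝ) : ℂ) * Complex.I) / 2) •
          (fun x : Sphere2 => transverse b (-Complex.I) x) := by
      funext x
      rw [← b.sum_inner_mul_inner v (x : R3)]
      simp only [Fin.sum_univ_three, Pi.add_apply, Pi.smul_apply, smul_eq_mul, axial, transverse]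
      push_cast
      linear_combination (((inner ℝ v (b 1) : ℝ) : ℂ) * ((inner ℝ (b 1) (x : R3) : ℝ) : ℂ)) *
        Complex.I_sq
    rw [h]
    refine add_mem (add_mem ?_ ?_) ?_ <;>
      exact Submodule.smul_mem _ _ (Submodule.subset_span (by simp))

theorem spherePoly_mono : Monotone spherePoly :=
  monotone_nat_of_le_succ fun L => by
    rw [spherePoly, spherePoly, pow_succ]
    exact fun f hf => by simpa using Submodule.mul_mem_mul hf one_mem_sphereAffine

theorem mul_mem_spherePoly {L M : ℕ} {f g : Sphere2 → ℂ} (hf : f ∈ spherePoly L)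
    (hg : g ∈ spherePoly M) : f * g ∈ spherePoly (L + M) := by
  rw [spherePoly, pow_add]
  exact Submodule.mul_mem_mul hf hg

theorem pow_mem_spherePoly {f : Sphere2 → ℂ} (hf : f ∈ sphereAffine) (L : ℕ) :
    f ^ L ∈ spherePoly L := Submodule.pow_mem_pow _ hf L

/-- The degree of the monomial is min(j,k) + |j-k| = max(j,k), so a square of indices corresponds to
a degree bound. -/
theorem sphMon_mem (b : OrthonormalBasis (Fin 3) ℝ R3) {j k L : ℕ} (hj : j ≤ L) (hk : k ≤ L) :
    sphMon b j k ∈ spherePoly L := by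
  have h := mul_mem_spherePoly (mul_mem_spherePoly
    (pow_mem_spherePoly (axial_mem_sphereAffine b) (min j k))
    (pow_mem_spherePoly (transverse_mem_sphereAffine b Complex.I) (j - k)))
    (pow_mem_spherePoly (transverse_mem_sphereAffine b (-Complex.I)) (k - j))
  exact spherePoly_mono (by omega) h

theorem transverse_mul_transverse (b : OrthonormalBasis (Fin 3) ℝ R3) (x : Sphere2) :
    transverse b Complex.I x * transverse b (-Complex.I) x = 1 - axial b x ^ 2 := by
  have h := b.sum_sq_inner_right (x : R3)
  rw [Fin.sum_univ_three, sphere_norm] at h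
  have h' : ((inner ℝ (b 0) (x : R3) : ℝ) : ℂ) ^ 2 + ((inner ℝ (b 1) (x : R3) : ℝ) : ℂ) ^ 2
      + ((inner ℝ (b 2) (x : R3) : ℝ) : ℂ) ^ 2 = 1 := by exact_mod_cast h.trans (one_pow 2)
  simp only [transverse, axial]
  linear_combination h' - ((inner ℝ (b 1) (x : R3) : ℝ) : ℂ) ^ 2 * Complex.I_sq

theorem sphMon_mul_axial (b : OrthonormalBasis (Fin 3) ℝ R3) (j k : ℕ) :
    sphMon b j k * (fun x : Sphere2 => axial b x) = sphMon b (j + 1) (k + 1) := by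
  funext x
  have h : min (j + 1) (k + 1) = min j k + 1 := by omega
  simp only [sphMon, Pi.mul_apply, Nat.add_sub_add_right, h]
  ring

theorem sphMon_mul_transverse_I (b : OrthonormalBasis (Fin 3) ℝ R3) {j k : ℕ} (h : k ≤ j) :
    sphMon b j k * (fun x : Sphere2 => transverse b Complex.I x) = sphMon b (j + 1) k := by
  funext x
  have h1 : k - (j + 1) = k - j := by omega
  have h2 : j + 1 - k = j - k + 1 := by omega
  have h3 : min (j + 1) k = min j k := by omega
  simp only [sphMon, Pi.mul_apply, h1, h2, h3, pow_succ]
  ring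

/-- Here w meets a factor conj w, and w * conj w = 1 - z^2 splits the product into two monomials of
the family. -/
theorem sphMon_mul_transverse_I' (b : OrthonormalBasis (Fin 3) ℝ R3) {j k : ℕ} (h : j ≤ k) :
    sphMon b j (k + 1) * (fun x : Sphere2 => transverse b Complex.I x) =
      sphMon b j k - sphMon b (j + 2) (k + 2) := by
  funext x
  have h1 : k + 1 - j = k - j + 1 := by omega
  have h2 : j - (k + 1) = 0 := by omega
  have h3 : min j (k + 1) = j := by omega
  have h4 : j - k = 0 := by omega
  have h5 : min (j + 2) (k + 2) = j + 2 := by omega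
  simp only [sphMon, Pi.mul_apply, Pi.sub_apply, Nat.add_sub_add_right, h1, h2, h3, h4, h5,
    min_eq_left h]
  linear_combination (axial b x ^ j * transverse b (-Complex.I) x ^ (k - j)) *
    transverse_mul_transverse b x

theorem star_transverse (b : OrthonormalBasis (Fin 3) ℝ R3) (x : Sphere2) :
    star (transverse b Complex.I x) = transverse b (-Complex.I) x := by
  simp [transverse]

theorem star_sphMon (b : OrthonormalBasis (Fin 3) ℝ R3) (j k : ℕ) :
    star (sphMon b j k) = sphMon b k j := by
  funext x
  have h := star_transverse b x
  have h' : star (transverse b (-Complex.I) x) = transverse b Complex.I x := by rw [← h, star_star]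
  have hz : star (axial b (x : R3)) = axial b x := by simp [axial]
  rw [Pi.star_apply]
  simp only [sphMon, star_mul, star_pow, h, h', hz, min_comm k j]
  ring

theorem star_transverse_mul (b : OrthonormalBasis (Fin 3) ℝ R3) (j k : ℕ) :
    sphMon b j k * (fun x : Sphere2 => transverse b (-Complex.I) x) =
      star (sphMon b k j * (fun x : Sphere2 => transverse b Complex.I x)) := by
  rw [star_mul, star_sphMon, mul_comm]
  congr 1
  funext x
  exact (star_transverse b x).symm

/-- The span of the functions `sphMon b j k` with `j, k ≤ L`. -/
noncomputable def sphMonSpan (b : OrthonormalBasis (Fin 3) ℝ R3) (L : ℕ) :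
    Submodule ℂ (Sphere2 → ℂ) :=
  Submodule.span ℂ (Set.range fun p : Fin (L + 1) × Fin (L + 1) => sphMon b p.1 p.2)

theorem sphMon_mem_span (b : OrthonormalBasis (Fin 3) ℝ R3) {j k L : ℕ} (hj : j ≤ L)
    (hk : k ≤ L) : sphMon b j k ∈ sphMonSpan b L :=
  Submodule.subset_span ⟨(⟨j, by omega⟩, ⟨k, by omega⟩), rfl⟩

theorem star_mem_sphMonSpan {b : OrthonormalBasis (Fin 3) ℝ R3} {L : ℕ} {f : Sphere2 → ℂ}
    (hf : f ∈ sphMonSpan b L) : star f ∈ sphMonSpan b L := by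
  induction hf using Submodule.span_induction with
  | mem f hf =>
    obtain ⟨p, rfl⟩ := hf
    simp only [star_sphMon]
    exact sphMon_mem_span b (by omega) (by omega)
  | zero => simp
  | add f g _ _ hf hg => rw [star_add]; exact add_mem hf hg
  | smul c f _ hf => rw [star_smul]; exact Submodule.smul_mem _ _ hf

/-- By induction on L it is enough to multiply a spanning monomial by 1, z, w or conj w and stay in
the next square of indices. Complex conjugation swaps j and k, so the case of conj w follows from
that of w. -/
theorem sphMonSpan_eq (b : OrthonormalBasis (Fin 3) ℝ R3) (L : ℕ) :
    spherePoly L = sphMonSpan b L := by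
  apply le_antisymm
  · induction L with
    | zero =>
      rw [spherePoly, pow_zero, Submodule.one_eq_span, Submodule.span_le, Set.singleton_subset_iff]
      have h : (1 : Sphere2 → ℂ) = sphMon b 0 0 := by
        funext x
        simp [sphMon]
      rw [h]
      exact sphMon_mem_span b le_rfl le_rfl
    | succ L ih =>
      rw [spherePoly, pow_succ]
      refine (mul_le_mul' ih (sphereAffine_le b)).trans ?_
      rw [sphMonSpan, Submodule.span_mul_span, Submodule.span_le]
      have hw : ∀ j k : ℕ, j ≤ L → k ≤ L →
          sphMon b j k * (fun x : Sphere2 => transverse b Complex.I x) ∈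
            sphMonSpan b (L + 1) := by
        intro j k hj hk
        rcases le_or_gt k j with h | h
        · rw [sphMon_mul_transverse_I b h]
          exact sphMon_mem_span b (by omega) (by omega)
        · obtain ⟨k, rfl⟩ : ∃ k', k = k' + 1 := ⟨k - 1, by omega⟩
          rw [sphMon_mul_transverse_I' b (by omega)]
          exact sub_mem (sphMon_mem_span b (by omega) (by omega))
            (sphMon_mem_span b (by omega) (by omega))
      rintro _ ⟨_, ⟨⟨j, k⟩, rfl⟩, g, hg, rfl⟩
      simp only [Set.mem_insert_iff, Set.mem_singleton_iff] at hg
      rcases hg with rfl | rfl | rfl | rfl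
      · simpa using sphMon_mem_span b (L := L + 1) (j := j) (k := k) (by omega) (by omega)
      · simp only [sphMon_mul_axial]
        exact sphMon_mem_span b (by omega) (by omega)
      · exact hw _ _ (by omega) (by omega)
      · simp only [star_transverse_mul]
        exact star_mem_sphMonSpan (hw _ _ (by omega) (by omega))
  · refine Submodule.span_le.mpr ?_
    rintro _ ⟨p, rfl⟩
    exact sphMon_mem b (by omega) (by omega)

theorem star_mem_spherePoly {L : ℕ} {f : Sphere2 → ℂ} (hf : f ∈ spherePoly L) :
    star f ∈ spherePoly L := by
  rw [sphMonSpan_eq (EuclideanSpace.basisFun (Fin 3) ℝ)] at hf ⊢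
  exact star_mem_sphMonSpan hf

instance spherePoly_finiteDimensional (L : ℕ) : FiniteDimensional ℂ (spherePoly L) := by
  rw [sphMonSpan_eq (EuclideanSpace.basisFun (Fin 3) ℝ), sphMonSpan]
  exact FiniteDimensional.span_of_finite ℂ (Set.finite_range _)

/-! ### Linear independence of the adapted monomials -/

theorem exists_sphere_point (b : OrthonormalBasis (Fin 3) ℝ R3) {z s : ℝ} (hzs : z ^ 2 + s ^ 2 = 1)
    {ζ : ℂ} (hζ : ‖ζ‖ = 1) : ∃ x : Sphere2, axial b x = z ∧ transverse b Complex.I x = s * ζ ∧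
      transverse b (-Complex.I) x = s * ζ⁻¹ := by
  have hζ2 : ζ.re ^ 2 + ζ.im ^ 2 = 1 := by
    have h := Complex.sq_norm ζ
    rw [hζ, Complex.normSq_apply] at h
    linarith
  let y : R3 := b.repr.symm (WithLp.toLp 2 ![s * ζ.re, s * ζ.im, z])
  have hy : ‖y‖ = 1 := by
    rw [LinearIsometryEquiv.norm_map, EuclideanSpace.norm_eq, Real.sqrt_eq_one]
    simp only [Fin.sum_univ_three, Real.norm_eq_abs, sq_abs, Matrix.cons_val_zero,
      Matrix.cons_val_one, Matrix.cons_val]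
    linear_combination hzs + s ^ 2 * hζ2
  have hb : ∀ i, inner ℝ (b i) y = (![s * ζ.re, s * ζ.im, z] : Fin 3 → ℝ) i := fun i => by
    rw [← b.repr_apply_apply, LinearIsometryEquiv.apply_symm_apply]
  have hW : transverse b Complex.I y = s * ζ := by
    simp only [transverse, hb, Matrix.cons_val_zero, Matrix.cons_val_one]
    apply Complex.ext <;> simp
  refine ⟨⟨y, by simpa using hy⟩, ?_, hW, ?_⟩
  · simp [axial, hb]
  · rw [← star_transverse, hW, Complex.inv_def, Complex.normSq_eq_norm_sq, hζ]
    simp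

/-- On the circle of latitude z the monomial equals z^min(j,k) s^|j-k| ζ^(j-k) with s^2 = 1 - z^2.
Varying ζ on the unit circle separates the differences j-k. Varying z then separates min(j,k), and
the two numbers determine (j,k). -/
theorem sphMon_linearIndependent (b : OrthonormalBasis (Fin 3) ℝ R3) (L : ℕ) :
    LinearIndependent ℂ fun p : Fin (L + 1) × Fin (L + 1) => sphMon b p.1 p.2 := by
  rw [Fintype.linearIndependent_iff]
  intro c hc p₀
  have hcirc : (Metric.sphere (0 : ℂ) 1).Infinite := by
    refine (isPreconnected_sphere (by simp [Complex.rank_real_complex]) 0 1).infinite_of_nontrivial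
      ⟨1, by simp, -1, by simp, by norm_num⟩
  have key : ∀ z ∈ Set.Ioo (-1 : ℝ) 1, ∑ p with p.1.val + (L - p.2.val) =
      p₀.1.val + (L - p₀.2.val), c p * (z : ℂ) ^ min p.1.val p.2.val = 0 := by
    rintro z ⟨hz1, hz2⟩
    let s := √(1 - z ^ 2)
    have hs0 : 0 < 1 - z ^ 2 := by nlinarith
    have hs : s ≠ 0 := (Real.sqrt_pos.mpr hs0).ne'
    have hzs : z ^ 2 + s ^ 2 = 1 := by rw [Real.sq_sqrt hs0.le]; ring
    let d : Fin (L + 1) × Fin (L + 1) → ℕ := fun p => (p.1.val - p.2.val) + (p.2.val - p.1.val)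
    -- The relation is multiplied by ζ^L, so that the exponents j - k + L are nonnegative.
    let Q : Polynomial ℂ := ∑ p : Fin (L + 1) × Fin (L + 1),
      Polynomial.C (c p * z ^ min p.1.val p.2.val * (s : ℂ) ^ d p) *
        Polynomial.X ^ (p.1.val + (L - p.2.val))
    have hQ : Q = 0 := by
      refine Polynomial.eq_zero_of_infinite_isRoot _ (hcirc.mono fun ζ hζ => ?_)
      have hζ1 : ‖ζ‖ = 1 := by simpa using hζ
      have hζ0 : ζ ≠ 0 := norm_ne_zero_iff.mp (by simp [hζ1])
      obtain ⟨x, hx1, hx2, hx3⟩ := exists_sphere_point b hzs hζ1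
      have h := congrFun hc x
      simp only [Finset.sum_apply, Pi.smul_apply, smul_eq_mul, Pi.zero_apply, sphMon, hx1, hx2,
        hx3] at h
      simp only [Set.mem_ofPred_eq, Polynomial.IsRoot, Q, Polynomial.eval_finsetSum,
        Polynomial.eval_mul, Polynomial.eval_C, Polynomial.eval_pow, Polynomial.eval_X]
      rw [← zero_mul (ζ ^ L), ← h, Finset.sum_mul]
      refine Finset.sum_congr rfl fun p _ => ?_
      have hp2 : p.2.val ≤ L := by omega
      simp only [d]
      rcases le_total p.2.val p.1.val with h' | h'
      · obtain ⟨m, hm⟩ := Nat.exists_eq_add_of_le h'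
        have e1 : p.1.val - p.2.val = m := by omega
        have e2 : p.2.val - p.1.val = 0 := by omega
        have e3 : p.1.val + (L - p.2.val) = m + L := by omega
        rw [e1, e2, e3]
        ring
      · obtain ⟨m, hm⟩ := Nat.exists_eq_add_of_le h'
        have e1 : p.1.val - p.2.val = 0 := by omega
        have e2 : p.2.val - p.1.val = m := by omega
        obtain ⟨r, hr⟩ := Nat.exists_eq_add_of_le (show m ≤ L by omega)
        have e3 : p.1.val + (L - p.2.val) = r := by omega
        rw [e1, e2, e3]
        have e4 : ζ ^ L = ζ ^ m * ζ ^ r := by rw [← pow_add, ← hr]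
        rw [e4, mul_pow (s : ℂ) ζ⁻¹, inv_pow]
        field_simp
        ring
    have hcoef := congrArg (fun q => Polynomial.coeff q (p₀.1.val + (L - p₀.2.val))) hQ
    simp only [Q, Polynomial.finsetSum_coeff, Polynomial.coeff_C_mul, Polynomial.coeff_X_pow,
      Polynomial.coeff_zero, mul_ite, mul_one, mul_zero] at hcoef
    rw [← Finset.sum_filter] at hcoef
    -- Pairs with the same difference share |j-k|, so the nonzero power of s is a common factor and
    -- cancels.
    have hd : ∀ p ∈ Finset.univ.filter (fun p : Fin (L + 1) × Fin (L + 1) =>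
        p₀.1.val + (L - p₀.2.val) = p.1.val + (L - p.2.val)), d p = d p₀ := by
      intro p hp
      simp only [Finset.mem_filter, Finset.mem_univ, true_and] at hp
      simp only [d]
      omega
    rw [Finset.sum_congr rfl fun p hp => by rw [hd p hp], ← Finset.sum_mul] at hcoef
    have := (mul_eq_zero.mp hcoef).resolve_right (pow_ne_zero _ (by exact_mod_cast hs))
    simpa only [eq_comm] using this
  let Q : Polynomial ℂ := ∑ p : Fin (L + 1) × Fin (L + 1) with p.1.val + (L - p.2.val) =
      p₀.1.val + (L - p₀.2.val), Polynomial.C (c p) * Polynomial.X ^ min p.1.val p.2.val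
  have hQ : Q = 0 := by
    refine Polynomial.eq_zero_of_infinite_isRoot _
      (((Set.Ioo_infinite (show (-1 : ℝ) < 1 by norm_num)).image
        Complex.ofReal_injective.injOn).mono ?_)
    rintro _ ⟨z, hz, rfl⟩
    simp only [Set.mem_ofPred_eq, Polynomial.IsRoot, Q, Polynomial.eval_finsetSum,
        Polynomial.eval_mul, Polynomial.eval_C, Polynomial.eval_pow, Polynomial.eval_X]
    exact key z hz
  have hcoef := congrArg (fun q => Polynomial.coeff q (min p₀.1.val p₀.2.val)) hQ
  simp only [Q, Polynomial.finsetSum_coeff, Polynomial.coeff_C_mul, Polynomial.coeff_X_pow,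
    Polynomial.coeff_zero, mul_ite, mul_one, mul_zero] at hcoef
  rw [← Finset.sum_filter, Finset.filter_filter, Finset.sum_eq_single p₀] at hcoef
  · exact hcoef
  · intro p hp hne
    simp only [Finset.mem_filter, Finset.mem_univ, true_and] at hp
    exact absurd (Prod.ext (Fin.ext (by omega)) (Fin.ext (by omega))) hne
  · simp

/-- The basis of the polynomial functions adapted to a frame. -/
noncomputable def spherePolyBasis (b : OrthonormalBasis (Fin 3) ℝ R3) (L : ℕ) :
    Module.Basis (Fin (L + 1) × Fin (L + 1)) ℂ (spherePoly L) :=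
  (Module.Basis.span (sphMon_linearIndependent b L)).map
    (LinearEquiv.ofEq _ _ (sphMonSpan_eq b L).symm)

theorem spherePolyBasis_apply (b : OrthonormalBasis (Fin 3) ℝ R3) (L : ℕ)
    (p : Fin (L + 1) × Fin (L + 1)) :
    (spherePolyBasis b L p : Sphere2 → ℂ) = sphMon b p.1 p.2 := by
  exact congrArg Subtype.val (Module.Basis.span_apply (sphMon_linearIndependent b L) p)

/-! ### The Laplacian on polynomial functions -/

theorem smooth_sphMon (b : OrthonormalBasis (Fin 3) ℝ R3) (j k : ℕ) :
    SmoothOnSphere (sphMon b j k) := by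
  refine smoothOnSphere_comp_coe (P := fun y => axial b y ^ min j k *
    transverse b Complex.I y ^ (j - k) * transverse b (-Complex.I) y ^ (k - j)) ?_
  unfold axial transverse
  have h : ∀ i, ContDiff ℝ ∞ fun y : R3 => ((inner ℝ (b i) y : ℝ) : ℂ) := fun i =>
    Complex.ofRealCLM.contDiff.comp (contDiff_const.inner ℝ contDiff_id)
  exact (((h 2).pow _).mul (((h 0).add ((h 1).mul contDiff_const)).pow _)).mul
    (((h 0).add ((h 1).mul contDiff_const)).pow _)

theorem SmoothOnSphere.add {f g : Sphere2 → ℂ} (hf : SmoothOnSphere f) (hg : SmoothOnSphere g) :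
    SmoothOnSphere (f + g) := ContMDiff.add hf hg

theorem SmoothOnSphere.smul (c : ℂ) {f : Sphere2 → ℂ} (hf : SmoothOnSphere f) :
    SmoothOnSphere (c • f) := (ContinuousLinearMap.mul ℝ ℂ c).contMDiff.comp hf

theorem smooth_of_mem_spherePoly {L : ℕ} {f : Sphere2 → ℂ} (hf : f ∈ spherePoly L) :
    SmoothOnSphere f := by
  rw [sphMonSpan_eq (EuclideanSpace.basisFun (Fin 3) ℝ)] at hf
  induction hf using Submodule.span_induction with
  | mem f hf =>
    obtain ⟨p, rfl⟩ := hf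
    exact smooth_sphMon _ _ _
  | zero => exact contMDiff_const
  | add f g _ _ hf hg => exact hf.add hg
  | smul c f _ hf => exact hf.smul c

theorem sphereLaplacian_sphMon (b : OrthonormalBasis (Fin 3) ℝ R3) (j k : ℕ) (x : Sphere2) :
    sphereLaplacian (sphMon b j k) x =
      (min j k : ℕ) * (min j k - 1 : ℕ) * sphMon b (j - 2) (k - 2) x
        - (max j k : ℕ) * ((max j k : ℕ) + 1) * sphMon b j k x := by
  rcases le_total k j with h | h
  · have e : sphMon b j k =
        fun x : Sphere2 => axial b x ^ k * transverse b Complex.I x ^ (j - k) := by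
      funext x
      simp [sphMon, h]
    rw [e, sphereLaplacian_monomial b Complex.I_sq, min_eq_right h, max_eq_left h,
      Nat.add_sub_cancel' h]
    rcases Nat.lt_or_ge k 2 with hk | hk
    · have h0 : (k : ℂ) * (k - 1 : ℕ) = 0 := by interval_cases k <;> simp
      simp [h0]
    · have e1 : min (j - 2) (k - 2) = k - 2 := by omega
      have e2 : j - 2 - (k - 2) = j - k := by omega
      have e3 : k - 2 - (j - 2) = 0 := by omega
      simp [sphMon, e1, e2, e3]
  · have e : sphMon b j k =
        fun x : Sphere2 => axial b x ^ j * transverse b (-Complex.I) x ^ (k - j) := by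
      funext x
      simp [sphMon, h]
    rw [e, sphereLaplacian_monomial b (by simp), min_eq_left h, max_eq_right h,
      Nat.add_sub_cancel' h]
    rcases Nat.lt_or_ge j 2 with hj | hj
    · have h0 : (j : ℂ) * (j - 1 : ℕ) = 0 := by interval_cases j <;> simp
      simp [h0]
    · have e1 : min (j - 2) (k - 2) = j - 2 := by omega
      have e2 : k - 2 - (j - 2) = k - j := by omega
      have e3 : j - 2 - (k - 2) = 0 := by omega
      simp [sphMon, e1, e2, e3]

/-- On polynomials of degree at most `L`, the operator `Δ + L(L+1)` lowers the degree. -/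
theorem sphereLaplacian_add_mem {L : ℕ} {f : Sphere2 → ℂ} (hf : f ∈ spherePoly L) :
    sphereLaplacian f + ((L : ℂ) * (L + 1)) • f ∈ spherePoly (L - 1) ∧
      (L = 0 → sphereLaplacian f + ((L : ℂ) * (L + 1)) • f = 0) := by
  set b := EuclideanSpace.basisFun (Fin 3) ℝ
  rw [sphMonSpan_eq b] at hf
  induction hf using Submodule.span_induction with
  | mem f hf =>
    obtain ⟨⟨⟨j, hj⟩, ⟨k, hk⟩⟩, rfl⟩ := hf
    have e : sphereLaplacian (sphMon b j k) + ((L : ℂ) * (L + 1)) • sphMon b j k =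
        ((min j k : ℕ) * (min j k - 1 : ℕ) : ℂ) • sphMon b (j - 2) (k - 2) +
        ((L : ℂ) * (L + 1) - (max j k : ℕ) * ((max j k : ℕ) + 1)) • sphMon b j k := by
      funext x
      simp only [Pi.add_apply, Pi.smul_apply, smul_eq_mul, sphereLaplacian_sphMon]
      ring
    simp only [e]
    refine ⟨add_mem (Submodule.smul_mem _ _ (sphMon_mem b (by omega) (by omega))) ?_, ?_⟩
    · rcases (show max j k ≤ L by omega).eq_or_lt with h | h
      · simp [h]
      · exact Submodule.smul_mem _ _ (sphMon_mem b (by omega) (by omega))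
    -- For L = 0 the degree L - 1 truncates to 0 and the membership says nothing, so vanishing is
    -- recorded separately.
    · rintro rfl
      obtain rfl : j = 0 := by omega
      obtain rfl : k = 0 := by omega
      simp
  | zero =>
    have h : sphereLaplacian 0 = 0 := funext sphereLaplacian_zero
    simp [h]
  | add f g hf hg ihf ihg =>
    change f ∈ sphMonSpan b L at hf
    change g ∈ sphMonSpan b L at hg
    rw [← sphMonSpan_eq] at hf hg
    have e : sphereLaplacian (f + g) = sphereLaplacian f + sphereLaplacian g :=
      funext (sphereLaplacian_add (smooth_of_mem_spherePoly hf) (smooth_of_mem_spherePoly hg))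
    rw [e, smul_add, add_add_add_comm]
    exact ⟨add_mem ihf.1 ihg.1, fun h => by rw [ihf.2 h, ihg.2 h, add_zero]⟩
  | smul c f hf ih =>
    change f ∈ sphMonSpan b L at hf
    rw [← sphMonSpan_eq] at hf
    have e : sphereLaplacian (c • f) = c • sphereLaplacian f :=
      funext (sphereLaplacian_smul c (smooth_of_mem_spherePoly hf))
    rw [e, smul_comm _ c, ← smul_add]
    exact ⟨Submodule.smul_mem _ _ ih.1, fun h => by rw [ih.2 h, smul_zero]⟩

theorem sphereLaplacian_mem {L : ℕ} {f : Sphere2 → ℂ} (hf : f ∈ spherePoly L) :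
    sphereLaplacian f ∈ spherePoly L := by
  have h := spherePoly_mono (Nat.sub_le L 1) (sphereLaplacian_add_mem hf).1
  simpa using sub_mem h (Submodule.smul_mem _ ((L : ℂ) * (L + 1)) hf)

/-! ### An integral over the sphere for which the Laplacian is symmetric -/

/-- A smooth cutoff on `ℝ³`, supported in an annulus around the unit sphere. -/
noncomputable def annulusBump : ContDiffBump (1 : ℝ) := ⟨1 / 4, 1 / 2, by norm_num, by norm_num⟩

/-- The integral of a function on the sphere, defined by integrating its radial extension against
a radial cutoff. -/
noncomputable def sphereInt (h : Sphere2 → ℂ) : ℂ :=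
  ∫ y : R3, ((annulusBump (‖y‖ ^ 2) : ℝ) : ℂ) * radialExt h y

theorem SmoothOnSphere.continuous {f : Sphere2 → ℂ} (hf : SmoothOnSphere f) : Continuous f :=
  ContMDiff.continuous hf

/-- Radial extensions are singular only at the origin. A cutoff vanishing near it makes their
products with the cutoff regular on the whole space. -/
theorem annulusBump_eventually_zero :
    ∀ᶠ y in nhds (0 : R3), annulusBump (‖y‖ ^ 2) = 0 := by
  filter_upwards [Metric.ball_mem_nhds (0 : R3) (show (0 : ℝ) < 1 / 2 by norm_num)] with y hy
  apply annulusBump.zero_of_le_dist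
  have h1 : ‖y‖ < 1 / 2 := by simpa using hy
  have h2 : ‖y‖ ^ 2 < 1 / 2 := by nlinarith [norm_nonneg y]
  rw [Real.dist_eq, abs_sub_comm]
  refine le_trans ?_ (le_abs_self _)
  change (1 / 2 : ℝ) ≤ _
  linarith

theorem annulusBump_hasCompactSupport :
    HasCompactSupport fun y : R3 => ((annulusBump (‖y‖ ^ 2) : ℝ) : ℂ) := by
  refine HasCompactSupport.of_support_subset_isCompact (isCompact_closedBall (0 : R3) 2) ?_
  intro y hy
  by_contra hlt
  apply hy
  have h1 : 2 < ‖y‖ := by simpa using hlt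
  have h2 : annulusBump (‖y‖ ^ 2) = 0 := by
    apply annulusBump.zero_of_le_dist
    rw [Real.dist_eq]
    refine le_trans ?_ (le_abs_self _)
    change (1 / 2 : ℝ) ≤ _
    nlinarith
  simp [h2]

theorem annulusBump_contDiff :
    ContDiff ℝ ∞ fun y : R3 => ((annulusBump (‖y‖ ^ 2) : ℝ) : ℂ) :=
  Complex.ofRealCLM.contDiff.comp (annulusBump.contDiff.comp (contDiff_norm_sq ℝ))

theorem annulusBump_coe (x : Sphere2) : annulusBump (‖(x : R3)‖ ^ 2) = 1 := by
  rw [sphere_norm]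
  apply annulusBump.one_of_mem_closedBall
  simp [annulusBump.rIn_pos.le]

theorem continuousAt_radialExt {h : Sphere2 → ℂ} (hh : Continuous h) {y : R3} (hy : y ≠ 0) :
    ContinuousAt (radialExt h) y := by
  have h1 : ContinuousOn (radialExt h) {0}ᶜ := by
    rw [continuousOn_iff_continuous_domRestrict]
    have h2 : ({0}ᶜ : Set R3).domRestrict (radialExt h) =
        fun u : ({0}ᶜ : Set R3) => h (radialProj u.1 u.2) := by
      funext u
      have hu : ¬ (u : R3) = 0 := u.2
      simp only [Set.domRestrict_apply, radialExt, dif_neg hu]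
    rw [h2]
    refine hh.comp (Continuous.subtype_mk ?_ _)
    exact (continuous_subtype_val.norm.inv₀ fun u => norm_ne_zero_iff.mpr u.2).smul
      continuous_subtype_val
  exact h1.continuousAt (isOpen_compl_singleton.mem_nhds hy)

theorem continuous_annulusBump_mul {h : Sphere2 → ℂ} (hh : Continuous h) :
    Continuous fun y : R3 => ((annulusBump (‖y‖ ^ 2) : ℝ) : ℂ) * radialExt h y := by
  rw [continuous_iff_continuousAt]
  intro y
  by_cases hy : y = 0
  · subst hy
    have h1 : (fun y : R3 => ((annulusBump (‖y‖ ^ 2) : ℝ) : ℂ) * radialExt h y) =ᶠ[nhds 0] 0 := by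
      filter_upwards [annulusBump_eventually_zero] with y hy
      simp [hy]
    exact h1.continuousAt
  · exact annulusBump_contDiff.continuous.continuousAt.mul (continuousAt_radialExt hh hy)

theorem integrable_annulusBump_mul {h : Sphere2 → ℂ} (hh : Continuous h) :
    MeasureTheory.Integrable fun y : R3 => ((annulusBump (‖y‖ ^ 2) : ℝ) : ℂ) * radialExt h y :=
  (continuous_annulusBump_mul hh).integrable_of_hasCompactSupport
    annulusBump_hasCompactSupport.mul_right

theorem radialExt_add (f g : Sphere2 → ℂ) (y : R3) :
    radialExt (f + g) y = radialExt f y + radialExt g y := by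
  by_cases hy : y = 0 <;> simp [radialExt, hy]

theorem radialExt_const_smul (c : ℂ) (f : Sphere2 → ℂ) (y : R3) :
    radialExt (c • f) y = c * radialExt f y := by
  by_cases hy : y = 0 <;> simp [radialExt, hy]

theorem radialExt_mul (f g : Sphere2 → ℂ) (y : R3) :
    radialExt (f * g) y = radialExt f y * radialExt g y := by
  by_cases hy : y = 0 <;> simp [radialExt, hy]

theorem radialExt_star (f : Sphere2 → ℂ) (y : R3) :
    radialExt (star f) y = star (radialExt f y) := by
  by_cases hy : y = 0 <;> simp [radialExt, hy]

theorem sphereInt_add {f g : Sphere2 → ℂ} (hf : Continuous f) (hg : Continuous g) :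
    sphereInt (f + g) = sphereInt f + sphereInt g := by
  simp only [sphereInt, radialExt_add, mul_add]
  exact MeasureTheory.integral_add (integrable_annulusBump_mul hf) (integrable_annulusBump_mul hg)

theorem sphereInt_smul (c : ℂ) (f : Sphere2 → ℂ) : sphereInt (c • f) = c * sphereInt f := by
  simp only [sphereInt, radialExt_const_smul, mul_left_comm _ c]
  exact MeasureTheory.integral_const_mul c _

/-- The integrand is a continuous nonnegative function with zero integral, hence identically zero,
and the cutoff equals 1 on the sphere. -/
theorem eq_zero_of_sphereInt_mul_star {f : Sphere2 → ℂ} (hf : Continuous f)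
    (h : sphereInt (f * star f) = 0) : f = 0 := by
  have hstar : Continuous (f * star f) := hf.mul hf.star
  have e : ∀ y : R3, ((annulusBump (‖y‖ ^ 2) : ℝ) : ℂ) * radialExt (f * star f) y =
      ((annulusBump (‖y‖ ^ 2) * ‖radialExt f y‖ ^ 2 : ℝ) : ℂ) := fun y => by
    rw [radialExt_mul, radialExt_star, ← starRingEnd_apply, Complex.mul_conj']
    push_cast
    rfl
  have hc := continuous_annulusBump_mul hstar
  have hi := integrable_annulusBump_mul hstar
  simp only [sphereInt, e] at h hc hi
  rw [integral_complex_ofReal, Complex.ofReal_eq_zero] at h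
  have hc' : Continuous fun y : R3 => annulusBump (‖y‖ ^ 2) * ‖radialExt f y‖ ^ 2 := by
    exact (Complex.continuous_re.comp hc).congr fun y => Complex.ofReal_re _
  have hi' : MeasureTheory.Integrable
      fun y : R3 => annulusBump (‖y‖ ^ 2) * ‖radialExt f y‖ ^ 2 := by
    exact hi.re.congr (Filter.Eventually.of_forall fun y => Complex.ofReal_re _)
  rw [MeasureTheory.integral_eq_zero_iff_of_nonneg
    (fun y => mul_nonneg annulusBump.nonneg (sq_nonneg _)) hi'] at h
  have h0 := (hc'.ae_eq_iff_eq MeasureTheory.volume continuous_const).mp h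
  funext x
  have hx : annulusBump (‖(x : R3)‖ ^ 2) * ‖radialExt f (x : R3)‖ ^ 2 = 0 := congrFun h0 (x : R3)
  rw [annulusBump_coe, radialExt_coe, one_mul] at hx
  simpa using hx

/-! ### Green's identity for radial extensions -/

/-- Integration by parts against the constant function 1. It serves as the divergence theorem for
compactly supported fields. -/
theorem integral_fderiv_eq_zero {h : R3 → ℂ} (hh : ContDiff ℝ 1 h) (hs : HasCompactSupport h)
    (v : R3) : ∫ y, fderiv ℝ h y v = 0 := by
  have hc : Continuous fun y => fderiv ℝ h y v :=
    (hh.continuous_fderiv one_ne_zero).clm_apply continuous_const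
  have hi : MeasureTheory.Integrable fun y => fderiv ℝ h y v :=
    hc.integrable_of_hasCompactSupport (hs.fderiv_apply ℝ v)
  have key := integral_mul_fderiv_eq_neg_fderiv_mul_of_integrable
    (μ := MeasureTheory.volume) (f := fun _ : R3 => (1 : ℂ)) (g := h) (v := v)
    (by simp) (by simpa using hi)
    (by simpa using hh.continuous.integrable_of_hasCompactSupport hs)
    (fun x _ => differentiableAt_const _) (fun x _ => hh.differentiable one_ne_zero x)
  simpa using key

theorem fderiv_radialExt_self {f : Sphere2 → ℂ} (hf : SmoothOnSphere f) {y : R3} (hy : y ≠ 0) :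
    fderiv ℝ (radialExt f) y y = 0 := by
  have hd : DifferentiableAt ℝ (radialExt f) y :=
    (hf.contDiffAt_radialExt hy).differentiableAt (by simp)
  have hline : HasDerivAt (fun t : ℝ => y + t • y) y 0 := by
    simpa using ((hasDerivAt_id (0 : ℝ)).smul_const y).const_add y
  have h1 : HasDerivAt (fun t : ℝ => radialExt f (y + t • y)) (fderiv ℝ (radialExt f) y y) 0 :=
    HasFDerivAt.comp_hasDerivAt_of_eq (0 : ℝ) hd.hasFDerivAt hline (by simp)
  have h2 : (fun t : ℝ => radialExt f (y + t • y)) =ᶠ[nhds 0] fun _ => radialExt f y := by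
    filter_upwards [Ioi_mem_nhds (show (-1 : ℝ) < 0 by norm_num)] with t ht
    have ht' : (0 : ℝ) < 1 + t := by
      have : -1 < t := ht
      linarith
    rw [← radialExt_smul f ht' y, add_smul, one_smul]
  exact h1.unique ((hasDerivAt_const (0 : ℝ) (radialExt f y)).congr_of_eventuallyEq h2)

theorem contDiffAt_fderiv_radialExt {f : Sphere2 → ℂ} (hf : SmoothOnSphere f) {y : R3}
    (hy : y ≠ 0) (v : R3) : ContDiffAt ℝ 1 (fun y => fderiv ℝ (radialExt f) y v) y :=
  (((hf.contDiffAt_radialExt hy).of_le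
    (show ((2 : ℕ) : WithTop ℕ∞) ≤ ∞ by norm_cast)).fderiv_right (m := 1) (by norm_num)).clm_apply
    contDiffAt_const

/-- The radial weight `|y|²` times the cutoff. -/
noncomputable def annulusWeight (y : R3) : ℂ := ((‖y‖ ^ 2 * annulusBump (‖y‖ ^ 2) : ℝ) : ℂ)

theorem annulusWeight_contDiff : ContDiff ℝ ∞ annulusWeight :=
  Complex.ofRealCLM.contDiff.comp
    ((contDiff_norm_sq ℝ).mul (annulusBump.contDiff.comp (contDiff_norm_sq ℝ)))

/-- The gradient of a radial weight is radial, while radial extensions have no radial derivative.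
Hence the derivative of the weight drops out of the divergence of the flux. -/
theorem exists_fderiv_annulusWeight (y : R3) :
    ∃ k : ℂ, ∀ v : R3, fderiv ℝ annulusWeight y v = k * ((inner ℝ v y : ℝ) : ℂ) := by
  let κ : ℝ → ℝ := fun u => u * annulusBump u
  have hκ : DifferentiableAt ℝ κ (‖y‖ ^ 2) :=
    (differentiable_id.mul (annulusBump.contDiff (n := 1).differentiable one_ne_zero)) _
  have h1 : HasFDerivAt (fun y : R3 => ‖y‖ ^ 2) (2 • innerSL ℝ y) y :=
    (hasStrictFDerivAt_norm_sq y).hasFDerivAt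
  have h3 : HasFDerivAt (fun y : R3 => κ (‖y‖ ^ 2)) (deriv κ (‖y‖ ^ 2) • (2 • innerSL ℝ y)) y := by
    have h := hκ.hasDerivAt
    exact HasDerivAt.comp_hasFDerivAt (f := fun y : R3 => ‖y‖ ^ 2) y h h1
  have h2 : HasFDerivAt annulusWeight
      (Complex.ofRealCLM.comp (deriv κ (‖y‖ ^ 2) • (2 • innerSL ℝ y))) y :=
    Complex.ofRealCLM.hasFDerivAt.comp y h3
  refine ⟨(2 * deriv κ (‖y‖ ^ 2) : ℝ), fun v => ?_⟩
  rw [h2.fderiv]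
  simp [real_inner_comm]
  ring

/-- The flux field whose divergence expresses the symmetry of the spherical Laplacian. -/
noncomputable def greenFlux (f g : Sphere2 → ℂ) (v y : R3) : ℂ :=
  annulusWeight y * (radialExt g y * fderiv ℝ (radialExt f) y v
    - radialExt f y * fderiv ℝ (radialExt g) y v)

theorem annulusWeight_eventually_zero : ∀ᶠ y in nhds (0 : R3), annulusWeight y = 0 := by
  filter_upwards [annulusBump_eventually_zero] with y hy
  simp [annulusWeight, hy]

theorem greenFlux_contDiff {f g : Sphere2 → ℂ} (hf : SmoothOnSphere f) (hg : SmoothOnSphere g)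
    (v : R3) : ContDiff ℝ 1 (greenFlux f g v) := by
  rw [contDiff_iff_contDiffAt]
  intro y
  by_cases hy : y = 0
  · subst hy
    have h1 : greenFlux f g v =ᶠ[nhds 0] fun _ => 0 := by
      filter_upwards [annulusWeight_eventually_zero] with y hy
      simp [greenFlux, hy]
    exact contDiffAt_const.congr_of_eventuallyEq h1
  · have h1 : (1 : WithTop ℕ∞) ≤ ∞ := by norm_cast
    exact (annulusWeight_contDiff.of_le h1).contDiffAt.mul
      ((((hg.contDiffAt_radialExt hy).of_le h1).mul (contDiffAt_fderiv_radialExt hf hy v)).sub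
      (((hf.contDiffAt_radialExt hy).of_le h1).mul (contDiffAt_fderiv_radialExt hg hy v)))

theorem greenFlux_hasCompactSupport (f g : Sphere2 → ℂ) (v : R3) :
    HasCompactSupport (greenFlux f g v) := by
  refine HasCompactSupport.mul_right (annulusBump_hasCompactSupport.mono fun y hy => ?_)
  intro h
  apply hy
  have h' : annulusBump (‖y‖ ^ 2) = 0 := by simpa using h
  simp [annulusWeight, h']

theorem fderiv_greenFlux {f g : Sphere2 → ℂ} (hf : SmoothOnSphere f) (hg : SmoothOnSphere g)
    {y : R3} (hy : y ≠ 0) (v : R3) :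
    fderiv ℝ (greenFlux f g v) y v =
      fderiv ℝ annulusWeight y v * (radialExt g y * fderiv ℝ (radialExt f) y v
        - radialExt f y * fderiv ℝ (radialExt g) y v)
      + annulusWeight y * (radialExt g y * fderiv ℝ (fderiv ℝ (radialExt f)) y v v
        - radialExt f y * fderiv ℝ (fderiv ℝ (radialExt g)) y v v) := by
  have hW := (annulusWeight_contDiff.differentiable (by simp) y).hasFDerivAt
  have hF := ((hf.contDiffAt_radialExt hy).differentiableAt (by simp)).hasFDerivAt
  have hG := ((hg.contDiffAt_radialExt hy).differentiableAt (by simp)).hasFDerivAt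
  have h2 : ((2 : ℕ) : WithTop ℕ∞) ≤ ∞ := by norm_cast
  have hF2 := ((((hf.contDiffAt_radialExt hy).of_le h2).fderiv_right (m := 1)
    (by norm_num)).differentiableAt one_ne_zero).hasFDerivAt.clm_apply (hasFDerivAt_const v y)
  have hG2 := ((((hg.contDiffAt_radialExt hy).of_le h2).fderiv_right (m := 1)
    (by norm_num)).differentiableAt one_ne_zero).hasFDerivAt.clm_apply (hasFDerivAt_const v y)
  have key := hW.mul ((hG.mul hF2).sub (hF.mul hG2))
  have e : greenFlux f g v = annulusWeight * (radialExt g * (fun y => fderiv ℝ (radialExt f) y v)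
    - radialExt f * fun y => fderiv ℝ (radialExt g) y v) := rfl
  rw [e, key.fderiv]
  simp
  ring

theorem sum_fderiv_greenFlux {f g : Sphere2 → ℂ} (hf : SmoothOnSphere f) (hg : SmoothOnSphere g)
    (b : OrthonormalBasis (Fin 3) ℝ R3) (y : R3) :
    ∑ i, fderiv ℝ (greenFlux f g (b i)) y (b i) = ((annulusBump (‖y‖ ^ 2) : ℝ) : ℂ) *
      (radialExt (sphereLaplacian f) y * radialExt g y
        - radialExt f y * radialExt (sphereLaplacian g) y) := by
  by_cases hy : y = 0
  · subst hy
    have h1 : ∀ v, greenFlux f g v =ᶠ[nhds 0] fun _ => 0 := fun v => by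
      filter_upwards [annulusWeight_eventually_zero] with y hy
      simp [greenFlux, hy]
    have h2 := annulusBump_eventually_zero.self_of_nhds
    simp only [(h1 _).fderiv_eq, h2]
    simp
  · obtain ⟨k, hk⟩ := exists_fderiv_annulusWeight y
    have hrad : ∀ {f : Sphere2 → ℂ}, SmoothOnSphere f →
        ∑ i, ((inner ℝ (b i) y : ℝ) : ℂ) * fderiv ℝ (radialExt f) y (b i) = 0 := fun {f} hf => by
      have h := congrArg (fderiv ℝ (radialExt f) y) (b.sum_repr' y)
      rw [map_sum, fderiv_radialExt_self hf hy] at h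
      simpa only [map_smul, Complex.real_smul] using h
    -- The factor ‖y‖⁻² appearing here is what the ‖y‖² in the weight cancels.
    have hlap : ∀ {f : Sphere2 → ℂ}, SmoothOnSphere f →
        ∑ i, fderiv ℝ (fderiv ℝ (radialExt f)) y (b i) (b i) =
          ((‖y‖ : ℂ)⁻¹) ^ 2 * radialExt (sphereLaplacian f) y := fun {f} hf => by
      rw [← laplacian_eq_sum_fderiv, laplacian_radialExt hf hy]
    simp only [fderiv_greenFlux hf hg hy, hk]
    have e : ∀ i, k * ((inner ℝ (b i) y : ℝ) : ℂ) * (radialExt g y * fderiv ℝ (radialExt f) y (b i)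
        - radialExt f y * fderiv ℝ (radialExt g) y (b i))
      + annulusWeight y * (radialExt g y * fderiv ℝ (fderiv ℝ (radialExt f)) y (b i) (b i)
        - radialExt f y * fderiv ℝ (fderiv ℝ (radialExt g)) y (b i) (b i)) =
      k * radialExt g y * (((inner ℝ (b i) y : ℝ) : ℂ) * fderiv ℝ (radialExt f) y (b i))
      - k * radialExt f y * (((inner ℝ (b i) y : ℝ) : ℂ) * fderiv ℝ (radialExt g) y (b i))
      + annulusWeight y * radialExt g y * fderiv ℝ (fderiv ℝ (radialExt f)) y (b i) (b i)
      - annulusWeight y * radialExt f y * fderiv ℝ (fderiv ℝ (radialExt g)) y (b i) (b i) :=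
      fun i => by ring
    rw [Finset.sum_congr rfl fun i _ => e i]
    simp only [Finset.sum_add_distrib, Finset.sum_sub_distrib, ← Finset.mul_sum, hrad hf,
      hrad hg, hlap hf, hlap hg, annulusWeight]
    have hn : (‖y‖ : ℂ) ≠ 0 := by exact_mod_cast norm_ne_zero_iff.mpr hy
    push_cast
    field_simp
    ring

/-- The spherical Laplacian is symmetric. -/
theorem sphereInt_laplacian_mul {f g : Sphere2 → ℂ} (hf : SmoothOnSphere f)
    (hg : SmoothOnSphere g) (hf' : Continuous (sphereLaplacian f))
    (hg' : Continuous (sphereLaplacian g)) :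
    sphereInt (sphereLaplacian f * g) = sphereInt (f * sphereLaplacian g) := by
  let b := EuclideanSpace.basisFun (Fin 3) ℝ
  have hi : ∀ i, MeasureTheory.Integrable fun y => fderiv ℝ (greenFlux f g (b i)) y (b i) :=
    fun i => Continuous.integrable_of_hasCompactSupport
      (((greenFlux_contDiff hf hg (b i)).continuous_fderiv one_ne_zero).clm_apply continuous_const)
      ((greenFlux_hasCompactSupport f g (b i)).fderiv_apply ℝ (b i))
  have h1 : ∫ y, ∑ i, fderiv ℝ (greenFlux f g (b i)) y (b i) = 0 := by
    rw [MeasureTheory.integral_finsetSum _ fun i _ => hi i]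
    exact Finset.sum_eq_zero fun i _ => integral_fderiv_eq_zero (greenFlux_contDiff hf hg (b i))
      (greenFlux_hasCompactSupport f g (b i)) (b i)
  simp only [sum_fderiv_greenFlux hf hg b, ← radialExt_mul, mul_sub] at h1
  rw [MeasureTheory.integral_sub (integrable_annulusBump_mul (hf'.mul hg.continuous))
    (integrable_annulusBump_mul (hf.continuous.mul hg'))] at h1
  exact sub_eq_zero.mp h1

/-! ### Density of polynomials and eigenfunctions -/

/-- The polynomial functions as a star subalgebra of the continuous functions. -/
noncomputable def spherePolyAlgebra : StarSubalgebra ℂ C(Sphere2, ℂ) where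
  carrier := {u | ∃ L, (u : Sphere2 → ℂ) ∈ spherePoly L}
  mul_mem' := by
    rintro u v ⟨L, hu⟩ ⟨M, hv⟩
    exact ⟨L + M, mul_mem_spherePoly hu hv⟩
  add_mem' := by
    rintro u v ⟨L, hu⟩ ⟨M, hv⟩
    exact ⟨L + M, add_mem (spherePoly_mono (Nat.le_add_right L M) hu)
      (spherePoly_mono (Nat.le_add_left M L) hv)⟩
  algebraMap_mem' c := by
    refine ⟨0, ?_⟩
    have h : ((algebraMap ℂ C(Sphere2, ℂ) c : C(Sphere2, ℂ)) : Sphere2 → ℂ) = c • 1 := by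
      funext x
      simp [Algebra.algebraMap_eq_smul_one]
    rw [h, spherePoly, pow_zero]
    exact Submodule.smul_mem _ _ (Submodule.one_le.mp le_rfl)
  star_mem' := by
    rintro u ⟨L, hu⟩
    exact ⟨L, star_mem_spherePoly hu⟩

theorem spherePolyAlgebra_separatesPoints : spherePolyAlgebra.SeparatesPoints := by
  intro x y hxy
  have hne : (x : R3) - y ≠ 0 := sub_ne_zero.mpr fun h => hxy (Subtype.ext h)
  let v : R3 := x - y
  let u : C(Sphere2, ℂ) := ⟨fun x => ((inner ℝ v (x : R3) : ℝ) : ℂ), by fun_prop⟩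
  refine ⟨u, ⟨u, ⟨1, ?_⟩, rfl⟩, ?_⟩
  · rw [spherePoly, pow_one]
    exact inner_mem_sphereAffine v
  · intro h
    have h1 : inner ℝ v (x : R3) = inner ℝ v (y : R3) := Complex.ofReal_injective h
    rw [← sub_eq_zero, ← inner_sub_right] at h1
    exact hne (inner_self_eq_zero.mp h1)

theorem norm_sphereInt_mul_le {q : Sphere2 → ℂ} (hq : Continuous q) (u : C(Sphere2, ℂ)) :
    ‖sphereInt (q * u)‖ ≤
      (∫ y : R3, ‖((annulusBump (‖y‖ ^ 2) : ℝ) : ℂ) * radialExt q y‖) * ‖u‖ := by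
  rw [sphereInt, ← MeasureTheory.integral_mul_const]
  refine MeasureTheory.norm_integral_le_of_norm_le
    ((integrable_annulusBump_mul hq).norm.mul_const _) (Filter.Eventually.of_forall fun y => ?_)
  rw [radialExt_mul, ← mul_assoc, norm_mul]
  refine mul_le_mul_of_nonneg_left ?_ (norm_nonneg _)
  by_cases hy : y = 0
  · simp [radialExt, hy]
  · simp only [radialExt, dif_neg hy]
    exact u.norm_coe_le_norm _

/-- Integration against a continuous function. -/
noncomputable def sphereIntMul {q : Sphere2 → ℂ} (hq : Continuous q) : C(Sphere2, ℂ) →ₗ[ℂ] ℂ where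
  toFun u := sphereInt (q * u)
  map_add' u v := by
    rw [ContinuousMap.coe_add, mul_add, sphereInt_add (hq.mul u.continuous) (hq.mul v.continuous)]
  map_smul' c u := by
    rw [ContinuousMap.coe_smul, mul_smul_comm, sphereInt_smul]
    rfl

theorem closure_spherePolyAlgebra :
    closure (spherePolyAlgebra : Set C(Sphere2, ℂ)) = Set.univ := by
  rw [← StarSubalgebra.topologicalClosure_coe,
    ContinuousMap.starSubalgebra_topologicalClosure_eq_top_of_separatesPoints _
      spherePolyAlgebra_separatesPoints]
  rfl

/-- By Stone-Weierstrass polynomials approximate conj q uniformly, and pairing with q is continuous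
in the sup norm. So q is orthogonal to its own conjugate and vanishes by definiteness. -/
theorem eq_zero_of_orthogonal_spherePoly {q : Sphere2 → ℂ} (hq : Continuous q)
    (h : ∀ M, ∀ v ∈ spherePoly M, sphereInt (q * v) = 0) : q = 0 := by
  have hcont : Continuous (sphereIntMul hq) :=
    AddMonoidHomClass.continuous_of_bound (sphereIntMul hq) _ (norm_sphereInt_mul_le hq)
  have hclosed : IsClosed {u | sphereIntMul hq u = 0} := isClosed_eq hcont continuous_const
  have htop : closure (spherePolyAlgebra : Set C(Sphere2, ℂ)) ⊆ {u | sphereIntMul hq u = 0} := by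
    refine closure_minimal ?_ hclosed
    rintro u ⟨L, hu⟩
    exact h L u hu
  rw [closure_spherePolyAlgebra] at htop
  exact eq_zero_of_sphereInt_mul_star hq (htop (Set.mem_univ (⟨star q, hq.star⟩ : C(Sphere2, ℂ))))

/-- The bilinear pairing on the finite-dimensional polynomial space is nondegenerate because the
space is stable under conjugation. Hence every functional on it, in particular pairing with f, is
represented by a polynomial. -/
theorem exists_projection_spherePoly (L : ℕ) {f : Sphere2 → ℂ} (hf : Continuous f) :
    ∃ p ∈ spherePoly L, ∀ u ∈ spherePoly L, sphereInt ((f - p) * u) = 0 := by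
  have hcont : ∀ u : spherePoly L, Continuous (u : Sphere2 → ℂ) := fun u =>
    (smooth_of_mem_spherePoly u.2).continuous
  let D : spherePoly L →ₗ[ℂ] Module.Dual ℂ (spherePoly L) :=
    LinearMap.mk₂ ℂ (fun v u => sphereInt ((v : Sphere2 → ℂ) * u))
      (fun u v w => by
        rw [Submodule.coe_add, add_mul,
          sphereInt_add ((hcont u).mul (hcont w)) ((hcont v).mul (hcont w))])
      (fun c u v => by
        rw [Submodule.coe_smul, smul_mul_assoc, sphereInt_smul, smul_eq_mul])
      (fun u v w => by
        rw [Submodule.coe_add, mul_add,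
          sphereInt_add ((hcont u).mul (hcont v)) ((hcont u).mul (hcont w))])
      (fun c u v => by
        rw [Submodule.coe_smul, mul_smul_comm, sphereInt_smul, smul_eq_mul])
  have hinj : Function.Injective D := by
    rw [← LinearMap.ker_eq_bot, LinearMap.ker_eq_bot']
    intro v hv
    have h := LinearMap.congr_fun hv ⟨star (v : Sphere2 → ℂ), star_mem_spherePoly v.2⟩
    exact Subtype.ext (eq_zero_of_sphereInt_mul_star (hcont v) h)
  have hsurj := (LinearMap.injective_iff_surjective_of_finrank_eq_finrank
    (Subspace.dual_finrank_eq (K := ℂ) (V := spherePoly L)).symm).mp hinj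
  let φ : Module.Dual ℂ (spherePoly L) :=
    { toFun := fun u => sphereInt (f * u)
      map_add' := fun u v => by
        rw [Submodule.coe_add, mul_add,
          sphereInt_add (hf.mul (hcont u)) (hf.mul (hcont v))]
      map_smul' := fun c u => by
        rw [Submodule.coe_smul, mul_smul_comm, sphereInt_smul]
        rfl }
  obtain ⟨p, hp⟩ := hsurj φ
  refine ⟨p, p.2, fun u hu => ?_⟩
  have h := LinearMap.congr_fun hp ⟨u, hu⟩
  change sphereInt ((p : Sphere2 → ℂ) * u) = sphereInt (f * u) at h
  have e : (f - (p : Sphere2 → ℂ)) * u = f * u + (-1 : ℂ) • ((p : Sphere2 → ℂ) * u) := by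
    rw [neg_one_smul, sub_mul, sub_eq_add_neg]
  have hu' := hcont ⟨u, hu⟩
  rw [e, sphereInt_add (hf.mul hu') (((hcont p).mul hu').const_smul _), sphereInt_smul, h]
  ring

/-- Smooth eigenfunctions of the spherical Laplacian are polynomial. -/
theorem mem_spherePoly_of_eigenfunction {L : ℕ} {ev : ℝ} (hev : ev < (L + 1) * (L + 2))
    {f : Sphere2 → ℂ} (hf : SmoothOnSphere f)
    (hfe : sphereLaplacian f = -(ev : ℂ) • f) : f ∈ spherePoly L := by
  obtain ⟨p, hp, hpo⟩ := exists_projection_spherePoly L hf.continuous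
  have hps := smooth_of_mem_spherePoly hp
  have hlapc : ∀ {M : ℕ} {u : Sphere2 → ℂ}, u ∈ spherePoly M → Continuous (sphereLaplacian u) :=
    fun hu => (smooth_of_mem_spherePoly (sphereLaplacian_mem hu)).continuous
  set q := f - p with hq
  have eq1 : q = f + (-1 : ℂ) • p := by rw [hq, neg_one_smul, sub_eq_add_neg]
  have hqs : SmoothOnSphere q := eq1 ▸ hf.add (hps.smul _)
  have hqlap : sphereLaplacian q = sphereLaplacian f - sphereLaplacian p := by
    funext x
    rw [eq1, sphereLaplacian_add hf (hps.smul _), sphereLaplacian_smul _ hps]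
    simp only [Pi.sub_apply]
    ring
  have hfc : Continuous (sphereLaplacian f) := by
    rw [hfe]
    exact hf.continuous.const_smul _
  have hqc : Continuous (sphereLaplacian q) := by
    rw [hqlap]
    exact hfc.sub (hlapc hp)
  have hsymm : ∀ {M : ℕ} {u : Sphere2 → ℂ}, u ∈ spherePoly M →
      sphereInt (sphereLaplacian q * u) = sphereInt (q * sphereLaplacian u) := fun hu =>
    sphereInt_laplacian_mul hqs (smooth_of_mem_spherePoly hu) hqc (hlapc hu)
  let r := sphereLaplacian p + (ev : ℂ) • p
  have hr : r ∈ spherePoly L := add_mem (sphereLaplacian_mem hp) (Submodule.smul_mem _ _ hp)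
  have hqr : sphereLaplacian q = -(ev : ℂ) • q + (-1 : ℂ) • r := by
    rw [hqlap, hfe, hq]
    simp only [r]
    module
  -- Pairing the equation for Δq with conj r and moving Δ across leaves only the integral of r *
  -- conj r, because q is orthogonal to polynomials of degree at most L.
  have hr0 : r = 0 := by
    apply eq_zero_of_sphereInt_mul_star (smooth_of_mem_spherePoly hr).continuous
    have hu := star_mem_spherePoly hr
    have hus := smooth_of_mem_spherePoly hu
    have h1 := hsymm hu
    rw [hpo _ (sphereLaplacian_mem hu), hqr, add_mul, smul_mul_assoc, smul_mul_assoc,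
      sphereInt_add ((hqs.continuous.mul hus.continuous).const_smul _)
        (((smooth_of_mem_spherePoly hr).continuous.mul hus.continuous).const_smul _),
      sphereInt_smul, sphereInt_smul, hpo _ hu] at h1
    simpa using h1
  have hqe : sphereLaplacian q = -(ev : ℂ) • q := by rw [hqr, hr0, smul_zero, add_zero]
  -- For u of degree M + 1, (Δ + (M+1)(M+2))u has degree at most M, so by symmetry ((M+1)(M+2) - ev)
  -- times the pairing of q with u is 0. The bound on `ev` makes this factor nonzero.
  have horth : ∀ M, L ≤ M → ∀ u ∈ spherePoly M, sphereInt (q * u) = 0 := by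
    intro M hM
    induction M, hM using Nat.le_induction with
    | base => exact hpo
    | succ M hM ih =>
      intro u hu
      have hus := smooth_of_mem_spherePoly hu
      have h1 := ih _ (sphereLaplacian_add_mem hu).1
      have h2 := hsymm hu
      rw [hqe, smul_mul_assoc, sphereInt_smul] at h2
      rw [mul_add, sphereInt_add (hqs.continuous.mul (hlapc hu))
        (hqs.continuous.mul (hus.continuous.const_smul _)), mul_smul_comm, sphereInt_smul,
        ← h2, ← add_mul] at h1
      refine (mul_eq_zero.mp h1).resolve_left fun h0 => ?_
      have h3 : (M + 1 : ℝ) * (M + 1 + 1) = ev := by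
        have h4 : (((M + 1 : ℝ) * (M + 1 + 1) - ev : ℝ) : ℂ) = 0 := by
          push_cast at h0 ⊢
          linear_combination h0
        exact sub_eq_zero.mp (Complex.ofReal_eq_zero.mp h4)
      have h5 : (L : ℝ) ≤ M := by exact_mod_cast hM
      nlinarith [(Nat.cast_nonneg L : (0 : ℝ) ≤ L)]
  have hq0 : q = 0 := by
    refine eq_zero_of_orthogonal_spherePoly hqs.continuous fun M u hu => ?_
    exact horth (max L M) (le_max_left _ _) u (spherePoly_mono (le_max_right _ _) hu)
  rw [sub_eq_zero.mp hq0]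
  exact hp

/-! ### Rotations -/

/-- The linear isometry of `ℝ³` defined by a rotation. -/
noncomputable def SO3.isometry (g : SO3) : R3 ≃ₗᵢ[ℝ] R3 :=
  LinearIsometry.toLinearIsometryEquiv
    ⟨Matrix.toEuclideanLin (g : Matrix (Fin 3) (Fin 3) ℝ), SO3.norm_apply g⟩ rfl

theorem SO3.isometry_apply (g : SO3) (x : R3) :
    g.isometry x = Matrix.toEuclideanLin (g : Matrix (Fin 3) (Fin 3) ℝ) x := rfl

theorem SO3.coe_rotate (g : SO3) (x : Sphere2) : (g.rotate x : R3) = g.isometry x := rfl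

theorem SO3.rotate_one (x : Sphere2) : (1 : SO3).rotate x = x := by
  apply Subtype.ext
  simp [SO3.rotate, Matrix.toLpLin_one]

theorem SO3.rotate_mul (g h : SO3) (x : Sphere2) : (g * h).rotate x = g.rotate (h.rotate x) := by
  apply Subtype.ext
  simp [SO3.rotate, Matrix.toLpLin_apply]

theorem SO3.eq_one_of_rotate {g : SO3} (h : ∀ x, g.rotate x = x) : g = 1 := by
  apply Subtype.ext
  ext i j
  have hx := congrArg (fun y : Sphere2 => (y : R3) i)
    (h ⟨EuclideanSpace.single j (1 : ℝ), by simp⟩)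
  simpa [SO3.rotate, Matrix.toLpLin_apply, Matrix.one_apply, Pi.single_apply] using hx

theorem radialExt_rotate (f : Sphere2 → ℂ) (g : SO3) (y : R3) :
    radialExt (fun x => f (g.rotate x)) y = radialExt f (g.isometry y) := by
  by_cases hy : y = 0
  · simp [radialExt, hy]
  · have hgy : g.isometry y ≠ 0 := by simpa using hy
    simp only [radialExt, dif_neg hy, dif_neg hgy]
    congr 1
    apply Subtype.ext
    simp [SO3.coe_rotate, radialProj]

theorem sphereLaplacian_rotate {f : Sphere2 → ℂ} (hf : SmoothOnSphere f) (g : SO3)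
    (hfg : SmoothOnSphere fun x => f (g.rotate x)) (x : Sphere2) :
    sphereLaplacian (fun x => f (g.rotate x)) x = sphereLaplacian f (g.rotate x) := by
  let b := EuclideanSpace.basisFun (Fin 3) ℝ
  rw [sphereLaplacian, sphereLaplacian, sphereLaplacian_eq_sum_deriv b hfg (sphere_ne_zero _),
    sphereLaplacian_eq_sum_deriv (b.map g.isometry) hf (sphere_ne_zero _)]
  refine Finset.sum_congr rfl fun i _ => ?_
  congr 2
  funext t
  rw [radialExt_rotate, map_add, map_smul, SO3.coe_rotate, OrthonormalBasis.map_apply]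

/-- Precomposition with a rotation, as an algebra homomorphism. -/
noncomputable def SO3.pullback (g : SO3) : (Sphere2 → ℂ) →ₐ[ℂ] (Sphere2 → ℂ) :=
  AlgHom.pi fun x => Pi.evalAlgHom ℂ _ (g.rotate x)

theorem SO3.pullback_apply (g : SO3) (f : Sphere2 → ℂ) (x : Sphere2) :
    g.pullback f x = f (g.rotate x) := rfl

theorem SO3.pullback_mem {g : SO3} {L : ℕ} {f : Sphere2 → ℂ} (hf : f ∈ spherePoly L) :
    g.pullback f ∈ spherePoly L := by
  have h1 : sphereAffine.map g.pullback.toLinearMap ≤ sphereAffine := by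
    conv_lhs => rw [sphereAffine]
    rw [Submodule.map_span, Submodule.span_le]
    rintro _ ⟨f, rfl | ⟨v, rfl⟩, rfl⟩
    · exact one_mem_sphereAffine
    · have h : g.pullback (fun x : Sphere2 => ((inner ℝ v (x : R3) : ℝ) : ℂ)) =
          fun x : Sphere2 => ((inner ℝ (g.isometry.symm v) (x : R3) : ℝ) : ℂ) := by
        funext x
        rw [SO3.pullback_apply, SO3.coe_rotate, ← LinearIsometryEquiv.inner_map_map g.isometry
          (g.isometry.symm v), LinearIsometryEquiv.apply_symm_apply]
      change g.pullback (fun x : Sphere2 => ((inner ℝ v (x : R3) : ℝ) : ℂ)) ∈ sphereAffine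
      rw [h]
      exact inner_mem_sphereAffine _
  have h2 : (spherePoly L).map g.pullback.toLinearMap ≤ spherePoly L := by
    rw [spherePoly, Submodule.map_pow]
    exact pow_le_pow_left' h1 L
  exact h2 ⟨f, hf, rfl⟩

/-- In the coordinates adapted to the frame `b`, the rotation `g` fixes the axis and multiplies the
transverse complex coordinate by `ζ`. -/
structure SO3.IsFrame (g : SO3) (b : OrthonormalBasis (Fin 3) ℝ R3) (ζ : ℂ) : Prop where
  norm_eq : ‖ζ‖ = 1
  axial_eq : ∀ x : Sphere2, axial b (g.rotate x) = axial b x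
  transverse_eq : ∀ x : Sphere2, transverse b Complex.I (g.rotate x) = ζ * transverse b Complex.I x

theorem exists_fixed_unit (g : SO3) : ∃ v : R3, ‖v‖ = 1 ∧ g.isometry v = v := by
  set M := (g : Matrix (Fin 3) (Fin 3) ℝ) with hM
  have hg := Matrix.mem_specialOrthogonalGroup_iff.mp g.2
  have h1 : M * M.transpose = 1 := by
    simpa [Matrix.star_eq_conjTranspose] using (Matrix.mem_orthogonalGroup_iff (Fin 3) ℝ).mp hg.1
  have h2 : M.det = 1 := hg.2
  -- M - 1 = M(1 - M)ᵀ gives det(M - 1) = det(1 - M), which is -det(M - 1) in odd dimension.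
  have hdet : (M - 1).det = 0 := by
    have e : M - 1 = M * (1 - M).transpose := by
      rw [Matrix.transpose_sub, mul_sub, h1, Matrix.transpose_one, mul_one]
    have h3 : (M - 1).det = (1 - M).det := by
      conv_lhs => rw [e]
      rw [Matrix.det_mul, h2, one_mul, Matrix.det_transpose]
    have h4 : (1 - M).det = -(M - 1).det := by
      rw [← neg_sub, Matrix.det_neg]
      simp
      ring
    linarith
  obtain ⟨u, hu0, hu⟩ := Matrix.exists_mulVec_eq_zero_iff.mpr hdet
  have hu' : M.mulVec u = u := by
    rw [Matrix.sub_mulVec, Matrix.one_mulVec] at hu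
    exact sub_eq_zero.mp hu
  let v : R3 := WithLp.toLp 2 u
  have hv0 : v ≠ 0 := fun h => hu0 (by simpa [v] using congrArg WithLp.ofLp h)
  have hv : g.isometry v = v := by
    rw [SO3.isometry_apply, Matrix.toLpLin_apply]
    exact congrArg (WithLp.toLp 2) hu'
  exact ⟨‖v‖⁻¹ • v, by rw [norm_smul, norm_inv, norm_norm,
    inv_mul_cancel₀ (norm_ne_zero_iff.mpr hv0)], by rw [map_smul, hv]⟩

/-- Take a fixed unit vector as the third axis. Orthogonality and determinant 1 leave a planar
rotation block, which is multiplication by a unit complex number. -/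
theorem SO3.exists_isFrame (g : SO3) : ∃ b ζ, g.IsFrame b ζ := by
  obtain ⟨v, hv, hgv⟩ := exists_fixed_unit g
  obtain ⟨b, hb⟩ := Orthonormal.exists_orthonormalBasis_extension_of_card_eq (𝕜 := ℝ) (E := R3)
    (ι := Fin 3) (by simp) (v := fun _ => v) (s := {2}) (by
      rw [orthonormal_iff_ite]
      rintro ⟨i, rfl⟩ ⟨j, rfl⟩
      simp [hv])
  have hb2 : b 2 = v := hb 2 rfl
  let G := g.isometry
  have hfix : G (b 2) = b 2 := by rw [hb2]; exact hgv
  let A : Matrix (Fin 3) (Fin 3) ℝ := Matrix.of fun i j => inner ℝ (b i) (G (b j))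
  have hdet : A.det = 1 := by
    have h1 : LinearMap.toMatrix b.toBasis b.toBasis
        (Matrix.toEuclideanLin (g : Matrix (Fin 3) (Fin 3) ℝ)) = A := by
      ext i j
      rw [LinearMap.toMatrix_apply]
      simp only [OrthonormalBasis.coe_toBasis, OrthonormalBasis.coe_toBasis_repr_apply,
        OrthonormalBasis.repr_apply_apply]
      rfl
    rw [← h1, LinearMap.det_toMatrix]
    have h2 := (Matrix.mem_specialOrthogonalGroup_iff.mp g.2).2
    rw [← h2]
    simp
  have hcol : ∀ i j, ∑ k, A k i * A k j = if i = j then 1 else 0 := fun i j => by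
    rw [← b.inner_eq_ite i j, ← LinearIsometryEquiv.inner_map_map G (b i) (b j),
      ← b.sum_inner_mul_inner (G (b i)) (G (b j))]
    exact Finset.sum_congr rfl fun k _ => by simp only [A, Matrix.of_apply, real_inner_comm]
  have hA2 : ∀ i, A i 2 = if i = 2 then 1 else 0 := fun i => by
    change inner ℝ (b i) (G (b 2)) = _
    rw [hfix, b.inner_eq_ite]
  have h2A : ∀ i, A 2 i = if 2 = i then 1 else 0 := fun i => by
    change inner ℝ (b 2) (G (b i)) = _
    rw [← b.inner_eq_ite 2 i, ← LinearIsometryEquiv.inner_map_map G (b 2) (b i), hfix]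
  have e02 : A 0 2 = 0 := by simpa using hA2 0
  have e12 : A 1 2 = 0 := by simpa using hA2 1
  have e22 : A 2 2 = 1 := by simpa using hA2 2
  have e20 : A 2 0 = 0 := by simpa using h2A 0
  have e21 : A 2 1 = 0 := by simpa using h2A 1
  rw [Matrix.det_fin_three, e02, e12, e22, e20, e21] at hdet
  have h00 := hcol 0 0
  have h01 := hcol 0 1
  rw [Fin.sum_univ_three, e20, if_pos rfl] at h00
  rw [Fin.sum_univ_three, e20, if_neg (by decide)] at h01
  -- The first column of the block is a unit vector. Orthogonality and the determinant then
  -- determine the second column by linear algebra.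
  have e11 : A 1 1 = A 0 0 := by
    linear_combination (-A 1 1) * h00 + A 0 0 * hdet + A 1 0 * h01
  have e01 : A 0 1 = -A 1 0 := by
    linear_combination (-A 0 1) * h00 - A 1 0 * hdet + A 0 0 * h01
  have hcoord : ∀ (x : R3) (i : Fin 3), inner ℝ (b i) (G x) = ∑ j, A i j * inner ℝ (b j) x :=
    fun x i => by
      conv_lhs => rw [← b.sum_repr' x]
      rw [map_sum, inner_sum]
      refine Finset.sum_congr rfl fun j _ => ?_
      rw [map_smul, inner_smul_right, mul_comm]
      rfl
  refine ⟨b, A 0 0 + A 1 0 * Complex.I, ?_, fun x => ?_, fun x => ?_⟩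
  · rw [← sq_eq_sq₀ (norm_nonneg _) zero_le_one, Complex.sq_norm, Complex.normSq_add_mul_I]
    linear_combination h00
  · rw [axial, axial, SO3.coe_rotate, hcoord x 2, Fin.sum_univ_three, e20, e21, e22]
    simp
  · simp only [transverse, SO3.coe_rotate]
    rw [hcoord x 0, hcoord x 1, Fin.sum_univ_three, Fin.sum_univ_three, e11, e01, e02, e12]
    push_cast
    linear_combination (-(A 1 0 : ℂ) * ((inner ℝ (b 1) (x : R3) : ℝ) : ℂ)) * Complex.I_sq

theorem SO3.IsFrame.transverse_neg {g : SO3} {b : OrthonormalBasis (Fin 3) ℝ R3} {ζ : ℂ}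
    (h : g.IsFrame b ζ) (x : Sphere2) :
    transverse b (-Complex.I) (g.rotate x) = star ζ * transverse b (-Complex.I) x := by
  rw [← star_transverse, h.transverse_eq, star_mul, star_transverse, mul_comm]

theorem SO3.IsFrame.eq_one {g : SO3} {b : OrthonormalBasis (Fin 3) ℝ R3}
    (h : g.IsFrame b 1) : g = 1 := by
  refine SO3.eq_one_of_rotate fun x => Subtype.ext
    (InnerProductSpace.ext_inner_left_basis b.toBasis fun i => ?_)
  have h2 := h.axial_eq x
  have h0 := h.transverse_eq x
  have h1 := h.transverse_neg x
  rw [one_mul] at h0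
  rw [star_one, one_mul] at h1
  simp only [transverse, axial] at h0 h1 h2
  rw [OrthonormalBasis.coe_toBasis]
  apply Complex.ofReal_injective
  fin_cases i
  · change ((inner ℝ (b 0) (g.rotate x : R3) : ℝ) : ℂ) = ((inner ℝ (b 0) (x : R3) : ℝ) : ℂ)
    linear_combination (h0 + h1) / 2
  · change ((inner ℝ (b 1) (g.rotate x : R3) : ℝ) : ℂ) = ((inner ℝ (b 1) (x : R3) : ℝ) : ℂ)
    linear_combination (-Complex.I) * (h0 - h1) / 2 + (((inner ℝ (b 1) (g.rotate x : R3) : ℝ) : ℂ) -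
      ((inner ℝ (b 1) (x : R3) : ℝ) : ℂ)) * Complex.I_sq
  · exact h2

theorem SO3.isFrame_one (b : OrthonormalBasis (Fin 3) ℝ R3) : SO3.IsFrame 1 b 1 :=
  ⟨by simp, fun x => by rw [SO3.rotate_one], fun x => by rw [SO3.rotate_one, one_mul]⟩

theorem SO3.IsFrame.mul {g h : SO3} {b : OrthonormalBasis (Fin 3) ℝ R3} {ζ ξ : ℂ}
    (hg : g.IsFrame b ζ) (hh : h.IsFrame b ξ) : (g * h).IsFrame b (ζ * ξ) :=
  ⟨by rw [norm_mul, hg.norm_eq, hh.norm_eq, one_mul],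
    fun x => by rw [SO3.rotate_mul, hg.axial_eq, hh.axial_eq],
    fun x => by rw [SO3.rotate_mul, hg.transverse_eq, hh.transverse_eq, mul_assoc]⟩

theorem SO3.IsFrame.pow {g : SO3} {b : OrthonormalBasis (Fin 3) ℝ R3} {ζ : ℂ}
    (hg : g.IsFrame b ζ) (n : ℕ) : (g ^ n).IsFrame b (ζ ^ n) := by
  induction n with
  | zero => simpa using SO3.isFrame_one b
  | succ n ih => rw [pow_succ, pow_succ]; exact ih.mul hg

theorem SO3.IsFrame.factor_unique {g : SO3} {b : OrthonormalBasis (Fin 3) ℝ R3} {ζ ξ : ℂ}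
    (h : g.IsFrame b ζ) (h' : g.IsFrame b ξ) : ζ = ξ := by
  obtain ⟨x, -, hx, -⟩ := exists_sphere_point b (z := 0) (s := 1) (by norm_num)
    (ζ := 1) (by simp)
  have h2 := h.transverse_eq x
  rw [h'.transverse_eq x, hx] at h2
  simpa using h2.symm

/-- Since star ζ = ζ⁻¹, the eigenvalue ζ^(j-k) can be written as a product over the two indices. The
trace then factors as a sum times its conjugate. -/
theorem SO3.IsFrame.pullback_sphMon {g : SO3} {b : OrthonormalBasis (Fin 3) ℝ R3} {ζ : ℂ}
    (h : g.IsFrame b ζ) (j k : ℕ) :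
    g.pullback (sphMon b j k) = (ζ ^ j * star ζ ^ k) • sphMon b j k := by
  have hζ : ζ * star ζ = 1 := by
    rw [← starRingEnd_apply, Complex.mul_conj', h.norm_eq]
    simp
  funext x
  simp only [SO3.pullback_apply, sphMon, h.axial_eq, h.transverse_eq, h.transverse_neg,
    Pi.smul_apply, smul_eq_mul, mul_pow]
  have e : ζ ^ j * star ζ ^ k = ζ ^ (j - k) * star ζ ^ (k - j) := by
    rcases le_total k j with hkj | hkj
    · obtain ⟨m, rfl⟩ := Nat.exists_eq_add_of_le hkj
      have e1 : k + m - k = m := by omega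
      have e2 : k - (k + m) = 0 := by omega
      rw [e1, e2, pow_add, mul_right_comm, ← mul_pow, hζ]
      ring
    · obtain ⟨m, rfl⟩ := Nat.exists_eq_add_of_le hkj
      have e1 : j + m - j = m := by omega
      have e2 : j - (j + m) = 0 := by omega
      rw [e1, e2, pow_add, ← mul_assoc, ← mul_pow, hζ]
      ring
  rw [e]
  ring

/-! ### Traces of rotations -/

/-- The square modulus of a geometric sum: the trace of a rotation on polynomials of degree at most
`L`. -/
noncomputable def fejerSum (L : ℕ) (ζ : ℂ) : ℝ := ‖∑ j ∈ Finset.range (L + 1), ζ ^ j‖ ^ 2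

theorem fejerSum_eq (L : ℕ) (ζ : ℂ) :
    (fejerSum L ζ : ℂ) = ∑ p : Fin (L + 1) × Fin (L + 1), ζ ^ p.1.val * star ζ ^ p.2.val := by
  rw [fejerSum, Complex.ofReal_pow, ← Complex.mul_conj', map_sum, Finset.sum_range,
    Finset.sum_range, Finset.sum_mul_sum, ← Finset.sum_product', Finset.univ_product_univ]
  simp

theorem fejerSum_one (L : ℕ) : fejerSum L 1 = ((L : ℝ) + 1) ^ 2 := by
  have h : (∑ j ∈ Finset.range (L + 1), (1 : ℂ) ^ j) = ((L + 1 : ℝ) : ℂ) := by simp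
  rw [fejerSum, h, Complex.norm_real, Real.norm_eq_abs, sq_abs]

theorem fejerSum_nonneg (L : ℕ) (ζ : ℂ) : 0 ≤ fejerSum L ζ := sq_nonneg _

theorem fejerSum_le (L : ℕ) {ζ : ℂ} (hζ : ‖ζ‖ = 1) (hne : ζ ≠ 1) :
    fejerSum L ζ ≤ (2 / ‖ζ - 1‖) ^ 2 := by
  rw [fejerSum, geom_sum_eq hne, norm_div]
  have h : ‖ζ ^ (L + 1) - 1‖ ≤ 2 := by
    refine (norm_sub_le _ _).trans ?_
    rw [norm_pow, hζ]
    norm_num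
  gcongr

/-- The representation on polynomial functions of degree at most `L` of a group of rotations. -/
noncomputable def spherePolyRep {G : Type*} [Group G] (ρ : G →* SO3) (L : ℕ) :
    Representation ℂ G (spherePoly L) where
  -- Pullback reverses products, so the inverse is needed for a left action.
  toFun γ := (ρ γ⁻¹).pullback.toLinearMap.restrict fun _ hf => SO3.pullback_mem hf
  map_one' := by
    ext f x
    simp [SO3.pullback_apply, SO3.rotate_one]
  map_mul' γ δ := by
    ext f x
    simp [SO3.pullback_apply, SO3.rotate_mul]

theorem spherePolyRep_apply {G : Type*} [Group G] (ρ : G →* SO3) (L : ℕ) (γ : G)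
    (f : spherePoly L) : (spherePolyRep ρ L γ f : Sphere2 → ℂ) = (ρ γ⁻¹).pullback f := rfl

theorem spherePolyRep_character {G : Type*} [Group G] (ρ : G →* SO3) (L : ℕ) (γ : G)
    {b : OrthonormalBasis (Fin 3) ℝ R3} {ζ : ℂ} (h : (ρ γ⁻¹).IsFrame b ζ) :
    (spherePolyRep ρ L).character γ = fejerSum L ζ := by
  rw [Representation.character, LinearMap.trace_eq_matrix_trace ℂ (spherePolyBasis b L),
    Matrix.trace, fejerSum_eq]
  refine Finset.sum_congr rfl fun p _ => ?_
  have e : spherePolyRep ρ L γ (spherePolyBasis b L p) =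
      (ζ ^ p.1.val * star ζ ^ p.2.val) • spherePolyBasis b L p := by
    apply Subtype.ext
    rw [spherePolyRep_apply, spherePolyBasis_apply, h.pullback_sphMon, Submodule.coe_smul,
      spherePolyBasis_apply]
  rw [Matrix.diag_apply, LinearMap.toMatrix_apply, e, map_smul]
  simp

/-! ### Eigenspaces of the quotient -/

/-- The functions on the sphere invariant under a group of rotations. -/
def invariantFunctions {G : Type*} [Group G] (ρ : G →* SO3) : Submodule ℂ (Sphere2 → ℂ) where
  carrier := {f | ∀ (γ : G) (x : Sphere2), f ((ρ γ).rotate x) = f x}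
  zero_mem' := fun _ _ => rfl
  add_mem' := fun hf hg γ x => by simp only [Pi.add_apply, hf γ x, hg γ x]
  smul_mem' := fun c f hf γ x => by simp only [Pi.smul_apply, hf γ x]

theorem finrank_invariants {G : Type*} [Group G] (ρ : G →* SO3) (L : ℕ) :
    Module.finrank ℂ (spherePolyRep ρ L).invariants =
      Module.finrank ℂ (spherePoly L ⊓ invariantFunctions ρ : Submodule ℂ (Sphere2 → ℂ)) := by
  have h : (spherePolyRep ρ L).invariants.map (spherePoly L).subtype =
      spherePoly L ⊓ invariantFunctions ρ := by
    ext f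
    constructor
    · rintro ⟨f, hf, rfl⟩
      refine ⟨f.2, fun γ x => ?_⟩
      have h1 := congrFun (congrArg Subtype.val (hf γ⁻¹)) x
      rw [spherePolyRep_apply, inv_inv, SO3.pullback_apply] at h1
      exact h1
    · rintro ⟨hf, hinv⟩
      exact ⟨⟨f, hf⟩, fun γ => Subtype.ext (funext fun x => hinv γ⁻¹ x), rfl⟩
  rw [← h]
  exact (LinearEquiv.finrank_eq (Submodule.equivMapOfInjective _
    (spherePoly L).injective_subtype _))

theorem finrank_invariants_eq_sum {G : Type*} [Group G] [Fintype G] (ρ : G →* SO3) (L : ℕ)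
    {ζ : G → ℂ} (hζ : ∀ γ, ∃ b, (ρ γ).IsFrame b (ζ γ)) :
    (Module.finrank ℂ (spherePoly L ⊓ invariantFunctions ρ : Submodule ℂ (Sphere2 → ℂ)) : ℝ) =
      (Nat.card G : ℝ)⁻¹ * ∑ γ, fejerSum L (ζ γ) := by
  have : Invertible (Nat.card G : ℂ) :=
    invertibleOfNonzero (Nat.cast_ne_zero.mpr Nat.card_pos.ne')
  have h := (spherePolyRep ρ L).card_inv_mul_sum_char_eq_finrank
  rw [finrank_invariants, ← Equiv.sum_comp (Equiv.inv G)] at h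
  have h2 : ∀ γ, (spherePolyRep ρ L).character (Equiv.inv G γ) = fejerSum L (ζ γ) := fun γ => by
    obtain ⟨b, hb⟩ := hζ γ
    exact spherePolyRep_character ρ L _ (by simpa using hb)
  simp only [h2] at h
  apply Complex.ofReal_injective
  push_cast
  exact h.symm

/-! ### Spectrum and dimension count -/

/-- Applying Δ + L(L+1) multiplies f by the nonzero number L(L+1) - c and lowers the degree. So f
itself has lower degree, down to degree 0, where the operator is zero. -/
theorem eq_zero_of_eigenfunction {L : ℕ} {c : ℂ} (hc : ∀ l ≤ L, (l : ℂ) * (l + 1) ≠ c)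
    {f : Sphere2 → ℂ} (hf : f ∈ spherePoly L) (hfe : sphereLaplacian f = -c • f) : f = 0 := by
  induction L with
  | zero =>
    have h := (sphereLaplacian_add_mem hf).2 rfl
    rw [hfe, ← add_smul] at h
    exact (smul_eq_zero.mp h).resolve_left fun h0 => hc 0 le_rfl (by linear_combination h0)
  | succ L ih =>
    have h := (sphereLaplacian_add_mem hf).1
    rw [hfe, ← add_smul] at h
    refine ih (fun l hl => hc l (hl.trans (Nat.le_succ L))) ?_
    have h0 : -c + ((L + 1 : ℕ) : ℂ) * ((L + 1 : ℕ) + 1) ≠ 0 := fun h0 =>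
      hc (L + 1) le_rfl (by linear_combination h0)
    exact ((spherePoly L).smul_mem_iff h0).mp h

theorem mem_quotientEigenspace {G : Type*} [Group G] {ρ : G →* SO3} {ev : ℝ} {f : Sphere2 → ℂ} :
    f ∈ quotientEigenspace ρ ev ↔
      SmoothOnSphere f ∧ sphereLaplacian f = -(ev : ℂ) • f ∧ f ∈ invariantFunctions ρ := by
  have h : (∀ x, -sphereLaplacian f x = (ev : ℂ) * f x) ↔ sphereLaplacian f = -(ev : ℂ) • f := by
    rw [funext_iff]
    refine forall_congr' fun x => ?_
    rw [Pi.smul_apply, smul_eq_mul, neg_mul, neg_eq_iff_eq_neg]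
  rw [← h]
  rfl

theorem quotientEigenspace_le {G : Type*} [Group G] (ρ : G →* SO3) {L : ℕ} {ev : ℝ}
    (hev : ev < (L + 1) * (L + 2)) :
    quotientEigenspace ρ ev ≤ spherePoly L ⊓ invariantFunctions ρ := fun f hf => by
  obtain ⟨h1, h2, h3⟩ := mem_quotientEigenspace.mp hf
  exact ⟨mem_spherePoly_of_eigenfunction hev h1 h2, h3⟩

theorem exists_nat_bound (ev : ℝ) : ∃ L : ℕ, ev < ((L : ℝ) + 1) * (L + 2) := by
  obtain ⟨L, hL⟩ := exists_nat_gt ev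
  exact ⟨L, by nlinarith [(Nat.cast_nonneg L : (0 : ℝ) ≤ L)]⟩

instance quotientEigenspace_finiteDimensional {G : Type*} [Group G] (ρ : G →* SO3) (ev : ℝ) :
    FiniteDimensional ℂ (quotientEigenspace ρ ev) := by
  obtain ⟨L, hL⟩ := exists_nat_bound ev
  exact Submodule.finiteDimensional_of_le ((quotientEigenspace_le ρ hL).trans inf_le_left)

theorem exists_of_quotientEigenspace_ne_bot {G : Type*} [Group G] {ρ : G →* SO3} {ev : ℝ}
    (h : quotientEigenspace ρ ev ≠ ⊥) : ∃ l : ℕ, ev = (l : ℝ) * (l + 1) := by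
  obtain ⟨L, hL⟩ := exists_nat_bound ev
  by_contra! hne
  apply h
  rw [Submodule.eq_bot_iff]
  intro f hf
  refine eq_zero_of_eigenfunction (c := (ev : ℂ)) (fun l _ hl => hne l ?_)
    (quotientEigenspace_le ρ hL hf).1 (mem_quotientEigenspace.mp hf).2.1
  exact_mod_cast hl.symm

theorem quotientEigenspace_finite {G : Type*} [Group G] (ρ : G →* SO3) (bound : ℝ) :
    {ev : ℝ | ev ≤ bound ∧ quotientEigenspace ρ ev ≠ ⊥}.Finite := by
  obtain ⟨L, hL⟩ := exists_nat_bound bound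
  refine ((Finset.range (L + 1)).image fun l : ℕ => (l : ℝ) * (l + 1)).finite_toSet.subset ?_
  rintro ev ⟨hev, hne⟩
  obtain ⟨l, rfl⟩ := exists_of_quotientEigenspace_ne_bot hne
  simp only [Finset.coe_image, Set.mem_image, Finset.coe_range, Set.mem_Iio]
  refine ⟨l, ?_, rfl⟩
  by_contra! hl
  have hl' : (L : ℝ) + 1 ≤ l := by exact_mod_cast hl
  nlinarith [(Nat.cast_nonneg L : (0 : ℝ) ≤ L)]

theorem sphereLaplacian_mem_invariantFunctions {G : Type*} [Group G] {ρ : G →* SO3} {L : ℕ}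
    {f : Sphere2 → ℂ} (hf : f ∈ spherePoly L ⊓ invariantFunctions ρ) :
    sphereLaplacian f ∈ spherePoly L ⊓ invariantFunctions ρ := by
  refine ⟨sphereLaplacian_mem hf.1, fun γ x => ?_⟩
  have e : (fun x => f ((ρ γ).rotate x)) = f := funext (hf.2 γ)
  have hs := smooth_of_mem_spherePoly hf.1
  rw [← sphereLaplacian_rotate hs (ρ γ) (e.symm ▸ hs), e]

/-- The operator `Δ + c` on invariant polynomial functions. -/
noncomputable def shiftedLaplacian {G : Type*} [Group G] (ρ : G →* SO3) (L : ℕ) (c : ℂ) :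
    (spherePoly L ⊓ invariantFunctions ρ : Submodule ℂ (Sphere2 → ℂ)) →ₗ[ℂ]
      (spherePoly L ⊓ invariantFunctions ρ : Submodule ℂ (Sphere2 → ℂ)) where
  toFun f := ⟨sphereLaplacian f + c • (f : Sphere2 → ℂ),
    add_mem (sphereLaplacian_mem_invariantFunctions f.2) (Submodule.smul_mem _ _ f.2)⟩
  map_add' f g := by
    apply Subtype.ext
    funext x
    simp only [Submodule.coe_add, Pi.add_apply, smul_add,
      sphereLaplacian_add (smooth_of_mem_spherePoly f.2.1) (smooth_of_mem_spherePoly g.2.1)]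
    ring
  map_smul' a f := by
    apply Subtype.ext
    funext x
    simp only [Submodule.coe_smul, Pi.add_apply, Pi.smul_apply, smul_eq_mul, RingHom.id_apply,
      sphereLaplacian_smul a (smooth_of_mem_spherePoly f.2.1)]
    ring

theorem nat_mul_succ_injective : Function.Injective fun l : ℕ => (l : ℝ) * (l + 1) := by
  refine StrictMono.injective (strictMono_nat_of_lt_succ fun l => ?_)
  push_cast
  nlinarith [(Nat.cast_nonneg l : (0 : ℝ) ≤ l)]

theorem quotientEigenspace_zero {G : Type*} [Group G] (ρ : G →* SO3) :
    quotientEigenspace ρ 0 = spherePoly 0 ⊓ invariantFunctions ρ := by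
  refine le_antisymm (quotientEigenspace_le ρ (by norm_num)) fun f hf => ?_
  refine mem_quotientEigenspace.mpr ⟨smooth_of_mem_spherePoly hf.1, ?_, hf.2⟩
  simpa using (sphereLaplacian_add_mem hf.1).2 rfl

/-- With c = (L+1)(L+2), Δ + c is injective on the invariants of degree at most L, hence bijective
there. For f of degree L + 1, solving (Δ + c)g = (Δ + c)f in lower degree leaves f - g in the
eigenspace. -/
theorem sup_quotientEigenspace {G : Type*} [Group G] (ρ : G →* SO3) (L : ℕ) :
    (spherePoly L ⊓ invariantFunctions ρ) ⊔
      quotientEigenspace ρ (((L + 1 : ℕ) : ℝ) * ((L + 1 : ℕ) + 1)) =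
      spherePoly (L + 1) ⊓ invariantFunctions ρ ∧
    (spherePoly L ⊓ invariantFunctions ρ) ⊓
      quotientEigenspace ρ (((L + 1 : ℕ) : ℝ) * ((L + 1 : ℕ) + 1)) = ⊥ := by
  have hne : ∀ l ≤ L, (l : ℂ) * (l + 1) ≠ ((L + 1 : ℕ) : ℂ) * ((L + 1 : ℕ) + 1) := by
    intro l hl h
    have h' : (l : ℝ) * (l + 1) = ((L + 1 : ℕ) : ℝ) * ((L + 1 : ℕ) + 1) := by exact_mod_cast h
    have := nat_mul_succ_injective h'
    omega
  constructor
  · refine le_antisymm (sup_le (inf_le_inf_right _ (spherePoly_mono (Nat.le_succ L)))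
      (quotientEigenspace_le ρ ?_)) fun f hf => ?_
    · push_cast
      nlinarith [(Nat.cast_nonneg L : (0 : ℝ) ≤ L)]
    · set c : ℂ := ((L + 1 : ℕ) : ℂ) * ((L + 1 : ℕ) + 1) with hc
      have hinj : Function.Injective (shiftedLaplacian ρ L c) := by
        rw [← LinearMap.ker_eq_bot, LinearMap.ker_eq_bot']
        intro g hg
        have h1 : sphereLaplacian g + c • (g : Sphere2 → ℂ) = 0 := congrArg Subtype.val hg
        refine Subtype.ext (eq_zero_of_eigenfunction hne g.2.1 ?_)
        rw [neg_smul]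
        exact eq_neg_of_add_eq_zero_left h1
      have hTf : sphereLaplacian f + c • f ∈ spherePoly L ⊓ invariantFunctions ρ :=
        ⟨(sphereLaplacian_add_mem hf.1).1, (add_mem (sphereLaplacian_mem_invariantFunctions hf)
          (Submodule.smul_mem _ c hf)).2⟩
      obtain ⟨g, hg⟩ := LinearMap.surjective_of_injective hinj ⟨_, hTf⟩
      have hg' : sphereLaplacian g + c • (g : Sphere2 → ℂ) = sphereLaplacian f + c • f :=
        congrArg Subtype.val hg
      rw [← add_sub_cancel (g : Sphere2 → ℂ) f]
      refine Submodule.add_mem_sup g.2 (mem_quotientEigenspace.mpr ⟨?_, ?_, ?_⟩)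
      · exact smooth_of_mem_spherePoly (sub_mem hf.1 (spherePoly_mono (Nat.le_succ L) g.2.1))
      · have hfs := smooth_of_mem_spherePoly hf.1
        have hgs := smooth_of_mem_spherePoly g.2.1
        have e : f - (g : Sphere2 → ℂ) = f + (-1 : ℂ) • (g : Sphere2 → ℂ) := by
          rw [neg_one_smul, sub_eq_add_neg]
        funext x
        have hx := congrFun hg' x
        simp only [Pi.add_apply, Pi.smul_apply, smul_eq_mul, hc] at hx
        rw [e, sphereLaplacian_add hfs (hgs.smul _), sphereLaplacian_smul _ hgs]
        simp only [Pi.add_apply, Pi.smul_apply, smul_eq_mul]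
        push_cast at hx ⊢
        linear_combination (-1 : ℂ) * hx
      · exact sub_mem hf.2 g.2.2
  · rw [Submodule.eq_bot_iff]
    rintro f ⟨hf1, hf2⟩
    refine eq_zero_of_eigenfunction hne hf1.1 ?_
    have := (mem_quotientEigenspace.mp hf2).2.1
    push_cast at this ⊢
    exact this

instance {G : Type*} [Group G] (ρ : G →* SO3) (L : ℕ) : FiniteDimensional ℂ
    (spherePoly L ⊓ invariantFunctions ρ : Submodule ℂ (Sphere2 → ℂ)) :=
  Submodule.finiteDimensional_of_le inf_le_left

theorem sum_eigenvalueMultiplicity {G : Type*} [Group G] (ρ : G →* SO3) (L : ℕ) :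
    ∑ l ∈ Finset.range (L + 1), eigenvalueMultiplicity ρ ((l : ℝ) * (l + 1)) =
      Module.finrank ℂ (spherePoly L ⊓ invariantFunctions ρ : Submodule ℂ (Sphere2 → ℂ)) := by
  induction L with
  | zero =>
    rw [zero_add, Finset.sum_range_one, Nat.cast_zero, zero_mul, eigenvalueMultiplicity,
      quotientEigenspace_zero]
  | succ L ih =>
    obtain ⟨h1, h2⟩ := sup_quotientEigenspace ρ L
    have h := Submodule.finrank_sup_add_finrank_inf_eq (spherePoly L ⊓ invariantFunctions ρ)
      (quotientEigenspace ρ (((L + 1 : ℕ) : ℝ) * ((L + 1 : ℕ) + 1)))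
    rw [h1, h2, finrank_bot, add_zero] at h
    rw [Finset.sum_range_succ, ih, h, eigenvalueMultiplicity]

/-- Only the values l(l+1) with l ≤ L can contribute, so the sum over reals telescopes through the
filtration by degree. -/
theorem countingFunction_eq {G : Type*} [Group G] (ρ : G →* SO3) (L : ℕ) :
    countingFunction ρ ((L : ℝ) * (L + 1)) =
      Module.finrank ℂ (spherePoly L ⊓ invariantFunctions ρ : Submodule ℂ (Sphere2 → ℂ)) := by
  rw [← sum_eigenvalueMultiplicity, countingFunction,
    ← Finset.sum_image (s := Finset.range (L + 1)) (g := fun l : ℕ => (l : ℝ) * (l + 1))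
      (f := fun ev => eigenvalueMultiplicity ρ ev) nat_mul_succ_injective.injOn]
  refine finsum_mem_eq_sum_of_inter_support_eq (s := {ev : ℝ | ev ≤ (L : ℝ) * (L + 1)}) _ ?_
  ext ev
  simp only [Set.mem_inter_iff, Set.mem_ofPred_eq, Function.mem_support, Finset.coe_image,
    Set.mem_image, Finset.coe_range, Set.mem_Iio, and_congr_left_iff]
  intro hev
  have hne : quotientEigenspace ρ ev ≠ ⊥ := fun h => hev (by simp [eigenvalueMultiplicity, h])
  obtain ⟨l, rfl⟩ := exists_of_quotientEigenspace_ne_bot hne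
  have hmono : StrictMono fun l : ℕ => (l : ℝ) * (l + 1) := strictMono_nat_of_lt_succ fun l => by
    push_cast
    nlinarith [(Nat.cast_nonneg l : (0 : ℝ) ≤ l)]
  constructor
  · intro h
    exact ⟨l, Nat.lt_succ_of_le (hmono.le_iff_le.mp h), rfl⟩
  · rintro ⟨m, hm, hml⟩
    rw [← hml]
    exact hmono.monotone (Nat.le_of_lt_succ hm)

/-- The counting function of a finite group of rotations, in terms of the rotation numbers. -/
theorem countingFunction_eq_sum {G : Type*} [Group G] [Fintype G] (ρ : G →* SO3) (L : ℕ)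
    {ζ : G → ℂ} (hζ : ∀ γ, ∃ b, (ρ γ).IsFrame b (ζ γ)) :
    (countingFunction ρ ((L : ℝ) * (L + 1)) : ℝ) =
      (Nat.card G : ℝ)⁻¹ * ∑ γ, fejerSum L (ζ γ) := by
  rw [countingFunction_eq, finrank_invariants_eq_sum ρ L hζ]

/-- Weyl's law for a finite group of rotations. -/
theorem exists_weyl_bound {G : Type*} [Group G] [Finite G] {ρ : G →* SO3}
    (hρ : Function.Injective ρ) : ∃ C : ℝ, ∀ L : ℕ,
      |(countingFunction ρ ((L : ℝ) * (L + 1)) : ℝ) - ((L : ℝ) + 1) ^ 2 / Nat.card G| ≤ C := by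
  classical
  have := Fintype.ofFinite G
  choose b ζ hζ using fun γ => SO3.exists_isFrame (ρ γ)
  have hζ1 : ζ 1 = 1 := by
    have h := hζ 1
    rw [map_one] at h
    exact h.factor_unique (SO3.isFrame_one (b 1))
  -- Injectivity of ρ enters here: only the identity has a trace that grows with L.
  have hζne : ∀ γ, γ ≠ 1 → ζ γ ≠ 1 := fun γ hγ h => by
    have h1 := hζ γ
    rw [h] at h1
    exact hγ (hρ (h1.eq_one.trans (map_one ρ).symm))
  refine ⟨(Nat.card G : ℝ)⁻¹ * ∑ γ ∈ Finset.univ.erase (1 : G), (2 / ‖ζ γ - 1‖) ^ 2, fun L => ?_⟩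
  rw [countingFunction_eq_sum ρ L fun γ => ⟨b γ, hζ γ⟩,
    ← Finset.add_sum_erase _ _ (Finset.mem_univ (1 : G)), hζ1, fejerSum_one, mul_add,
    div_eq_inv_mul, add_sub_cancel_left, abs_of_nonneg
      (mul_nonneg (by positivity) (Finset.sum_nonneg fun γ _ => fejerSum_nonneg L _))]
  refine mul_le_mul_of_nonneg_left (Finset.sum_le_sum fun γ hγ => ?_) (by positivity)
  exact fejerSum_le L (hζ γ).norm_eq (hζne γ (Finset.ne_of_mem_erase hγ))

/-! ### Triangle groups -/

namespace TriangleGroup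

variable {p q r : ℕ}

/-- The first generator. -/
def α (p q r : ℕ) : TriangleGroup p q r := PresentedGroup.of 0

/-- The second generator. -/
def β (p q r : ℕ) : TriangleGroup p q r := PresentedGroup.of 1

theorem α_pow : α p q r ^ p = 1 := by
  rw [α, PresentedGroup.of, ← map_pow]
  exact PresentedGroup.one_of_mem (by simp)

theorem β_pow : β p q r ^ q = 1 := by
  rw [β, PresentedGroup.of, ← map_pow]
  exact PresentedGroup.one_of_mem (by simp)

theorem αβ_pow : (α p q r * β p q r) ^ r = 1 := by
  rw [α, β, PresentedGroup.of, PresentedGroup.of, ← map_mul, ← map_pow]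
  exact PresentedGroup.one_of_mem (by simp)

/-- The universal property of the triangle group. -/
def lift {G : Type*} [Group G] (x y : G) (hx : x ^ p = 1) (hy : y ^ q = 1) (hxy : (x * y) ^ r = 1) :
    TriangleGroup p q r →* G :=
  PresentedGroup.toGroup (f := ![x, y]) (by
    rintro _ (rfl | rfl | rfl) <;> simpa)

section lift

variable {G : Type*} [Group G] {x y : G} {hx : x ^ p = 1} {hy : y ^ q = 1} {hxy : (x * y) ^ r = 1}

@[simp]
theorem lift_α : lift x y hx hy hxy (α p q r) = x := PresentedGroup.toGroup.of _

@[simp]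
theorem lift_β : lift x y hx hy hxy (β p q r) = y := PresentedGroup.toGroup.of _

end lift

theorem closure_eq_top : Subgroup.closure {α p q r, β p q r} = ⊤ := by
  rw [← PresentedGroup.closure_range_of]
  congr 1
  ext x
  simp [α, β, Fin.exists_fin_two, eq_comm]

/-- The generators have finite order, so their inverses are positive powers, and stability under the
generators alone is enough. -/
theorem smul_mem_of_generators {X : Type*} [MulAction (TriangleGroup p q r) X] (hp : 0 < p)
    (hq : 0 < q) {S : Set X} (ha : ∀ x ∈ S, α p q r • x ∈ S) (hb : ∀ x ∈ S, β p q r • x ∈ S)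
    (γ : TriangleGroup p q r) : ∀ x ∈ S, γ • x ∈ S := by
  have hpow : ∀ {g : TriangleGroup p q r}, (∀ x ∈ S, g • x ∈ S) → ∀ n : ℕ, ∀ x ∈ S,
      g ^ n • x ∈ S := by
    intro g hg n
    induction n with
    | zero => simp
    | succ n ih => intro x hx; rw [pow_succ, mul_smul]; exact ih _ (hg x hx)
  have hinv : ∀ {g : TriangleGroup p q r} {n : ℕ}, 0 < n → g ^ n = 1 → (∀ x ∈ S, g • x ∈ S) →
      ∀ x ∈ S, g⁻¹ • x ∈ S := by
    intro g n hn hg h x hx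
    have e : g⁻¹ = g ^ (n - 1) := by
      rw [inv_eq_iff_mul_eq_one, ← pow_succ', Nat.sub_add_cancel hn, hg]
    rw [e]
    exact hpow h _ x hx
  have h : γ ∈ Subgroup.closure {α p q r, β p q r} := closure_eq_top ▸ Subgroup.mem_top γ
  induction h using Subgroup.closure_induction'' with
  | mem g hg =>
    rcases hg with rfl | rfl
    · exact ha
    · exact hb
  | inv_mem g hg =>
    rcases hg with rfl | rfl
    · exact hinv hp α_pow ha
    · exact hinv hq β_pow hb
  | one => simp
  | mul g h _ _ hg hh => intro x hx; rw [mul_smul]; exact hg _ (hh x hx)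

/-- A bound for the order from an enumeration of the cosets of the subgroup generated by `αβ`. -/
theorem card_le {k : ℕ} (hp : 0 < p) (hq : 0 < q) (hr : 0 < r)
    (h : ∀ {X : Type} (f g : X → X) (x₀ : X), (∀ x, f^[p] x = x) → (∀ x, g^[q] x = x) →
      (∀ x, (f ∘ g)^[r] x = x) → f (g x₀) = x₀ →
      ∃ s : Fin k → X, x₀ ∈ Set.range s ∧ ∀ x ∈ Set.range s, f x ∈ Set.range s ∧ g x ∈ Set.range s) :
    Finite (TriangleGroup p q r) ∧ Nat.card (TriangleGroup p q r) ≤ k * r := by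
  set H := Subgroup.zpowers (α p q r * β p q r)
  let X := TriangleGroup p q r ⧸ H
  have hiter : ∀ (g : TriangleGroup p q r) (n : ℕ) (x : X),
      (fun x : X => g • x)^[n] x = g ^ n • x := fun g n x => by
    rw [smul_iterate]
  -- The hypothesis is used for the coset space, with the coset of 1 as the point fixed by αβ. The
  -- family it returns is stable and contains that point, so it exhausts the cosets.
  obtain ⟨s, hs0, hs⟩ := h (fun x : X => α p q r • x) (fun x : X => β p q r • x)
    ((1 : TriangleGroup p q r) : X) (fun x => by rw [hiter, α_pow, one_smul])
    (fun x => by rw [hiter, β_pow, one_smul])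
    (fun x => by
      have e : ((fun x : X => α p q r • x) ∘ fun x : X => β p q r • x) =
          fun x : X => (α p q r * β p q r) • x := by
        funext x
        exact (mul_smul _ _ _).symm
      rw [e, hiter, αβ_pow, one_smul])
    (by
      rw [← mul_smul]
      change ((α p q r * β p q r * 1 : TriangleGroup p q r) : X) = _
      rw [mul_one]
      refine QuotientGroup.eq.mpr ?_
      rw [mul_one]
      exact inv_mem (Subgroup.mem_zpowers _))
  have hsurj : Function.Surjective s := fun x => by
    induction x using QuotientGroup.induction_on with
    | H γ =>
      have := smul_mem_of_generators hp hq (S := Set.range s) (fun x hx => (hs x hx).1)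
        (fun x hx => (hs x hx).2) γ _ hs0
      have e : γ • ((1 : TriangleGroup p q r) : X) = (γ : X) := by
        change ((γ * 1 : TriangleGroup p q r) : X) = _
        rw [mul_one]
      rwa [e] at this
  have hX : Finite X := Finite.of_surjective s hsurj
  have hXcard : Nat.card X ≤ k := by
    simpa using Nat.card_le_card_of_surjective s hsurj
  have hHcard : Nat.card H ≤ r := by
    rw [Nat.card_zpowers]
    exact orderOf_le_of_pow_eq_one hr αβ_pow
  have hH : Finite H :=
    (isOfFinOrder_iff_pow_eq_one.mpr ⟨r, hr, αβ_pow⟩).finite_zpowers.to_subtype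
  have e := Subgroup.groupEquivQuotientProdSubgroup (s := H)
  refine ⟨Finite.of_equiv _ e.symm, ?_⟩
  rw [Nat.card_congr e, Nat.card_prod]
  exact Nat.mul_le_mul hXcard hHcard

/-! ### Coset enumerations -/

theorem card_le_dihedral {n : ℕ} (hn : 2 ≤ n) :
    Finite (TriangleGroup 2 2 n) ∧ Nat.card (TriangleGroup 2 2 n) ≤ 2 * n := by
  refine card_le (by norm_num) (by norm_num) (by omega) fun f g x₀ hf hg _ h₀ => ?_
  simp only [Function.iterate_succ, Function.iterate_zero, Function.comp_apply, id] at hf hg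
  have h1 : g x₀ = f x₀ := by rw [← hf (g x₀), h₀]
  have h2 : g (f x₀) = x₀ := by rw [← h1, hg]
  refine ⟨![x₀, f x₀], ⟨0, rfl⟩, ?_⟩
  rintro _ ⟨i, rfl⟩
  fin_cases i
  · exact ⟨⟨1, rfl⟩, ⟨1, h1.symm⟩⟩
  · exact ⟨⟨0, (hf x₀).symm⟩, ⟨0, h2.symm⟩⟩

/-- Todd-Coxeter by hand: points are named as images of earlier ones, and a cycle of the relation
through a known point closes the table. The 4, 6 and 12 cosets in the polyhedral cases match the
vertices of the tetrahedron, octahedron and icosahedron. -/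
theorem card_le_tetrahedral :
    Finite (TriangleGroup 2 3 3) ∧ Nat.card (TriangleGroup 2 3 3) ≤ 12 := by
  refine card_le (k := 4) (by norm_num) (by norm_num) (by norm_num) fun f g x₀ hf hg h h₀ => ?_
  simp only [Function.iterate_succ, Function.iterate_zero, Function.comp_apply, id] at hf hg h
  obtain ⟨x₁, h1⟩ : ∃ x, x = f x₀ := ⟨_, rfl⟩
  obtain ⟨x₂, h2⟩ : ∃ x, x = g x₁ := ⟨_, rfl⟩
  obtain ⟨x₃, h3⟩ : ∃ x, x = f x₂ := ⟨_, rfl⟩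
  have g0 : g x₀ = x₁ := by rw [h1, ← hf (g x₀), h₀]
  have g2 : g x₂ = x₀ := by rw [h2, ← g0, hg]
  have f1 : f x₁ = x₀ := by rw [h1, hf]
  have f3 : f x₃ = x₂ := by rw [h3, hf]
  have g3 : g x₃ = x₃ := by
    have := h x₂
    rw [g2, ← h1, ← h2, ← h3] at this
    rw [← hf (g x₃), this, h3]
  refine ⟨![x₀, x₁, x₂, x₃], ⟨0, rfl⟩, ?_⟩
  rintro _ ⟨i, rfl⟩
  fin_cases i
  · exact ⟨⟨1, h1⟩, ⟨1, g0.symm⟩⟩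
  · exact ⟨⟨0, f1.symm⟩, ⟨2, h2⟩⟩
  · exact ⟨⟨3, h3⟩, ⟨0, g2.symm⟩⟩
  · exact ⟨⟨2, f3.symm⟩, ⟨3, g3.symm⟩⟩

theorem card_le_octahedral :
    Finite (TriangleGroup 2 3 4) ∧ Nat.card (TriangleGroup 2 3 4) ≤ 24 := by
  refine card_le (k := 6) (by norm_num) (by norm_num) (by norm_num) fun f g x₀ hf hg h h₀ => ?_
  simp only [Function.iterate_succ, Function.iterate_zero, Function.comp_apply, id] at hf hg h
  obtain ⟨x₁, h1⟩ : ∃ x, x = f x₀ := ⟨_, rfl⟩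
  obtain ⟨x₂, h2⟩ : ∃ x, x = g x₁ := ⟨_, rfl⟩
  obtain ⟨x₃, h3⟩ : ∃ x, x = f x₂ := ⟨_, rfl⟩
  obtain ⟨x₄, h4⟩ : ∃ x, x = g x₃ := ⟨_, rfl⟩
  obtain ⟨x₅, h5⟩ : ∃ x, x = f x₄ := ⟨_, rfl⟩
  have g0 : g x₀ = x₁ := by rw [h1, ← hf (g x₀), h₀]
  have g2 : g x₂ = x₀ := by rw [h2, ← g0, hg]
  have f1 : f x₁ = x₀ := by rw [h1, hf]
  have f3 : f x₃ = x₂ := by rw [h3, hf]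
  have f5 : f x₅ = x₄ := by rw [h5, hf]
  have g5 : g x₅ = x₃ := by
    have := h x₂
    rw [g2, ← h1, ← h2, ← h3, ← h4, ← h5] at this
    rw [← hf (g x₅), this, h3]
  have g4 : g x₄ = x₅ := by rw [h4, ← g5, hg]
  refine ⟨![x₀, x₁, x₂, x₃, x₄, x₅], ⟨0, rfl⟩, ?_⟩
  rintro _ ⟨i, rfl⟩
  fin_cases i
  · exact ⟨⟨1, h1⟩, ⟨1, g0.symm⟩⟩
  · exact ⟨⟨0, f1.symm⟩, ⟨2, h2⟩⟩
  · exact ⟨⟨3, h3⟩, ⟨0, g2.symm⟩⟩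
  · exact ⟨⟨2, f3.symm⟩, ⟨4, h4⟩⟩
  · exact ⟨⟨5, h5⟩, ⟨5, g4.symm⟩⟩
  · exact ⟨⟨4, f5.symm⟩, ⟨3, g5.symm⟩⟩

theorem card_le_icosahedral :
    Finite (TriangleGroup 2 3 5) ∧ Nat.card (TriangleGroup 2 3 5) ≤ 60 := by
  refine card_le (k := 12) (by norm_num) (by norm_num) (by norm_num) fun f g x₀ hf hg h h₀ => ?_
  simp only [Function.iterate_succ, Function.iterate_zero, Function.comp_apply, id] at hf hg h
  obtain ⟨x₁, h1⟩ : ∃ x, x = f x₀ := ⟨_, rfl⟩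
  obtain ⟨x₂, h2⟩ : ∃ x, x = g x₁ := ⟨_, rfl⟩
  obtain ⟨x₃, h3⟩ : ∃ x, x = f x₂ := ⟨_, rfl⟩
  obtain ⟨x₄, h4⟩ : ∃ x, x = g x₃ := ⟨_, rfl⟩
  obtain ⟨x₅, h5⟩ : ∃ x, x = f x₄ := ⟨_, rfl⟩
  obtain ⟨x₆, h6⟩ : ∃ x, x = g x₅ := ⟨_, rfl⟩
  obtain ⟨x₇, h7⟩ : ∃ x, x = f x₆ := ⟨_, rfl⟩
  obtain ⟨x₈, h8⟩ : ∃ x, x = g x₆ := ⟨_, rfl⟩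
  obtain ⟨x₉, h9⟩ : ∃ x, x = f x₈ := ⟨_, rfl⟩
  obtain ⟨y₀, k0⟩ : ∃ x, x = g x₉ := ⟨_, rfl⟩
  obtain ⟨y₁, k1⟩ : ∃ x, x = f y₀ := ⟨_, rfl⟩
  have g0 : g x₀ = x₁ := by rw [h1, ← hf (g x₀), h₀]
  have g2 : g x₂ = x₀ := by rw [h2, ← g0, hg]
  have f1 : f x₁ = x₀ := by rw [h1, hf]
  have f3 : f x₃ = x₂ := by rw [h3, hf]
  have f5 : f x₅ = x₄ := by rw [h5, hf]
  have f7 : f x₇ = x₆ := by rw [h7, hf]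
  have f9 : f x₉ = x₈ := by rw [h9, hf]
  have e1 : f y₁ = y₀ := by rw [k1, hf]
  have g7 : g x₇ = x₃ := by
    have := h x₂
    rw [g2, ← h1, ← h2, ← h3, ← h4, ← h5, ← h6, ← h7] at this
    rw [← hf (g x₇), this, h3]
  have g4 : g x₄ = x₇ := by rw [h4, ← g7, hg]
  have g8 : g x₈ = x₅ := by rw [h8, h6, hg]
  -- The relation read from x₂ closed the table only up to x₇. Reading it a second time, from x₄,
  -- identifies the last unknown image.
  have k2 : g y₁ = x₉ := by
    have := h x₄
    rw [g4, f7, ← h8, ← h9, ← k0, ← k1] at this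
    have h' : g (f (g y₁)) = x₅ := by rw [← hf (g (f (g y₁))), this, h5]
    have h'' : f (g y₁) = x₈ := by rw [← hg (f (g y₁)), h', ← h6, ← h8]
    rw [← hf (g y₁), h'', h9]
  have k3 : g y₀ = y₁ := by rw [k0, ← k2, hg]
  refine ⟨![x₀, x₁, x₂, x₃, x₄, x₅, x₆, x₇, x₈, x₉, y₀, y₁], ⟨0, rfl⟩, ?_⟩
  rintro _ ⟨i, rfl⟩
  fin_cases i
  · exact ⟨⟨1, h1⟩, ⟨1, g0.symm⟩⟩
  · exact ⟨⟨0, f1.symm⟩, ⟨2, h2⟩⟩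
  · exact ⟨⟨3, h3⟩, ⟨0, g2.symm⟩⟩
  · exact ⟨⟨2, f3.symm⟩, ⟨4, h4⟩⟩
  · exact ⟨⟨5, h5⟩, ⟨7, g4.symm⟩⟩
  · exact ⟨⟨4, f5.symm⟩, ⟨6, h6⟩⟩
  · exact ⟨⟨7, h7⟩, ⟨8, h8⟩⟩
  · exact ⟨⟨6, f7.symm⟩, ⟨3, g7.symm⟩⟩
  · exact ⟨⟨9, h9⟩, ⟨5, g8.symm⟩⟩
  · exact ⟨⟨8, f9.symm⟩, ⟨10, k0⟩⟩
  · exact ⟨⟨11, k1⟩, ⟨11, k3.symm⟩⟩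
  · exact ⟨⟨10, e1.symm⟩, ⟨9, k2.symm⟩⟩

end TriangleGroup

/-! ### Faithful permutation representations and embeddings in the rotation group -/

/-- An injective family of at least m elements in a group of order at most m lists the whole group,
so a homomorphism separating the family is injective. -/
theorem card_eq_and_injective {G H ι : Type*} [Group G] [Group H] [Finite G] [Finite ι] {m : ℕ}
    (hm : Nat.card G ≤ m) (f : G →* H) (w : ι → G) (hw : Function.Injective (f ∘ w))
    (hι : m ≤ Nat.card ι) :
    Nat.card G = m ∧ Function.Injective f ∧ Function.Surjective w := by
  have hinj := hw.of_comp
  have h1 := Nat.card_le_card_of_injective w hinj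
  have hsurj : Function.Surjective w :=
    ((Nat.bijective_iff_injective_and_card w).mpr ⟨hinj, by omega⟩).2
  refine ⟨by omega, fun x y hxy => ?_, hsurj⟩
  obtain ⟨i, rfl⟩ := hsurj x
  obtain ⟨j, rfl⟩ := hsurj y
  rw [hw hxy]

/-- Words in two letters, enumerating coset representatives in polyhedral triangle groups. -/
def cosetWord {G : Type*} [Group G] (a b : G) : Fin 12 → G :=
  -- The words follow the icosahedral coset table; their first 4 and 6 entries follow the
  -- tetrahedral and octahedral ones.
  ![1, a, b * a, a * b * a, b * a * b * a, a * b * a * b * a, b * a * b * a * b * a,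
    a * b * a * b * a * b * a, b * b * a * b * a * b * a, a * b * b * a * b * a * b * a,
    b * a * b * b * a * b * a * b * a, a * b * a * b * b * a * b * a * b * a]

theorem map_cosetWord {G H : Type*} [Group G] [Group H] (f : G →* H) (a b : G) (i : Fin 12) :
    f (cosetWord a b i) = cosetWord (f a) (f b) i := by
  fin_cases i <;> simp [cosetWord]

/-- Words enumerating the elements of polyhedral triangle groups. -/
def elementWord {G : Type*} [Group G] (a b : G) {k r : ℕ} (hk : k ≤ 12) (p : Fin k × Fin r) : G :=
  cosetWord a b (Fin.castLE hk p.1) * (a * b) ^ p.2.val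

theorem map_elementWord {G H : Type*} [Group G] [Group H] (f : G →* H) (a b : G) {k r : ℕ}
    (hk : k ≤ 12) (p : Fin k × Fin r) :
    f (elementWord a b hk p) = elementWord (f a) (f b) hk p := by
  simp [elementWord, map_cosetWord]

namespace TriangleGroup

/-- A triangle group for which an enumeration of its elements by words is distinguished by a
permutation representation has the expected order, and embeds wherever the images of `α`, `β`,
`αβ` and `(αβ)²` are nontrivial. -/
theorem card_eq_and_injective_of_perm {p q r k m d : ℕ} (hk : k ≤ 12)
    (hfin : Finite (TriangleGroup p q r)) (hcard : Nat.card (TriangleGroup p q r) ≤ m)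
    (hm : m = k * r) {a b : Equiv.Perm (Fin d)} (ha : a ^ p = 1) (hb : b ^ q = 1)
    (hab : (a * b) ^ r = 1)
    (hinj : Function.Injective fun s : Fin k × Fin r => elementWord a b hk s)
    (hconj : ∀ s : Fin k × Fin r, elementWord a b hk s = 1 ∨ ∃ t : Fin k × Fin r,
      ∃ n : Fin 3, ∃ u : Fin 4,
        elementWord a b hk t * elementWord a b hk s ^ n.val =
          (![a, b, a * b, (a * b) ^ 2] : Fin 4 → Equiv.Perm (Fin d)) u * elementWord a b hk t) :
    Nat.card (TriangleGroup p q r) = m ∧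
      ∀ {H : Type} [Group H] (f : TriangleGroup p q r →* H), f (α p q r) ≠ 1 → f (β p q r) ≠ 1 →
        f (α p q r * β p q r) ≠ 1 → f ((α p q r * β p q r) ^ 2) ≠ 1 → Function.Injective f := by
  let φ : TriangleGroup p q r →* Equiv.Perm (Fin d) := lift a b ha hb hab
  let w : Fin k × Fin r → TriangleGroup p q r := elementWord (α p q r) (β p q r) hk
  have hw : ∀ s, φ (w s) = elementWord a b hk s := fun s => by
    simp only [w, φ, map_elementWord, lift_α, lift_β]
  obtain ⟨h1, hφ, hsurj⟩ := card_eq_and_injective hcard φ w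
    (by simpa only [Function.comp_def, hw] using hinj) (by simp [hm])
  refine ⟨h1, fun {H} _ f fa fb fab fab2 => ?_⟩
  rw [injective_iff_map_eq_one]
  intro γ hγ
  obtain ⟨s, rfl⟩ := hsurj γ
  rcases hconj s with h | ⟨t, n, u, h⟩
  · exact hφ (by rw [hw, h, map_one])
  · exfalso
    let v : Fin 4 → TriangleGroup p q r :=
      ![α p q r, β p q r, α p q r * β p q r, (α p q r * β p q r) ^ 2]
    have hv : φ (v u) = (![a, b, a * b, (a * b) ^ 2] : Fin 4 → Equiv.Perm (Fin d)) u := by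
      fin_cases u <;> simp [v, φ]
    rw [← hv, ← hw, ← hw, ← map_pow, ← map_mul, ← map_mul] at h
    have h2 := congrArg f (hφ h)
    -- If γ is in the kernel of f, the conjugacy relation carried over from the permutations forces
    -- one of the four listed elements into the kernel. The square of αβ is needed for octahedral
    -- double transpositions, which have no other nontrivial power.
    rw [map_mul, map_mul, map_pow, hγ, one_pow, mul_one, eq_comm, mul_eq_right] at h2
    fin_cases u
    · exact fa h2
    · exact fb h2
    · exact fab h2
    · exact fab2 h2

-- The permutation models are A₄ here, S₄ for the octahedral group and A₅ for the icosahedral group.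
-- Separation of words and the conjugacy condition are finite checks.
open Equiv in
theorem tetrahedral_card_and_injective : Nat.card (TriangleGroup 2 3 3) = 12 ∧
    ∀ {H : Type} [Group H] (f : TriangleGroup 2 3 3 →* H), f (α 2 3 3) ≠ 1 → f (β 2 3 3) ≠ 1 →
      f (α 2 3 3 * β 2 3 3) ≠ 1 → f ((α 2 3 3 * β 2 3 3) ^ 2) ≠ 1 → Function.Injective f :=
  card_eq_and_injective_of_perm (k := 4) (d := 4) (a := swap 0 1 * swap 2 3)
    (b := swap 0 1 * swap 1 2) (by norm_num) card_le_tetrahedral.1 card_le_tetrahedral.2 rfl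
    (by decide +kernel) (by decide +kernel) (by decide +kernel) (by decide +kernel)
    (by decide +kernel)

open Equiv in
theorem octahedral_card_and_injective : Nat.card (TriangleGroup 2 3 4) = 24 ∧
    ∀ {H : Type} [Group H] (f : TriangleGroup 2 3 4 →* H), f (α 2 3 4) ≠ 1 → f (β 2 3 4) ≠ 1 →
      f (α 2 3 4 * β 2 3 4) ≠ 1 → f ((α 2 3 4 * β 2 3 4) ^ 2) ≠ 1 → Function.Injective f :=
  card_eq_and_injective_of_perm (k := 6) (d := 4) (a := swap 0 1)
    (b := swap 1 2 * swap 2 3) (by norm_num) card_le_octahedral.1 card_le_octahedral.2 rfl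
    (by decide +kernel) (by decide +kernel) (by decide +kernel) (by decide +kernel)
    (by decide +kernel)

open Equiv in
theorem icosahedral_card_and_injective : Nat.card (TriangleGroup 2 3 5) = 60 ∧
    ∀ {H : Type} [Group H] (f : TriangleGroup 2 3 5 →* H), f (α 2 3 5) ≠ 1 → f (β 2 3 5) ≠ 1 →
      f (α 2 3 5 * β 2 3 5) ≠ 1 → f ((α 2 3 5 * β 2 3 5) ^ 2) ≠ 1 → Function.Injective f :=
  card_eq_and_injective_of_perm (k := 12) (d := 5) (a := swap 0 1 * swap 2 3)
    (b := swap 0 2 * swap 2 4) (by norm_num) card_le_icosahedral.1 card_le_icosahedral.2 rfl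
    (by decide +kernel) (by decide +kernel) (by decide +kernel) (by decide +kernel)
    (by decide +kernel)

end TriangleGroup

/-! ### Explicit polyhedral rotations -/

/-- A rotation given by an orthogonal matrix of determinant one. -/
def SO3.ofMatrix (M : Matrix (Fin 3) (Fin 3) ℝ) (h : M * M.transpose = 1) (hdet : M.det = 1) : SO3 :=
  ⟨M, Matrix.mem_specialOrthogonalGroup_iff.mpr ⟨(Matrix.mem_orthogonalGroup_iff (Fin 3) ℝ).mpr
    (by simpa [Matrix.star_eq_conjTranspose] using h), hdet⟩⟩

/-- The cyclic permutation of the coordinate axes. -/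
def SO3.cyclic : SO3 := SO3.ofMatrix !![0, 0, 1; 1, 0, 0; 0, 1, 0]
  (by ext i j; fin_cases i <;> fin_cases j <;> simp [Matrix.mul_apply, Fin.sum_univ_three])
  (by simp [Matrix.det_fin_three])

/-- The half turn about the first axis. -/
def SO3.halfTurn : SO3 := SO3.ofMatrix !![1, 0, 0; 0, -1, 0; 0, 0, -1]
  (by ext i j; fin_cases i <;> fin_cases j <;> simp [Matrix.mul_apply, Fin.sum_univ_three])
  (by simp [Matrix.det_fin_three])

/-- The half turn exchanging the first two axes. -/
def SO3.diagonalHalfTurn : SO3 := SO3.ofMatrix !![0, 1, 0; 1, 0, 0; 0, 0, -1]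
  (by ext i j; fin_cases i <;> fin_cases j <;> simp [Matrix.mul_apply, Fin.sum_univ_three])
  (by simp [Matrix.det_fin_three])

theorem SO3.ext_matrix {g h : SO3}
    (H : (g : Matrix (Fin 3) (Fin 3) ℝ) = (h : Matrix (Fin 3) (Fin 3) ℝ)) : g = h := Subtype.ext H

theorem SO3.ne_one_of_apply {g : SO3} (i : Fin 3)
    (h : (g : Matrix (Fin 3) (Fin 3) ℝ) i i ≠ 1) : g ≠ 1 := fun hg => h (by simp [hg])

theorem SO3.cyclic_pow : SO3.cyclic ^ 3 = 1 := by
  apply SO3.ext_matrix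
  simp [SO3.cyclic, SO3.ofMatrix, pow_succ, Matrix.one_fin_three]

theorem SO3.cyclic_ne_one : SO3.cyclic ≠ 1 :=
  SO3.ne_one_of_apply 0 (by simp [SO3.cyclic, SO3.ofMatrix])

theorem exists_embedding_tetrahedral :
    ∃ ρ : TriangleGroup 2 3 3 →* SO3, Function.Injective ρ := by
  have h1 : SO3.halfTurn ^ 2 = 1 := by
    apply SO3.ext_matrix
    simp [SO3.halfTurn, SO3.ofMatrix, pow_succ, Matrix.one_fin_three]
  have h2 : (SO3.halfTurn * SO3.cyclic) ^ 3 = 1 := by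
    apply SO3.ext_matrix
    simp [SO3.halfTurn, SO3.cyclic, SO3.ofMatrix, pow_succ, Matrix.one_fin_three]
  refine ⟨TriangleGroup.lift _ _ h1 SO3.cyclic_pow h2,
    TriangleGroup.tetrahedral_card_and_injective.2 _ ?_ ?_ ?_ ?_⟩
  · rw [TriangleGroup.lift_α]
    refine SO3.ne_one_of_apply 1 ?_
    simp [SO3.halfTurn, SO3.ofMatrix]
    norm_num
  · rw [TriangleGroup.lift_β]
    exact SO3.cyclic_ne_one
  · rw [map_mul, TriangleGroup.lift_α, TriangleGroup.lift_β]
    refine SO3.ne_one_of_apply 0 ?_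
    simp [SO3.halfTurn, SO3.cyclic, SO3.ofMatrix]
  · rw [map_pow, map_mul, TriangleGroup.lift_α, TriangleGroup.lift_β]
    refine SO3.ne_one_of_apply 0 ?_
    simp [SO3.halfTurn, SO3.cyclic, SO3.ofMatrix, pow_succ]

theorem exists_embedding_octahedral :
    ∃ ρ : TriangleGroup 2 3 4 →* SO3, Function.Injective ρ := by
  have h1 : SO3.diagonalHalfTurn ^ 2 = 1 := by
    apply SO3.ext_matrix
    simp [SO3.diagonalHalfTurn, SO3.ofMatrix, pow_succ, Matrix.one_fin_three]
  have h2 : (SO3.diagonalHalfTurn * SO3.cyclic) ^ 4 = 1 := by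
    apply SO3.ext_matrix
    simp [SO3.diagonalHalfTurn, SO3.cyclic, SO3.ofMatrix, pow_succ, Matrix.one_fin_three]
  refine ⟨TriangleGroup.lift _ _ h1 SO3.cyclic_pow h2,
    TriangleGroup.octahedral_card_and_injective.2 _ ?_ ?_ ?_ ?_⟩
  · rw [TriangleGroup.lift_α]
    refine SO3.ne_one_of_apply 0 ?_
    simp [SO3.diagonalHalfTurn, SO3.ofMatrix]
  · rw [TriangleGroup.lift_β]
    exact SO3.cyclic_ne_one
  · rw [map_mul, TriangleGroup.lift_α, TriangleGroup.lift_β]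
    refine SO3.ne_one_of_apply 1 ?_
    simp [SO3.diagonalHalfTurn, SO3.cyclic, SO3.ofMatrix]
  · rw [map_pow, map_mul, TriangleGroup.lift_α, TriangleGroup.lift_β]
    refine SO3.ne_one_of_apply 1 ?_
    simp [SO3.diagonalHalfTurn, SO3.cyclic, SO3.ofMatrix, pow_succ]
    norm_num

/-- A half turn about a two-fold axis of a regular icosahedron. -/
noncomputable def icosahedralMatrix (φ : ℝ) : Matrix (Fin 3) (Fin 3) ℝ :=
  !![-1 / 2, φ / 2, (φ - 1) / 2; φ / 2, (φ - 1) / 2, 1 / 2; (φ - 1) / 2, 1 / 2, -φ / 2]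

/-- A rotation of order five of a regular icosahedron. -/
noncomputable def pentagonalMatrix (φ : ℝ) : Matrix (Fin 3) (Fin 3) ℝ :=
  !![φ / 2, (φ - 1) / 2, -1 / 2; (φ - 1) / 2, 1 / 2, φ / 2; 1 / 2, -φ / 2, (φ - 1) / 2]

/-- The square of `pentagonalMatrix φ`, for `φ² = φ + 1`. -/
noncomputable def pentagonalMatrixSq (φ : ℝ) : Matrix (Fin 3) (Fin 3) ℝ :=
  !![1 / 2, φ / 2, (1 - φ) / 2; φ / 2, (1 - φ) / 2, 1 / 2; (φ - 1) / 2, -1 / 2, -φ / 2]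

theorem pentagonalMatrix_mul_self {φ : ℝ} (hφ : φ ^ 2 = φ + 1) :
    pentagonalMatrix φ * pentagonalMatrix φ = pentagonalMatrixSq φ := by
  ext i j
  fin_cases i <;> fin_cases j <;>
    simp [pentagonalMatrix, pentagonalMatrixSq, Matrix.mul_apply, Fin.sum_univ_three] <;> grind

theorem pentagonalMatrixSq_mul_self {φ : ℝ} (hφ : φ ^ 2 = φ + 1) :
    pentagonalMatrixSq φ * pentagonalMatrixSq φ = (pentagonalMatrix φ).transpose := by
  ext i j
  fin_cases i <;> fin_cases j <;>
    simp [pentagonalMatrix, pentagonalMatrixSq, Matrix.mul_apply, Fin.sum_univ_three] <;> grind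

theorem pentagonalMatrix_transpose_mul {φ : ℝ} (hφ : φ ^ 2 = φ + 1) :
    (pentagonalMatrix φ).transpose * pentagonalMatrix φ = 1 := by
  ext i j
  fin_cases i <;> fin_cases j <;>
    simp [pentagonalMatrix, Matrix.mul_apply, Fin.sum_univ_three] <;> grind

theorem exists_embedding_icosahedral :
    ∃ ρ : TriangleGroup 2 3 5 →* SO3, Function.Injective ρ := by
  obtain ⟨φ, hφ⟩ : ∃ φ : ℝ, φ ^ 2 = φ + 1 := ⟨Real.goldenRatio, Real.goldenRatio_sq⟩
  have hsq : icosahedralMatrix φ * icosahedralMatrix φ = 1 := by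
    ext i j
    fin_cases i <;> fin_cases j <;>
      simp [icosahedralMatrix, Matrix.mul_apply, Fin.sum_univ_three] <;> grind
  have htr : (icosahedralMatrix φ).transpose = icosahedralMatrix φ := by
    ext i j
    fin_cases i <;> fin_cases j <;> simp [icosahedralMatrix]
  let g : SO3 := SO3.ofMatrix (icosahedralMatrix φ) (by rw [htr, hsq]) (by
    simp [icosahedralMatrix, Matrix.det_fin_three]
    grind)
  have h1 : g ^ 2 = 1 := SO3.ext_matrix (by rw [pow_two]; exact hsq)
  have hM : ((g * SO3.cyclic : SO3) : Matrix (Fin 3) (Fin 3) ℝ) =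
      pentagonalMatrix φ := by
    ext i j
    fin_cases i <;> fin_cases j <;>
      simp [g, icosahedralMatrix, pentagonalMatrix, SO3.cyclic, SO3.ofMatrix]
  have hM2 : (((g * SO3.cyclic) ^ 2 : SO3) : Matrix (Fin 3) (Fin 3) ℝ) =
      pentagonalMatrixSq φ := by
    rw [pow_two, Submonoid.coe_mul, hM, pentagonalMatrix_mul_self hφ]
  -- Squaring the order-five matrix twice gives its transpose, which is its inverse.
  have h2 : (g * SO3.cyclic) ^ 5 = 1 := by
    apply SO3.ext_matrix
    rw [show 5 = 2 + 2 + 1 from rfl, pow_add, pow_add, pow_one, Submonoid.coe_mul,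
      Submonoid.coe_mul, hM2, hM,
      pentagonalMatrixSq_mul_self hφ, pentagonalMatrix_transpose_mul hφ]
    rfl
  refine ⟨TriangleGroup.lift _ _ h1 SO3.cyclic_pow h2,
    TriangleGroup.icosahedral_card_and_injective.2 _ ?_ ?_ ?_ ?_⟩
  · rw [TriangleGroup.lift_α]
    refine SO3.ne_one_of_apply 0 ?_
    simp [g, SO3.ofMatrix, icosahedralMatrix]
    norm_num
  · rw [TriangleGroup.lift_β]
    exact SO3.cyclic_ne_one
  · rw [map_mul, TriangleGroup.lift_α, TriangleGroup.lift_β]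
    refine SO3.ne_one_of_apply 1 ?_
    rw [hM]
    norm_num [pentagonalMatrix]
  · rw [map_pow, map_mul, TriangleGroup.lift_α, TriangleGroup.lift_β]
    refine SO3.ne_one_of_apply 0 ?_
    rw [hM2]
    norm_num [pentagonalMatrixSq]

/-! ### Dihedral groups -/

theorem SO3.IsFrame.pow_eq_one_iff {g : SO3} {b : OrthonormalBasis (Fin 3) ℝ R3} {ζ : ℂ}
    (h : g.IsFrame b ζ) (k : ℕ) : ζ ^ k = 1 ↔ g ^ k = 1 := by
  refine ⟨fun hk => ?_, fun hk => ?_⟩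
  · have h1 := h.pow k
    rw [hk] at h1
    exact h1.eq_one
  · have h1 := h.pow k
    rw [hk] at h1
    exact h1.factor_unique (SO3.isFrame_one b)

namespace TriangleGroup

/-- The map from `Γ(2,2,n)` to the dihedral group. -/
def toDihedral (n : ℕ) : TriangleGroup 2 2 n →* DihedralGroup n :=
  lift (DihedralGroup.sr 0) (DihedralGroup.sr 1) (by simp [pow_two]) (by simp [pow_two]) (by simp)

/-- The elements of `Γ(2,2,n)`. -/
def dihedralWord (n : ℕ) : Fin n ⊕ Fin n → TriangleGroup 2 2 n :=
  Sum.elim (fun k => (α 2 2 n * β 2 2 n) ^ k.val) fun k => α 2 2 n * (α 2 2 n * β 2 2 n) ^ k.val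

theorem toDihedral_word_injective (n : ℕ) :
    Function.Injective (toDihedral n ∘ dihedralWord n) := by
  have hα : toDihedral n (α 2 2 n) = DihedralGroup.sr 0 := lift_α
  have hβ : toDihedral n (β 2 2 n) = DihedralGroup.sr 1 := lift_β
  have hk : ∀ k l : Fin n, ((k.val : ℕ) : ZMod n) = (l.val : ℕ) → k = l := fun k l h => by
    rw [ZMod.natCast_eq_natCast_iff', Nat.mod_eq_of_lt k.2, Nat.mod_eq_of_lt l.2] at h
    exact Fin.ext h
  rintro (k | k) (l | l) h
  · simp [dihedralWord, hα, hβ] at h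
    rw [hk k l h]
  · simp [dihedralWord, hα, hβ] at h
  · simp [dihedralWord, hα, hβ] at h
  · simp [dihedralWord, hα, hβ] at h
    rw [hk k l h]

theorem dihedral_card {n : ℕ} (hn : 2 ≤ n) : Nat.card (TriangleGroup 2 2 n) = 2 * n := by
  have := (card_le_dihedral hn).1
  exact (card_eq_and_injective (card_le_dihedral hn).2 (toDihedral n) (dihedralWord n)
    (toDihedral_word_injective n) (by simp [two_mul])).1

theorem dihedralWord_bijective {n : ℕ} (hn : 2 ≤ n) : Function.Bijective (dihedralWord n) := by
  have := (card_le_dihedral hn).1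
  exact ⟨(toDihedral_word_injective n).of_comp,
    (card_eq_and_injective (card_le_dihedral hn).2 (toDihedral n) (dihedralWord n)
    (toDihedral_word_injective n) (by simp [two_mul])).2.2⟩

theorem αβ_pow_eq_one_iff {n : ℕ} (k : ℕ) : (α 2 2 n * β 2 2 n) ^ k = 1 ↔ n ∣ k := by
  refine ⟨fun h => ?_, fun ⟨m, hm⟩ => by rw [hm, pow_mul, αβ_pow, one_pow]⟩
  have h1 := congrArg (toDihedral n) h
  have hα : toDihedral n (α 2 2 n) = DihedralGroup.sr 0 := lift_α
  have hβ : toDihedral n (β 2 2 n) = DihedralGroup.sr 1 := lift_β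
  rw [map_pow, map_mul, hα, hβ, map_one, DihedralGroup.sr_mul_sr, DihedralGroup.r_pow,
    DihedralGroup.one_def, DihedralGroup.r.injEq, sub_zero, one_mul] at h1
  exact (ZMod.natCast_eq_zero_iff k n).mp h1

/-- Conjugation by the involution α inverts αβ, because α and β are both involutions. -/
theorem reflection_pow_two {n : ℕ} (k : ℕ) : (α 2 2 n * (α 2 2 n * β 2 2 n) ^ k) ^ 2 = 1 := by
  have ha : α 2 2 n * α 2 2 n = 1 := by rw [← pow_two]; exact α_pow
  have hb : β 2 2 n * β 2 2 n = 1 := by rw [← pow_two]; exact β_pow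
  set a := α 2 2 n
  set b := β 2 2 n
  have h1 : a * (a * b) * a⁻¹ = (a * b)⁻¹ := by
    rw [← mul_assoc, ha, one_mul, mul_inv_rev, ← eq_inv_of_mul_eq_one_left hb]
  have h2 : a * (a * b) ^ k * a⁻¹ = ((a * b) ^ k)⁻¹ := by
    rw [← conj_pow, h1, inv_pow]
  have h3 : a⁻¹ = a := (eq_inv_of_mul_eq_one_left ha).symm
  rw [h3] at h2
  rw [pow_two, ← mul_assoc, h2, inv_mul_cancel]

end TriangleGroup

/-- The rotation with cosine `c` and sine `s` about the third axis. -/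
def SO3.axialRotation (c s : ℝ) (h : c ^ 2 + s ^ 2 = 1) : SO3 :=
  SO3.ofMatrix !![c, -s, 0; s, c, 0; 0, 0, 1]
    (by
      ext i j
      fin_cases i <;> fin_cases j <;> simp [Matrix.mul_apply, Fin.sum_univ_three] <;> grind)
    (by simp [Matrix.det_fin_three]; linear_combination h)

theorem axial_basisFun (y : R3) : axial (EuclideanSpace.basisFun (Fin 3) ℝ) y = y 2 := by
  simp [axial, EuclideanSpace.inner_single_left]

theorem transverse_basisFun (ε : ℂ) (y : R3) :
    transverse (EuclideanSpace.basisFun (Fin 3) ℝ) ε y = y 0 + y 1 * ε := by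
  simp [transverse, EuclideanSpace.inner_single_left]

theorem SO3.axialRotation_isFrame {c s : ℝ} (h : c ^ 2 + s ^ 2 = 1) :
    (SO3.axialRotation c s h).IsFrame (EuclideanSpace.basisFun (Fin 3) ℝ) (c + s * Complex.I) := by
  refine ⟨?_, fun x => ?_, fun x => ?_⟩
  · rw [← sq_eq_sq₀ (norm_nonneg _) zero_le_one, Complex.sq_norm, Complex.normSq_add_mul_I]
    linear_combination h
  · rw [axial_basisFun, axial_basisFun]
    simp [SO3.rotate, SO3.axialRotation, SO3.ofMatrix, Matrix.toLpLin_apply,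
      dotProduct, Fin.sum_univ_three]
  · rw [transverse_basisFun, transverse_basisFun]
    simp [SO3.rotate, SO3.axialRotation, SO3.ofMatrix, Matrix.toLpLin_apply,
      dotProduct, Fin.sum_univ_three]
    linear_combination (-(s : ℂ) * ((x : R3) 1 : ℝ)) * Complex.I_sq

theorem SO3.halfTurn_sq : SO3.halfTurn ^ 2 = 1 := by
  apply SO3.ext_matrix
  simp [SO3.halfTurn, SO3.ofMatrix, pow_succ, Matrix.one_fin_three]

theorem SO3.axial_halfTurn (x : Sphere2) :
    axial (EuclideanSpace.basisFun (Fin 3) ℝ) (SO3.halfTurn.rotate x) =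
      -axial (EuclideanSpace.basisFun (Fin 3) ℝ) x := by
  rw [axial_basisFun, axial_basisFun]
  simp [SO3.rotate, SO3.halfTurn, SO3.ofMatrix, Matrix.toLpLin_apply,
    dotProduct, Fin.sum_univ_three]

theorem exists_embedding_dihedral {n : ℕ} (hn : 2 ≤ n) :
    ∃ ρ : TriangleGroup 2 2 n →* SO3, Function.Injective ρ := by
  let θ : ℝ := 2 * Real.pi / n
  let R := SO3.axialRotation (Real.cos θ) (Real.sin θ) (Real.cos_sq_add_sin_sq θ)
  let b := EuclideanSpace.basisFun (Fin 3) ℝ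
  have hR : R.IsFrame b (Complex.exp (2 * Real.pi * Complex.I / n)) := by
    have h := SO3.axialRotation_isFrame (Real.cos_sq_add_sin_sq θ)
    have e : (Real.cos θ : ℂ) + Real.sin θ * Complex.I =
        Complex.exp (2 * Real.pi * Complex.I / n) := by
      rw [Complex.ofReal_cos, Complex.ofReal_sin, ← Complex.exp_mul_I]
      congr 1
      simp only [θ]
      push_cast
      ring
    rwa [e] at h
  have hprim := Complex.isPrimitiveRoot_exp n (by omega)
  have hR1 : ∀ k : ℕ, R ^ k = 1 ↔ n ∣ k := fun k => by
    rw [← hR.pow_eq_one_iff, hprim.pow_eq_one_iff_dvd]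
  have h2 : (SO3.halfTurn * R) ^ 2 = 1 := by
    apply SO3.ext_matrix
    rw [pow_two]
    ext i j
    fin_cases i <;> fin_cases j <;>
      simp [R, SO3.axialRotation, SO3.halfTurn, SO3.ofMatrix] <;>
      grind [Real.sin_sq_add_cos_sq]
  have h3 : SO3.halfTurn * (SO3.halfTurn * R) = R := by
    rw [← mul_assoc, ← pow_two, SO3.halfTurn_sq, one_mul]
  let ρ : TriangleGroup 2 2 n →* SO3 := TriangleGroup.lift SO3.halfTurn (SO3.halfTurn * R)
    SO3.halfTurn_sq h2 (by rw [h3, hR1])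
  have hρa : ρ (TriangleGroup.α 2 2 n) = SO3.halfTurn := TriangleGroup.lift_α
  have hρb : ρ (TriangleGroup.β 2 2 n) = SO3.halfTurn * R := TriangleGroup.lift_β
  refine ⟨ρ, (injective_iff_map_eq_one ρ).mpr fun γ hγ => ?_⟩
  obtain ⟨k | k, rfl⟩ := (TriangleGroup.dihedralWord_bijective hn).2 γ
  · simp only [TriangleGroup.dihedralWord, Sum.elim_inl, map_pow, map_mul, hρa, hρb, h3] at hγ ⊢
    rwa [TriangleGroup.αβ_pow_eq_one_iff, ← hR1]
  · exfalso
    simp only [TriangleGroup.dihedralWord, Sum.elim_inr, map_pow, map_mul, hρa, hρb, h3] at hγ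
    -- At the pole, the axial rotation preserves the height 1 and the half turn changes its sign, so
    -- the product is not the identity.
    obtain ⟨x, hx, -, -⟩ := exists_sphere_point b (z := 1) (s := 0) (by norm_num)
      (ζ := 1) (by simp)
    have h4 := SO3.axial_halfTurn ((R ^ k.val).rotate x)
    rw [← SO3.rotate_mul, hγ, SO3.rotate_one, (hR.pow k.val).axial_eq, hx] at h4
    norm_num at h4

/-! ### The exact counting function of the dihedral family -/

theorem fejerSum_neg_one (L : ℕ) : fejerSum L (-1) = if Even L then 1 else 0 := by
  rw [fejerSum, neg_one_geom_sum]
  by_cases h : Even L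
  · have h' : ¬ Even (L + 1) := by rwa [Nat.even_add_one, not_not]
    simp [h, h']
  · have h' : Even (L + 1) := by rwa [Nat.even_add_one]
    simp [h, h']

/-- The number of pairs of integers in `[0, L]` that are congruent modulo `n`. -/
def congruentPairs (n L : ℕ) : ℕ :=
  ((Finset.range (L + 1) ×ˢ Finset.range (L + 1)).filter fun p => p.1 ≡ p.2 [MOD n]).card

theorem IsPrimitiveRoot.pow_mul_star_pow_eq_one_iff {n : ℕ} {ζ : ℂ} (h : IsPrimitiveRoot ζ n)
    (hζ : ‖ζ‖ = 1) (i j : ℕ) : ζ ^ i * star ζ ^ j = 1 ↔ i ≡ j [MOD n] := by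
  have hζ0 : ζ ≠ 0 := norm_ne_zero_iff.mp (by simp [hζ])
  have hs : star ζ = ζ⁻¹ := by
    rw [Complex.inv_def, Complex.normSq_eq_norm_sq, hζ]
    simp
  have e : ζ ^ i * star ζ ^ j = ζ ^ ((i : ℤ) - j) := by
    rw [hs, zpow_sub₀ hζ0, zpow_natCast, zpow_natCast, inv_pow, div_eq_mul_inv]
  rw [e, h.zpow_eq_one_iff_dvd, Nat.ModEq.comm, Nat.modEq_iff_dvd]

/-- Orthogonality of roots of unity: after expanding the squared modulus, the sum over k of
ζ^(k(i-j)) is n when i ≡ j mod n and 0 otherwise. -/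
theorem sum_fejerSum_pow {n : ℕ} {ζ : ℂ} (h : IsPrimitiveRoot ζ n) (hζ : ‖ζ‖ = 1) (L : ℕ) :
    ∑ k : Fin n, fejerSum L (ζ ^ k.val) = n * congruentPairs n L := by
  apply Complex.ofReal_injective
  have hsum : ∀ p : ℕ × ℕ, ∑ k : Fin n, (ζ ^ p.1 * star ζ ^ p.2) ^ k.val =
      if p.1 ≡ p.2 [MOD n] then (n : ℂ) else 0 := fun p => by
    rw [← Finset.sum_range fun k => (ζ ^ p.1 * star ζ ^ p.2) ^ k]
    split_ifs with hp
    · rw [(h.pow_mul_star_pow_eq_one_iff hζ _ _).mpr hp]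
      simp
    · rw [geom_sum_eq fun h1 => hp ((h.pow_mul_star_pow_eq_one_iff hζ _ _).mp h1)]
      have h1 : (ζ ^ p.1 * star ζ ^ p.2) ^ n = 1 := by
        rw [mul_pow, ← pow_mul, ← pow_mul, mul_comm p.1, mul_comm p.2, pow_mul, pow_mul, ← star_pow,
          h.pow_eq_one]
        simp
      rw [h1, sub_self, zero_div]
  have hf : ∀ k : Fin n, (fejerSum L (ζ ^ k.val) : ℂ) =
      ∑ p ∈ Finset.range (L + 1) ×ˢ Finset.range (L + 1), (ζ ^ p.1 * star ζ ^ p.2) ^ k.val :=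
    fun k => by
      rw [fejerSum, Complex.ofReal_pow, ← Complex.mul_conj', map_sum, Finset.sum_mul_sum,
        ← Finset.sum_product']
      refine Finset.sum_congr rfl fun p _ => ?_
      rw [map_pow, map_pow, starRingEnd_apply]
      ring
  push_cast
  simp only [hf]
  rw [Finset.sum_comm]
  simp only [hsum]
  rw [← Finset.sum_filter, Finset.sum_const, congruentPairs, nsmul_eq_mul, mul_comm]

/-- The reflection i ↦ M - i turns the congruence into divisibility of a number in (0, M] by n. -/
theorem card_congruent (n M : ℕ) :
    ((Finset.range M).filter fun i => i ≡ M [MOD n]).card = M / n := by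
  rw [← Nat.Ioc_filter_dvd_card_eq_div]
  refine Finset.card_bij' (fun i _ => M - i) (fun i _ => M - i) ?_ ?_ ?_ ?_
  · intro i hi
    simp only [Finset.mem_filter, Finset.mem_range, Finset.mem_Ioc] at hi ⊢
    exact ⟨by omega, (Nat.modEq_iff_dvd' hi.1.le).mp hi.2⟩
  · intro i hi
    simp only [Finset.mem_filter, Finset.mem_range, Finset.mem_Ioc] at hi ⊢
    refine ⟨by omega, (Nat.modEq_iff_dvd' (by omega)).mpr ?_⟩
    rw [Nat.sub_sub_self hi.1.2]
    exact hi.2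
  · intro i hi
    simp only [Finset.mem_filter, Finset.mem_range] at hi
    omega
  · intro i hi
    simp only [Finset.mem_filter, Finset.mem_Ioc] at hi
    omega

theorem congruentPairs_succ (n L : ℕ) :
    congruentPairs n (L + 1) = congruentPairs n L + 2 * ((L + 1) / n) + 1 := by
  have h : ∀ M, congruentPairs n M =
      ∑ i ∈ Finset.range (M + 1), ∑ j ∈ Finset.range (M + 1), if i ≡ j [MOD n] then 1 else 0 :=
    fun M => by
      rw [congruentPairs, Finset.card_filter, Finset.sum_product]
  have h1 : ∑ i ∈ Finset.range (L + 1), (if i ≡ L + 1 [MOD n] then 1 else 0) = (L + 1) / n := by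
    rw [← Finset.card_filter, card_congruent]
  have h2 : ∑ i ∈ Finset.range (L + 1), (if L + 1 ≡ i [MOD n] then 1 else 0) = (L + 1) / n := by
    simpa only [Nat.ModEq.comm] using h1
  rw [h, h, Finset.sum_range_succ]
  simp only [Finset.sum_range_succ _ (L + 1)]
  rw [Finset.sum_add_distrib, h1, h2, if_pos (Nat.ModEq.refl _)]
  ring

theorem sum_Icc_succ_div (n L : ℕ) :
    ∑ k ∈ Finset.Icc 1 ((L + 1) / n), (((L + 1 : ℕ) : ℤ) - k * n + 1) =
      ∑ k ∈ Finset.Icc 1 (L / n), ((L : ℤ) - k * n + 1) + ((L + 1) / n : ℕ) := by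
  have h1 : ∑ k ∈ Finset.Icc 1 ((L + 1) / n), (((L + 1 : ℕ) : ℤ) - k * n + 1) =
      ∑ k ∈ Finset.Icc 1 ((L + 1) / n), ((L : ℤ) - k * n + 1) + ((L + 1) / n : ℕ) := by
    have e : ∀ k : ℕ, (((L + 1 : ℕ) : ℤ) - k * n + 1) = ((L : ℤ) - k * n + 1) + 1 := fun k => by
      push_cast
      ring
    simp only [e]
    rw [Finset.sum_add_distrib]
    simp
  rw [h1, Nat.succ_div]
  split_ifs with hd
  -- When n divides L + 1 the range gains an index, whose summand before the shift by one is L -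
  -- (L+1) + 1 = 0.
  · rw [Finset.sum_Icc_succ_top (Nat.le_add_left 1 _)]
    have h2 : (L / n + 1) * n = L + 1 := by
      have h3 : (L + 1) / n = _ := Nat.succ_div
      rw [if_pos hd] at h3
      rw [← h3]
      exact Nat.div_mul_cancel hd
    have h2' : ((L / n + 1 : ℕ) : ℤ) * n = L + 1 := by exact_mod_cast h2
    rw [h2']
    ring
  · rfl

/-- Both sides grow by 2⌊(L+1)/n⌋, plus 2 when L + 1 is even: on the right the diagonal pair and the
parity term add up to 2 or cancel. -/
theorem two_mul_dihedral_count (n L : ℕ) :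
    2 * (1 + ((L / 2 : ℕ) : ℤ) + ∑ k ∈ Finset.Icc 1 (L / n), ((L : ℤ) - k * n + 1)) =
      congruentPairs n L + if Even L then 1 else 0 := by
  induction L with
  | zero => simp [congruentPairs, Nat.ModEq.refl, Finset.filter_singleton]
  | succ L ih =>
    rw [sum_Icc_succ_div n, congruentPairs_succ]
    by_cases h : Even L
    · have h' : ¬ Even (L + 1) := by rwa [Nat.even_add_one, not_not]
      rw [if_pos h] at ih
      rw [if_neg h']
      obtain ⟨m, rfl⟩ := h
      have e1 : (m + m + 1) / 2 = m := by omega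
      have e2 : (m + m) / 2 = m := by omega
      rw [e1]
      rw [e2] at ih
      push_cast at ih ⊢
      linarith
    · have h' : Even (L + 1) := by rwa [Nat.even_add_one]
      rw [if_neg h] at ih
      rw [if_pos h']
      obtain ⟨m, rfl⟩ := Nat.not_even_iff_odd.mp h
      have e1 : (2 * m + 1 + 1) / 2 = m + 1 := by omega
      have e2 : (2 * m + 1) / 2 = m := by omega
      rw [e1]
      rw [e2] at ih
      push_cast at ih ⊢
      linarith

theorem countingFunction_dihedral {n : ℕ} (hn : 2 ≤ n) {ρ : TriangleGroup 2 2 n →* SO3}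
    (hρ : Function.Injective ρ) (L : ℕ) :
    (countingFunction ρ ((L : ℝ) * (L + 1)) : ℤ) =
      1 + ((L / 2 : ℕ) : ℤ) + ∑ k ∈ Finset.Icc 1 (L / n), ((L : ℤ) - k * n + 1) := by
  have hfin := (TriangleGroup.card_le_dihedral hn).1
  have := Fintype.ofFinite (TriangleGroup 2 2 n)
  let W := Equiv.ofBijective _ (TriangleGroup.dihedralWord_bijective hn)
  obtain ⟨b, ζ, hζ⟩ :=
    SO3.exists_isFrame (ρ (TriangleGroup.α 2 2 n * TriangleGroup.β 2 2 n))
  -- Because ρ is injective, the rotation number of αβ has order exactly n.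
  have hprim : IsPrimitiveRoot ζ n := by
    have h1 : ∀ k : ℕ, ζ ^ k = 1 ↔ n ∣ k := fun k => by
      rw [hζ.pow_eq_one_iff, ← map_pow, map_eq_one_iff ρ hρ, TriangleGroup.αβ_pow_eq_one_iff]
    exact ⟨(h1 n).mpr dvd_rfl, fun k hk => (h1 k).mp hk⟩
  let ξ : Fin n ⊕ Fin n → ℂ := Sum.elim (fun k => ζ ^ k.val) fun _ => -1
  have hξ : ∀ γ, ∃ b, (ρ γ).IsFrame b (ξ (W.symm γ)) := fun γ => by
    obtain ⟨s, rfl⟩ := W.surjective γ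
    rw [Equiv.symm_apply_apply]
    rcases s with k | k
    · refine ⟨b, ?_⟩
      have h := hζ.pow k.val
      rw [← map_pow] at h
      exact h
    · obtain ⟨b', η, hη⟩ := SO3.exists_isFrame (ρ (W (Sum.inr k)))
      refine ⟨b', ?_⟩
      -- The remaining elements are nontrivial involutions, so their rotation number squares to 1
      -- without being 1, hence is -1.
      have h1 : η ^ 2 = 1 := by
        rw [hη.pow_eq_one_iff, ← map_pow]
        change ρ ((TriangleGroup.α 2 2 n * (TriangleGroup.α 2 2 n * TriangleGroup.β 2 2 n) ^
          k.val) ^ 2) = 1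
        rw [TriangleGroup.reflection_pow_two, map_one]
      have h2 : η ≠ 1 := fun h => by
        have h3 := (hη.pow_eq_one_iff 1).mp (by simpa using h)
        rw [pow_one, map_eq_one_iff ρ hρ] at h3
        have h4 : W (Sum.inr k) = W (Sum.inl ⟨0, by omega⟩) := by
          rw [h3]
          simp [W, TriangleGroup.dihedralWord]
        exact absurd (W.injective h4) (by simp)
      have h5 : η = -1 := (eq_or_eq_neg_of_sq_eq_sq η 1 (by rw [h1, one_pow])).resolve_left h2
      rw [h5] at hη
      exact hη
  have key := countingFunction_eq_sum ρ L hξ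
  rw [← Equiv.sum_comp W, TriangleGroup.dihedral_card hn] at key
  simp only [Equiv.symm_apply_apply] at key
  rw [Fintype.sum_sum_type] at key
  simp only [ξ, Sum.elim_inl, Sum.elim_inr] at key
  rw [sum_fejerSum_pow hprim hζ.norm_eq, fejerSum_neg_one, Finset.sum_const, Finset.card_univ,
    Fintype.card_fin, nsmul_eq_mul, ← mul_add] at key
  have hn0 : (n : ℝ) ≠ 0 := by
    have : 0 < n := by omega
    positivity
  have key2 : (2 * countingFunction ρ ((L : ℝ) * (L + 1)) : ℝ) =
      congruentPairs n L + if Even L then 1 else 0 := by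
    rw [key]
    push_cast
    field_simp
  have key3 : (2 * countingFunction ρ ((L : ℝ) * (L + 1)) : ℤ) =
      congruentPairs n L + if Even L then 1 else 0 := by
    exact_mod_cast key2
  rw [← two_mul_dihedral_count] at key3
  linarith

/-! ### Sums of sines -/

/-- Telescoping: sin θ sin((2l+1)θ) = sin²((l+1)θ) - sin²(lθ). -/
theorem sin_mul_sum_sin (θ : ℝ) (M : ℕ) :
    Real.sin θ * ∑ l ∈ Finset.range M, Real.sin ((2 * (l : ℝ) + 1) * θ) =
      Real.sin (M * θ) ^ 2 := by
  induction M with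
  | zero => simp
  | succ M ih =>
    rw [Finset.sum_range_succ, mul_add, ih]
    have e1 : (2 * (M : ℝ) + 1) * θ = M * θ + (M * θ + θ) := by ring
    have e2 : ((M + 1 : ℕ) : ℝ) * θ = M * θ + θ := by
      push_cast
      ring
    rw [e1, e2, Real.sin_add (M * θ) (M * θ + θ), Real.cos_add, Real.sin_add (M * θ) θ]
    linear_combination (-Real.sin (M * θ) ^ 2) * Real.sin_sq_add_cos_sq θ

theorem abs_sum_sin_div_le (θ : ℝ) (M : ℕ) :
    |∑ l ∈ Finset.range M, Real.sin ((2 * (l : ℝ) + 1) * θ) / Real.sin θ| ≤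
      1 / Real.sin θ ^ 2 := by
  rw [← Finset.sum_div]
  rcases eq_or_ne (Real.sin θ) 0 with h | h
  · simp [h]
  · have e : (∑ l ∈ Finset.range M, Real.sin ((2 * (l : ℝ) + 1) * θ)) / Real.sin θ =
        Real.sin (M * θ) ^ 2 / Real.sin θ ^ 2 := by
      rw [← sin_mul_sum_sin, pow_two, mul_div_mul_left _ _ h]
    rw [e, abs_of_nonneg (by positivity)]
    exact div_le_div_of_nonneg_right (Real.sin_sq_le_one _) (by positivity)

theorem exists_bound_sum_sin (n : ℕ) : ∃ C : ℝ, ∀ L : ℕ,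
    |∑ l ∈ Finset.range (L + 1), ∑ s ∈ Finset.Icc 1 (n - 1),
      Real.sin ((2 * (l : ℝ) + 1) * (s * Real.pi / n)) / Real.sin (s * Real.pi / n)| ≤ C := by
  refine ⟨∑ s ∈ Finset.Icc 1 (n - 1), 1 / Real.sin (s * Real.pi / n) ^ 2, fun L => ?_⟩
  rw [Finset.sum_comm]
  exact (Finset.abs_sum_le_sum_abs _ _).trans
    (Finset.sum_le_sum fun s _ => abs_sum_sin_div_le _ _)

/-! ### The main theorem -/

theorem mainTheorem8 :
    -- the Weyl law for all the spherical triangle groups, `m` being the order of the group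
    (∀ p q r m : ℕ,
      ((p = 2 ∧ q = 2 ∧ 2 ≤ r ∧ m = 2 * r) ∨
        (p = 2 ∧ q = 3 ∧ r = 3 ∧ m = 12) ∨
        (p = 2 ∧ q = 3 ∧ r = 4 ∧ m = 24) ∨
        (p = 2 ∧ q = 3 ∧ r = 5 ∧ m = 60)) →
      Nat.card (TriangleGroup p q r) = m ∧
      (∃ ρ : TriangleGroup p q r →* SO3, Function.Injective ρ) ∧
      ∀ ρ : TriangleGroup p q r →* SO3, Function.Injective ρ →
        (∀ ev : ℝ, FiniteDimensional ℂ (quotientEigenspace ρ ev)) ∧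
        (∀ bound : ℝ, {ev : ℝ | ev ≤ bound ∧ quotientEigenspace ρ ev ≠ ⊥}.Finite) ∧
        ∃ C : ℝ, ∀ L : ℕ,
          |(countingFunction ρ ((L : ℝ) * (L + 1)) : ℝ) - ((L : ℝ) + 1) ^ 2 / m| ≤ C) ∧
    -- the exact counting function of the dihedral family
    (∀ n : ℕ, 2 ≤ n → ∀ ρ : TriangleGroup 2 2 n →* SO3, Function.Injective ρ → ∀ L : ℕ,
      (countingFunction ρ ((L : ℝ) * (L + 1)) : ℤ) =
        1 + ((L / 2 : ℕ) : ℤ) + ∑ k ∈ Finset.Icc 1 (L / n), ((L : ℤ) - k * n + 1)) ∧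
    -- the oscillating terms remain bounded when summed over `l`
    (∀ n : ℕ, 2 ≤ n → ∃ C : ℝ, ∀ L : ℕ,
      |∑ l ∈ Finset.range (L + 1), ∑ s ∈ Finset.Icc 1 (n - 1),
        Real.sin ((2 * (l : ℝ) + 1) * (s * Real.pi / n)) / Real.sin (s * Real.pi / n)| ≤ C) := by
  refine ⟨fun p q r m h => ?_, fun n hn ρ hρ L => countingFunction_dihedral hn hρ L,
    fun n _ => exists_bound_sum_sin n⟩
  have hgroup : Finite (TriangleGroup p q r) ∧ Nat.card (TriangleGroup p q r) = m ∧
      ∃ ρ : TriangleGroup p q r →* SO3, Function.Injective ρ := by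
    rcases h with ⟨rfl, rfl, hr, rfl⟩ | ⟨rfl, rfl, rfl, rfl⟩ | ⟨rfl, rfl, rfl, rfl⟩ |
      ⟨rfl, rfl, rfl, rfl⟩
    · exact ⟨(TriangleGroup.card_le_dihedral hr).1, TriangleGroup.dihedral_card hr,
        exists_embedding_dihedral hr⟩
    · exact ⟨TriangleGroup.card_le_tetrahedral.1,
        TriangleGroup.tetrahedral_card_and_injective.1, exists_embedding_tetrahedral⟩
    · exact ⟨TriangleGroup.card_le_octahedral.1,
        TriangleGroup.octahedral_card_and_injective.1, exists_embedding_octahedral⟩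
    · exact ⟨TriangleGroup.card_le_icosahedral.1,
        TriangleGroup.icosahedral_card_and_injective.1, exists_embedding_icosahedral⟩
  obtain ⟨hfin, hcard, hex⟩ := hgroup
  refine ⟨hcard, hex, fun ρ hρ => ⟨fun ev => inferInstance, quotientEigenspace_finite ρ, ?_⟩⟩
  rw [← hcard]
  exact exists_weyl_bound hρ
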